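/- Let $T>0$, $Q_T=(0,T)\times(0,1)$, $x_0\in(0,1)$, $c\in L^\infty(Q_T)$, and let $a:[0,1]\to\mathbb R$ satisfy $a(x_0)=0$, $a>0$ on $[0,1]\setminus\{x_0\}$, and, for some $K$, $(x-x_0)a'\le Ka$ a.e. in $[0,1]$, where either (WD) $K\in(0,1)$ and $a\in W^{1,1}(0,1)$, or (SD) $K\in[1,2)$ and $a\in W^{1,\infty}(0,1)$. Consider, for $\vartheta\in(0,K]$, the condition (M$_\vartheta$) the map $x\mapsto a(x)/|x-x_0|^{\vartheta}$ is nonincreasing on the left and nondecreasing on the right of $x_0$. Put $\Theta(t)=[t(T-t)]^{-4}$ and $\varphi(t,x)=\Theta(t)\psi(x)$, with $\psi$ specified below. **Spaces.** $\mathcal H^1_a$ is the set of $u$ with $u(0)=u(1)=0$ and $\sqrt a\,u'\in L^2(0,1)$ that are absolutely continuous on $[0,1]$ in case (WD), and that are in $L^2(0,1)$ and locally absolutely continuous on $[0,x_0)\cup(x_0,1]$ in case (SD); $\mathcal H^2_a=\{u\in\mathcal H^1_a: au'\in H^1(0,1)\}$; the norms are $\|u\|^2_{\mathcal H^1_a}=\|u\|^2_{L^2}+\|\sqrt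 a u'\|^2_{L^2}$ and $\|u\|^2_{\mathcal H^2_a}=\|u\|^2_{\mathcal H^1_a}+\|(au')'\|^2_{L^2}$. Further, $L^2_{1/a}=\{u\in L^2(0,1):\|u\|^2_{L^2_{1/a}}=\int_0^1u^2/a\,dx<\infty\}$, $\mathcal H^1_{1/a}=L^2_{1/a}\cap H^1_0(0,1)$ and $\mathcal H^2_{1/a}=\{u\in\mathcal H^1_{1/a}:u'\in H^1(0,1)\}$, with $\|u\|^2_{\mathcal H^1_{1/a}}=\|u\|^2_{L^2_{1/a}}+\|u'\|^2_{L^2}$ and $\|u\|^2_{\mathcal H^2_{1/a}}=\|u\|^2_{\mathcal H^1_{1/a}}+\|au''\|^2_{L^2_{1/a}}$. Let $$\mathcal S_1=L^2(0,T;\mathcal H^2_a)\cap H^1(0,T;\mathcal H^1_a),\qquad \mathcal S_2=L^2(0,T;\mathcal H^2_{1/a})\cap H^1(0,T;\mathcal H^1_{1/a}).$$ **(1) Divergence form.** If $K>\frac43$, assume that (M$_\vartheta$) holds for some $\vartheta\in(0,K]$ and, if moreover $K>\frac32$, that for this $\vartheta$ the map in (M$_\vartheta$) is bounded below away from $0$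 and $|a'(x)|\le\Sigma|x-x_0|^{2\vartheta-3}$ a.e. in $[0,1]$ for some $\Sigma>0$. Let $c_1>0$, $c_2>\max\left\{\frac{(1-x_0)^2}{a(1)(2-K)},\frac{x_0^2}{a(0)(2-K)}\right\}$ and $$\psi(x)=c_1\left[\int_{x_0}^x\frac{y-x_0}{a(y)}\,dy-c_2\right].$$ Then there are constants $C>0$ and $s_0>0$ such that every solution $v\in\mathcal S_1$ of $v_t+(av_x)_x-cv=h$ in $Q_T$, $v(t,0)=v(t,1)=0$, where $h\in L^2(Q_T)$, satisfies for all $s\ge s_0$ $$\int_{Q_T}\left(s\Theta a(v_x)^2+s^3\Theta^3\frac{(x-x_0)^2}{a}v^2\right)e^{2s\varphi}\,dx\,dt\le C\left(\int_{Q_T}h^2e^{2s\varphi}\,dx\,dt+sc_1\int_0^T\Big[a\Theta e^{2s\varphi}(x-x_0)(v_x)^2\Big]_{x=0}^{x=1}dt\right).$$ **(2) Non divergence form.** Assume that $\frac{(x-x_0)a'(x)}{a(x)}\in W^{1,\infty}(0,1)$ and, if $K\ge\frac12$, that (M$_\vartheta$) holds for some $\vartheta\in(0,K]$. Let $R>0$,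 $d_1>0$, $d_2>\max\left\{\frac{(1-x_0)^2e^{R(1-x_0)^2}}{(2-K)a(1)},\frac{x_0^2e^{Rx_0^2}}{(2-K)a(0)}\right\}$ and $$\psi(x)=d_1\left(\int_{x_0}^x\frac{y-x_0}{a(y)}e^{R(y-x_0)^2}\,dy-d_2\right).$$ Then there are constants $C>0$ and $s_0>0$ such that every solution $v\in\mathcal S_2$ of $v_t+av_{xx}-cv=h$ in $Q_T$, $v(t,0)=v(t,1)=0$, where $h\in L^2(0,T;L^2_{1/a})$, satisfies for all $s\ge s_0$ $$\int_{Q_T}\left(s\Theta(v_x)^2+s^3\Theta^3\left(\frac{x-x_0}{a}\right)^2v^2\right)e^{2s\varphi}\,dx\,dt\le C\left(\int_{Q_T}h^2\frac{e^{2s\varphi}}{a}\,dx\,dt+sd_1\int_0^T\Big[\Theta e^{2s\varphi}(x-x_0)(v_x)^2\Big]_{x=0}^{x=1}dt\right).$$ In both inequalities all integrals are finite. The constants $C$ and $s_0$ do not depend on $v$, $h$ and $s$. -/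

import Mathlib

open MeasureTheory Set

noncomputable section

namespace DegenerateCarleman

/-! ### Sobolev spaces on the interval `(0,1)` -/

/-- Lebesgue measure on `(0,1)`. -/
def muI : Measure ℝ := volume.restrict (Ioo 0 1)

/-- The cylinder `Q_T = (0,T) × (0,1)`; points are pairs `(t, x)`. -/
def cyl (T : ℝ) : Set (ℝ × ℝ) := Ioo 0 T ×ˢ Ioo 0 1

/-- Lebesgue measure on `Q_T`. -/
def muQ (T : ℝ) : Measure (ℝ × ℝ) := volume.restrict (cyl T)

/-- The derivative of a function on `[0,1]` (one-sided at the two end points). -/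
def Dx (u : ℝ → ℝ) (x : ℝ) : ℝ := derivWithin u (Icc 0 1) x

theorem Dx_eq_deriv (u : ℝ → ℝ) {x : ℝ} (hx : x ∈ Ioo (0 : ℝ) 1) : Dx u x = deriv u x :=
  derivWithin_of_mem_nhds (Icc_mem_nhds hx.1 hx.2)

/-- `u` is the continuous representative of an element of `W^{1,p}(0,1)`: it is absolutely
continuous on `[0,1]` with derivative in `L^p(0,1)`. -/
def MemW1 (p : ENNReal) (u : ℝ → ℝ) : Prop :=
  AbsolutelyContinuousOnInterval u 0 1 ∧ MemLp (Dx u) p muI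

/-- The class of `f` modulo almost everywhere equality belongs to `W^{1,p}(0,1)`. -/
def MemW1ae (p : ENNReal) (f : ℝ → ℝ) : Prop :=
  ∃ G : ℝ → ℝ, MemW1 p G ∧ f =ᵐ[muI] G

/-! ### Degenerate coefficients -/

/-- Weakly degenerate coefficient. -/
structure WeaklyDegenerate (a : ℝ → ℝ) (x₀ K : ℝ) : Prop where
  x₀_mem : x₀ ∈ Ioo (0 : ℝ) 1
  K_mem : K ∈ Ioo (0 : ℝ) 1
  zero : a x₀ = 0
  pos : ∀ x ∈ Icc (0 : ℝ) 1, x ≠ x₀ → 0 < a x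
  sobolev : MemW1 1 a
  deriv_le : ∀ᵐ x ∂muI, (x - x₀) * Dx a x ≤ K * a x

/-- Strongly degenerate coefficient. -/
structure StronglyDegenerate (a : ℝ → ℝ) (x₀ K : ℝ) : Prop where
  x₀_mem : x₀ ∈ Ioo (0 : ℝ) 1
  K_mem : K ∈ Ico (1 : ℝ) 2
  zero : a x₀ = 0
  pos : ∀ x ∈ Icc (0 : ℝ) 1, x ≠ x₀ → 0 < a x
  sobolev : MemW1 ⊤ a
  deriv_le : ∀ᵐ x ∂muI, (x - x₀) * Dx a x ≤ K * a x

/-- `x ↦ a(x) / |x - x₀|^ϑ` is nonincreasing on the left of `x₀` and nondecreasing on the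
right of `x₀`. -/
def MonotoneQuotient (a : ℝ → ℝ) (x₀ ϑ : ℝ) : Prop :=
  AntitoneOn (fun x => a x / |x - x₀| ^ ϑ) (Ico 0 x₀) ∧
    MonotoneOn (fun x => a x / |x - x₀| ^ ϑ) (Ioc x₀ 1)

/-- The assumption on the coefficient for the problem in divergence form. (A weakly degenerate
coefficient has `K < 1`, so the last clause only concerns the strongly degenerate case.) -/
def DivergenceHypothesis (a : ℝ → ℝ) (x₀ K : ℝ) : Prop :=
  (WeaklyDegenerate a x₀ K ∨ StronglyDegenerate a x₀ K) ∧
    (4 / 3 < K → ∃ ϑ ∈ Ioc (0 : ℝ) K, MonotoneQuotient a x₀ ϑ ∧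
      (3 / 2 < K →
        (∃ m > 0, ∀ x ∈ Icc (0 : ℝ) 1, x ≠ x₀ → m ≤ a x / |x - x₀| ^ ϑ) ∧
        ∃ S > 0, ∀ᵐ x ∂muI, |Dx a x| ≤ S * |x - x₀| ^ (2 * ϑ - 3)))

/-- The assumption on the coefficient for the problem in non divergence form. -/
def NonDivergenceHypothesis (a : ℝ → ℝ) (x₀ K : ℝ) : Prop :=
  (WeaklyDegenerate a x₀ K ∨ StronglyDegenerate a x₀ K) ∧
    MemW1ae ⊤ (fun x => (x - x₀) * Dx a x / a x) ∧
    (1 / 2 ≤ K → ∃ ϑ ∈ Ioc (0 : ℝ) K, MonotoneQuotient a x₀ ϑ)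

/-! ### Weighted spaces, divergence form -/

/-- `𝓗¹_a(0,1)`: in the weakly degenerate case (`K < 1`) its elements are absolutely continuous on
`[0,1]`; in the strongly degenerate case (`1 ≤ K`) they are square integrable and locally
absolutely continuous on `[0,x₀) ∪ (x₀,1]`. In both cases `√a u' ∈ L²` and `u(0) = u(1) = 0`. -/
def MemH1a (a : ℝ → ℝ) (x₀ K : ℝ) (u : ℝ → ℝ) : Prop :=
  (K < 1 → AbsolutelyContinuousOnInterval u 0 1) ∧
  (1 ≤ K → MemLp u 2 muI ∧
    (∀ y ∈ Ioo 0 x₀, AbsolutelyContinuousOnInterval u 0 y) ∧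
    (∀ y ∈ Ioo x₀ 1, AbsolutelyContinuousOnInterval u y 1)) ∧
  MemLp (fun x => √(a x) * Dx u x) 2 muI ∧ u 0 = 0 ∧ u 1 = 0

/-- `𝓗²_a(0,1)`: elements `u` of `𝓗¹_a(0,1)` with `a u' ∈ H¹(0,1)`. -/
def MemH2a (a : ℝ → ℝ) (x₀ K : ℝ) (u : ℝ → ℝ) : Prop :=
  MemH1a a x₀ K u ∧ MemW1ae 2 (fun x => a x * Dx u x)

/-- `L²(0,T; 𝓗¹_a(0,1))`, with `‖u‖² = ‖u‖²_{L²} + ‖√a u'‖²_{L²}` on `𝓗¹_a(0,1)`. -/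
structure MemL2H1a (T : ℝ) (a : ℝ → ℝ) (x₀ K : ℝ) (u : ℝ → ℝ → ℝ) : Prop where
  mem : ∀ᵐ t ∂(volume.restrict (Ioo 0 T)), MemH1a a x₀ K (u t)
  sq : MemLp (fun p : ℝ × ℝ => u p.1 p.2) 2 (muQ T)
  sq_dx : MemLp (fun p : ℝ × ℝ => √(a p.2) * Dx (u p.1) p.2) 2 (muQ T)

/-- `L²(0,T; 𝓗²_a(0,1))`, with `‖u‖² = ‖u‖²_{𝓗¹_a} + ‖(a u')'‖²_{L²}` on `𝓗²_a(0,1)`. -/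
structure MemL2H2a (T : ℝ) (a : ℝ → ℝ) (x₀ K : ℝ) (u : ℝ → ℝ → ℝ) : Prop where
  mem : ∀ᵐ t ∂(volume.restrict (Ioo 0 T)), MemH2a a x₀ K (u t)
  sq : MemLp (fun p : ℝ × ℝ => u p.1 p.2) 2 (muQ T)
  sq_dx : MemLp (fun p : ℝ × ℝ => √(a p.2) * Dx (u p.1) p.2) 2 (muQ T)
  sq_dxx : MemLp (fun p : ℝ × ℝ => Dx (fun y => a y * Dx (u p.1) y) p.2) 2 (muQ T)

/-! ### Weighted spaces, non divergence form -/

/-- `𝓗¹_{1/a}(0,1) = L²_{1/a}(0,1) ∩ H¹₀(0,1)`. -/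
def MemH1inv (a : ℝ → ℝ) (u : ℝ → ℝ) : Prop :=
  MemW1 2 u ∧ u 0 = 0 ∧ u 1 = 0 ∧ MemLp (fun x => u x / √(a x)) 2 muI

/-- `𝓗²_{1/a}(0,1)`: elements `u` of `𝓗¹_{1/a}(0,1)` with `u' ∈ H¹(0,1)`. -/
def MemH2inv (a : ℝ → ℝ) (u : ℝ → ℝ) : Prop :=
  MemH1inv a u ∧ MemW1ae 2 (Dx u)

/-- `L²(0,T; 𝓗¹_{1/a}(0,1))`, with `‖u‖² = ‖u‖²_{L²_{1/a}} + ‖u'‖²_{L²}` on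
`𝓗¹_{1/a}(0,1)`. -/
structure MemL2H1inv (T : ℝ) (a : ℝ → ℝ) (u : ℝ → ℝ → ℝ) : Prop where
  mem : ∀ᵐ t ∂(volume.restrict (Ioo 0 T)), MemH1inv a (u t)
  sq : MemLp (fun p : ℝ × ℝ => u p.1 p.2 / √(a p.2)) 2 (muQ T)
  sq_dx : MemLp (fun p : ℝ × ℝ => Dx (u p.1) p.2) 2 (muQ T)

/-- `L²(0,T; 𝓗²_{1/a}(0,1))`, with `‖u‖² = ‖u‖²_{𝓗¹_{1/a}} + ‖a u''‖²_{L²_{1/a}}` on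
`𝓗²_{1/a}(0,1)`; note that `‖a u''‖²_{L²_{1/a}} = ‖√a u''‖²_{L²}`. -/
structure MemL2H2inv (T : ℝ) (a : ℝ → ℝ) (u : ℝ → ℝ → ℝ) : Prop where
  mem : ∀ᵐ t ∂(volume.restrict (Ioo 0 T)), MemH2inv a (u t)
  sq : MemLp (fun p : ℝ × ℝ => u p.1 p.2 / √(a p.2)) 2 (muQ T)
  sq_dx : MemLp (fun p : ℝ × ℝ => Dx (u p.1) p.2) 2 (muQ T)
  sq_dxx : MemLp (fun p : ℝ × ℝ => √(a p.2) * Dx (Dx (u p.1)) p.2) 2 (muQ T)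

/-! ### Solutions -/

/-- `v(t) = v(0) + ∫₀ᵗ g(τ) dτ` for all `t ∈ [0,T]`, so that `g` is the time derivative of `v`.
The identity is one in a space (`𝓗¹_a` or `𝓗¹_{1/a}`) on which the evaluation at each point of
`[0,1]` other than `x₀` is continuous, so it may be read pointwise at these points. -/
def HasTimeDeriv (T x₀ : ℝ) (v g : ℝ → ℝ → ℝ) : Prop :=
  ∀ t ∈ Icc 0 T, ∀ x ∈ Icc (0 : ℝ) 1, x ≠ x₀ →
    IntervalIntegrable (fun τ => g τ x) volume 0 t ∧ v t x = v 0 x + ∫ τ in (0 : ℝ)..t, g τ x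

/-- `v`, with time derivative `vt`, belongs to
`𝓢₁ = L²(0,T; 𝓗²_a(0,1)) ∩ H¹(0,T; 𝓗¹_a(0,1))`. As usual, `v` stands for the representative
which is continuous in time with values in `𝓗¹_a(0,1)`. -/
structure MemS1 (T : ℝ) (a : ℝ → ℝ) (x₀ K : ℝ) (v vt : ℝ → ℝ → ℝ) : Prop where
  memL2 : MemL2H2a T a x₀ K v
  mem : ∀ t ∈ Icc 0 T, MemH1a a x₀ K (v t)
  memL2_dt : MemL2H1a T a x₀ K vt
  dt : HasTimeDeriv T x₀ v vt

/-- `v`, with time derivative `vt`, belongs to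
`𝓢₂ = H¹(0,T; 𝓗¹_{1/a}(0,1)) ∩ L²(0,T; 𝓗²_{1/a}(0,1))`. -/
structure MemS2 (T : ℝ) (a : ℝ → ℝ) (x₀ : ℝ) (v vt : ℝ → ℝ → ℝ) : Prop where
  memL2 : MemL2H2inv T a v
  mem : ∀ t ∈ Icc 0 T, MemH1inv a (v t)
  memL2_dt : MemL2H1inv T a vt
  dt : HasTimeDeriv T x₀ v vt

/-- `v` is a solution in `𝓢₁` of `v_t + (a v_x)_x - c v = h` in `Q_T`, `v(t,0) = v(t,1) = 0`
(the boundary conditions are part of the membership in `𝓢₁`). -/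
def IsDivSolution (T : ℝ) (a : ℝ → ℝ) (x₀ K : ℝ) (c h v : ℝ → ℝ → ℝ) : Prop :=
  ∃ vt : ℝ → ℝ → ℝ, MemS1 T a x₀ K v vt ∧
    ∀ᵐ p ∂(muQ T),
      vt p.1 p.2 + Dx (fun y => a y * Dx (v p.1) y) p.2 - c p.1 p.2 * v p.1 p.2 = h p.1 p.2

/-- `v` is a solution in `𝓢₂` of `v_t + a v_xx - c v = h` in `Q_T`, `v(t,0) = v(t,1) = 0`
(the boundary conditions are part of the membership in `𝓢₂`). -/
def IsNonDivSolution (T : ℝ) (a : ℝ → ℝ) (x₀ : ℝ) (c h v : ℝ → ℝ → ℝ) : Prop :=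
  ∃ vt : ℝ → ℝ → ℝ, MemS2 T a x₀ v vt ∧
    ∀ᵐ p ∂(muQ T),
      vt p.1 p.2 + a p.2 * Dx (Dx (v p.1)) p.2 - c p.1 p.2 * v p.1 p.2 = h p.1 p.2

/-! ### Weight functions -/

/-- `Θ(t) = [t (T - t)]⁻⁴`. -/
def Theta (T t : ℝ) : ℝ := 1 / (t * (T - t)) ^ 4

/-- `ψ` for the problem in divergence form. -/
def psiDiv (a : ℝ → ℝ) (x₀ c₁ c₂ x : ℝ) : ℝ :=
  c₁ * ((∫ y in x₀..x, (y - x₀) / a y) - c₂)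

/-- `ψ` for the problem in non divergence form. -/
def psiNonDiv (a : ℝ → ℝ) (x₀ d₁ d₂ R x : ℝ) : ℝ :=
  d₁ * ((∫ y in x₀..x, (y - x₀) / a y * Real.exp (R * (y - x₀) ^ 2)) - d₂)

/-- The weight `e^{2sφ}`, where `φ(t,x) = Θ(t) ψ(x)`. -/
def expWeight (T : ℝ) (ψ : ℝ → ℝ) (s t x : ℝ) : ℝ :=
  Real.exp (2 * s * (Theta T t * ψ x))

/-! ### The Carleman inequalities -/

/-- `[F]_{x=0}^{x=1}`. -/
def bracket (F : ℝ → ℝ) : ℝ := F 1 - F 0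

/-- The Carleman inequality for the problem in divergence form, with parameter `s` and constant
`C`; all the integrals in it are required to exist. -/
def CarlemanDiv (T : ℝ) (a : ℝ → ℝ) (x₀ c₁ c₂ C s : ℝ) (h v : ℝ → ℝ → ℝ) : Prop :=
  let E : ℝ → ℝ → ℝ := expWeight T (psiDiv a x₀ c₁ c₂) s
  let L : ℝ × ℝ → ℝ := fun p =>
    (s * Theta T p.1 * a p.2 * Dx (v p.1) p.2 ^ 2
      + s ^ 3 * Theta T p.1 ^ 3 * ((p.2 - x₀) ^ 2 / a p.2) * v p.1 p.2 ^ 2) * E p.1 p.2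
  let H : ℝ × ℝ → ℝ := fun p => h p.1 p.2 ^ 2 * E p.1 p.2
  let B : ℝ → ℝ := fun t =>
    bracket (fun x => a x * Theta T t * E t x * (x - x₀) * Dx (v t) x ^ 2)
  Integrable L (muQ T) ∧ Integrable H (muQ T) ∧ IntervalIntegrable B volume 0 T ∧
    ∫ p, L p ∂(muQ T) ≤ C * ((∫ p, H p ∂(muQ T)) + s * c₁ * ∫ t in (0 : ℝ)..T, B t)

/-- The Carleman inequality for the problem in non divergence form, with parameter `s` and
constant `C`; all the integrals in it are required to exist. -/
def CarlemanNonDiv (T : ℝ) (a : ℝ → ℝ) (x₀ d₁ d₂ R C s : ℝ) (h v : ℝ → ℝ → ℝ) : Prop :=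
  let E : ℝ → ℝ → ℝ := expWeight T (psiNonDiv a x₀ d₁ d₂ R) s
  let L : ℝ × ℝ → ℝ := fun p =>
    (s * Theta T p.1 * Dx (v p.1) p.2 ^ 2
      + s ^ 3 * Theta T p.1 ^ 3 * ((p.2 - x₀) / a p.2) ^ 2 * v p.1 p.2 ^ 2) * E p.1 p.2
  let H : ℝ × ℝ → ℝ := fun p => h p.1 p.2 ^ 2 * (E p.1 p.2 / a p.2)
  let B : ℝ → ℝ := fun t =>
    bracket (fun x => Theta T t * E t x * (x - x₀) * Dx (v t) x ^ 2)
  Integrable L (muQ T) ∧ Integrable H (muQ T) ∧ IntervalIntegrable B volume 0 T ∧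
    ∫ p, L p ∂(muQ T) ≤ C * ((∫ p, H p ∂(muQ T)) + s * d₁ * ∫ t in (0 : ℝ)..T, B t)

end DegenerateCarleman

end

open MeasureTheory Set Filter Topology

noncomputable section

namespace DegenerateCarleman

section

/-! ### Absolute continuity away from a point -/

/-! Both inequalities are instances of one estimate for `v_t + ρ⁻¹ (A v_x)_x - c v = h`, with `A =
a`, `ρ = 1` in divergence form and `A = 1`, `ρ = 1/a` in non divergence form. The weight satisfies
`ψ' = d κ / A` with `κ = γ ρ A`. Put `z = e^{sφ} v` and `l = s Θ d`. After conjugation the operator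
splits into a symmetric part `X = ρ⁻¹ (A z_x)_x + l² κ γ z - s φ_t z` and a skew part `Y = z_t - 2 l
(κ/ρ) z_x - l M z`, where `M = κ'/ρ`, and `X + Y = e^{sφ} (h + c v)`. Since `4 X Y ≤ (X + Y)²`, a
lower bound for the integral of `ρ X Y` is enough. By `carleman_identity`, this product is a space
derivative (of a flux) plus a time derivative (of an energy) plus the principal terms `D (l A z_x² +
l³ (κ²/A) z²)` plus lower order terms, where `D = M + A γ'`. In both cases `(x - x₀) a' ≤ K a`
yields `D ≥ 2 - K > 0`. The only further derivative needed is `M'`: it vanishes in divergence form,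
and it is bounded in non divergence form because `(x - x₀) a'/a` is Lipschitz.

Several lower order terms are of size `ε l² ρ z²`, with `ε` as small as desired for large `s`. Near
`x₀` the coefficient `κ²/A` degenerates, so they cannot be absorbed pointwise. An inequality of
Hardy type, `∫ l² ρ z² ≤ N ∫ (l A z_x² + l³ (κ²/A) z²)`, is obtained by adding the exact derivative
of `l^n k z²` for a suitable multiplier `k`. In divergence form `k = x - x₀`; in non divergence form
`k` is a multiple of `(x - x₀)/a` if `K < 1`, and `-1/(x - x₀)` if `1 ≤ K`
(`exists_coercive_multiplier`).

The functions are absolutely continuous only away from `x₀`, so every integration by parts in space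
is done on both sides of `x₀` (`LocACDeriv.sub_le_integral`). The energy density is integrable while
`1/|x - x₀|` is not, hence `|x - x₀|` times the density tends to zero along some sequence on each
side. Along such sequences the flux has the same limit from the left and from the right, and the two
contributions cancel. At `x = 0` and `x = 1` the flux reduces to `-l γ (A v_x)²`, the observed
boundary term. In time, `ψ` is bounded above by a negative constant, so the exponential kills all
powers of `Θ` at `t = 0` and `t = T`, and the energy derivative integrates to zero
(`integral_sEnergyD_eq_zero`). This uses that `v_x` is absolutely continuous in time with derivative
`v_{tx}`, which is `HasTimeDeriv.time_regular`. -/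

theorem _root_.AbsolutelyContinuousOnInterval.of_dist_le {f g : ℝ → ℝ} {a b C : ℝ}
    (hf : AbsolutelyContinuousOnInterval f a b)
    (h : ∀ x ∈ uIcc a b, ∀ y ∈ uIcc a b, dist (g x) (g y) ≤ C * dist (f x) (f y)) :
    AbsolutelyContinuousOnInterval g a b := by
  unfold AbsolutelyContinuousOnInterval at hf ⊢
  apply squeeze_zero' ?_ ?_ (by simpa using hf.const_mul C)
  · exact Filter.Eventually.of_forall fun _ ↦ Finset.sum_nonneg (fun i hi ↦ dist_nonneg)
  rw [eventually_inf_principal]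
  filter_upwards with E hE
  rw [Finset.mul_sum]
  gcongr with i hi
  exact h _ (hE.1 i hi).1 _ (hE.1 i hi).2

theorem _root_.AbsolutelyContinuousOnInterval.congr {f g : ℝ → ℝ} {a b : ℝ}
    (hf : AbsolutelyContinuousOnInterval f a b) (h : ∀ x ∈ uIcc a b, g x = f x) :
    AbsolutelyContinuousOnInterval g a b :=
  hf.of_dist_le (C := 1) fun x hx y hy => by rw [h x hx, h y hy, one_mul]

theorem _root_.AbsolutelyContinuousOnInterval.comp_contDiff {f F : ℝ → ℝ} {a b : ℝ}
    (hf : AbsolutelyContinuousOnInterval f a b) (hF : ContDiff ℝ 1 F) :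
    AbsolutelyContinuousOnInterval (fun x => F (f x)) a b := by
  obtain ⟨C, hC⟩ := hf.exists_bound
  obtain ⟨K, hK⟩ := hF.contDiffOn.exists_lipschitzOnWith (s := Icc (-C) C) (by decide)
    (convex_Icc _ _) isCompact_Icc
  refine hf.of_dist_le (C := K) fun x hx y hy => hK.dist_le_mul _ ?_ _ ?_
  · exact abs_le.1 (hC x hx)
  · exact abs_le.1 (hC y hy)

/-- By compactness `f` is bounded below by its positive minimum `f z`, and inversion is Lipschitz
with constant `(f z)⁻²` on the range of `f`. -/
theorem _root_.AbsolutelyContinuousOnInterval.fun_inv {f : ℝ → ℝ} {a b : ℝ}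
    (hf : AbsolutelyContinuousOnInterval f a b) (h : ∀ x ∈ uIcc a b, 0 < f x) :
    AbsolutelyContinuousOnInterval (fun x => (f x)⁻¹) a b := by
  obtain ⟨z, hz, hz'⟩ := isCompact_uIcc.exists_isMinOn (nonempty_uIcc (a := a) (b := b))
    hf.continuousOn
  refine hf.of_dist_le (C := (f z * f z)⁻¹) fun x hx y hy => ?_
  have h1 := h x hx
  have h2 := h y hy
  have h3 := h z hz
  have h4 : f z ≤ f x := hz' hx
  have h5 : f z ≤ f y := hz' hy
  rw [Real.dist_eq, Real.dist_eq, inv_sub_inv h1.ne' h2.ne', abs_div, abs_sub_comm,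
    abs_of_pos (mul_pos h1 h2), div_eq_inv_mul]
  gcongr

theorem _root_.AbsolutelyContinuousOnInterval.intervalIntegrable_of_hasDerivAt
    {f f' : ℝ → ℝ} {a b : ℝ} (hf : AbsolutelyContinuousOnInterval f a b) (hab : a ≤ b)
    (h : ∀ᵐ x ∂volume.restrict (Ioo a b), HasDerivAt f (f' x) x) :
    IntervalIntegrable f' volume a b := by
  refine hf.intervalIntegrable_deriv.congr_ae ?_
  rw [uIoc_of_le hab, ← restrict_Ioo_eq_restrict_Ioc]
  filter_upwards [h] with x hx using hx.deriv

theorem _root_.AbsolutelyContinuousOnInterval.integral_eq_sub_of_hasDerivAt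
    {f f' : ℝ → ℝ} {a b : ℝ} (hf : AbsolutelyContinuousOnInterval f a b) (hab : a ≤ b)
    (h : ∀ᵐ x ∂volume.restrict (Ioo a b), HasDerivAt f (f' x) x) :
    ∫ x in a..b, f' x = f b - f a := by
  rw [← hf.integral_deriv_eq_sub, intervalIntegral.integral_of_le hab,
    intervalIntegral.integral_of_le hab, ← restrict_Ioo_eq_restrict_Ioc]
  refine integral_congr_ae ?_
  filter_upwards [h] with x hx using hx.deriv.symm

/-- `f` is absolutely continuous on the compact subintervals of `[0,x₀) ∪ (x₀,1]`. -/
def LocAC (x₀ : ℝ) (f : ℝ → ℝ) : Prop :=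
  (∀ y ∈ Ioo 0 x₀, AbsolutelyContinuousOnInterval f 0 y) ∧
    ∀ y ∈ Ioo x₀ 1, AbsolutelyContinuousOnInterval f y 1

/-- `f` is absolutely continuous on the compact subintervals of `[0,x₀) ∪ (x₀,1]`, with
derivative `f'`. -/
structure LocACDeriv (x₀ : ℝ) (f f' : ℝ → ℝ) : Prop where
  ac : LocAC x₀ f
  deriv : ∀ᵐ x ∂muI, HasDerivAt f (f' x) x

variable {x₀ : ℝ} {f f' g g' : ℝ → ℝ}

theorem ae_mem_Ioo : ∀ᵐ x ∂muI, x ∈ Ioo (0 : ℝ) 1 := ae_restrict_mem measurableSet_Ioo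

theorem ae_ne (x₀ : ℝ) : ∀ᵐ x ∂muI, x ≠ x₀ := by
  have : ∀ᵐ x ∂(volume : Measure ℝ), x ≠ x₀ := by simp [ae_iff, measure_singleton]
  exact ae_restrict_of_ae this

instance : IsFiniteMeasure muI := by unfold muI; infer_instance

theorem ae_Icc_ne (x₀ : ℝ) : ∀ᵐ x ∂muI, x ∈ Icc (0 : ℝ) 1 ∧ x ≠ x₀ := by
  filter_upwards [ae_mem_Ioo, ae_ne x₀] with x h1 h2 using ⟨Ioo_subset_Icc_self h1, h2⟩

theorem _root_.AbsolutelyContinuousOnInterval.locAC (hf : AbsolutelyContinuousOnInterval f 0 1)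
    (hx₀ : x₀ ∈ Ioo (0 : ℝ) 1) : LocAC x₀ f := by
  constructor
  · intro y hy
    refine hf.mono ?_
    rw [uIcc_of_le hy.1.le, uIcc_of_le zero_le_one]
    exact Icc_subset_Icc_right (hy.2.trans hx₀.2).le
  · intro y hy
    refine hf.mono ?_
    rw [uIcc_of_le hy.2.le, uIcc_of_le zero_le_one]
    exact Icc_subset_Icc_left (hx₀.1.trans hy.1).le

/-- Countably many compact intervals exhaust both sides of `x₀`. This transfers statements valid
where absolute continuity holds to almost every point of `(0,1)`. -/
theorem ae_muI_of_restrict {P : ℝ → Prop} (hx₀ : x₀ ∈ Ioo (0 : ℝ) 1)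
    (h1 : ∀ y ∈ Ioo 0 x₀, ∀ᵐ x, x ∈ Icc 0 y → P x)
    (h2 : ∀ y ∈ Ioo x₀ 1, ∀ᵐ x, x ∈ Icc y 1 → P x) : ∀ᵐ x ∂muI, P x := by
  obtain ⟨u, -, hu, hu'⟩ := exists_seq_strictMono_tendsto' hx₀.1
  obtain ⟨w, -, hw, hw'⟩ := exists_seq_strictAnti_tendsto' hx₀.2
  have h1' := ae_all_iff.2 fun n => h1 (u n) (hu n)
  have h2' := ae_all_iff.2 fun n => h2 (w n) (hw n)
  filter_upwards [ae_restrict_of_ae h1', ae_restrict_of_ae h2', ae_Icc_ne x₀] with x hx1 hx2 hx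
  rcases lt_or_gt_of_ne hx.2 with h | h
  · obtain ⟨n, hn⟩ := (hu'.eventually (lt_mem_nhds h)).exists
    exact hx1 n ⟨hx.1.1, hn.le⟩
  · obtain ⟨n, hn⟩ := (hw'.eventually (gt_mem_nhds h)).exists
    exact hx2 n ⟨hn.le, hx.1.2⟩

namespace LocAC

theorem ae_differentiableAt (hf : LocAC x₀ f) (hx₀ : x₀ ∈ Ioo (0 : ℝ) 1) :
    ∀ᵐ x ∂muI, DifferentiableAt ℝ f x := by
  refine ae_muI_of_restrict hx₀ (fun y hy => ?_) fun y hy => ?_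
  · simpa [uIcc_of_le hy.1.le] using (hf.1 y hy).ae_differentiableAt
  · simpa [uIcc_of_le hy.2.le] using (hf.2 y hy).ae_differentiableAt

theorem locACDeriv_Dx (hf : LocAC x₀ f) (hx₀ : x₀ ∈ Ioo (0 : ℝ) 1) :
    LocACDeriv x₀ f (Dx f) := by
  refine ⟨hf, ?_⟩
  filter_upwards [hf.ae_differentiableAt hx₀, ae_mem_Ioo] with x hx hx'
  rw [Dx_eq_deriv f hx']
  exact hx.hasDerivAt

theorem add (hf : LocAC x₀ f) (hg : LocAC x₀ g) : LocAC x₀ (fun x => f x + g x) :=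
  ⟨fun y hy => (hf.1 y hy).fun_add (hg.1 y hy), fun y hy => (hf.2 y hy).fun_add (hg.2 y hy)⟩

theorem neg (hf : LocAC x₀ f) : LocAC x₀ (fun x => -f x) :=
  ⟨fun y hy => (hf.1 y hy).fun_neg, fun y hy => (hf.2 y hy).fun_neg⟩

theorem mul (hf : LocAC x₀ f) (hg : LocAC x₀ g) : LocAC x₀ (fun x => f x * g x) :=
  ⟨fun y hy => (hf.1 y hy).fun_mul (hg.1 y hy), fun y hy => (hf.2 y hy).fun_mul (hg.2 y hy)⟩

theorem comp_contDiff (hf : LocAC x₀ f) {F : ℝ → ℝ} (hF : ContDiff ℝ 1 F) :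
    LocAC x₀ (fun x => F (f x)) :=
  ⟨fun y hy => (hf.1 y hy).comp_contDiff hF, fun y hy => (hf.2 y hy).comp_contDiff hF⟩

theorem of_contDiff (hf : ContDiff ℝ 1 f) : LocAC x₀ f :=
  ⟨fun _ _ => hf.contDiffOn.absolutelyContinuousOnInterval,
    fun _ _ => hf.contDiffOn.absolutelyContinuousOnInterval⟩

theorem inv (hx₀ : x₀ ∈ Ioo (0 : ℝ) 1) (hf : LocAC x₀ f)
    (h : ∀ x ∈ Icc (0 : ℝ) 1, x ≠ x₀ → 0 < f x) :
    LocAC x₀ (fun x => (f x)⁻¹) := by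
  constructor
  · intro y hy
    refine (hf.1 y hy).fun_inv fun x hx => ?_
    rw [uIcc_of_le hy.1.le] at hx
    exact h x ⟨hx.1, (hx.2.trans_lt (hy.2.trans hx₀.2)).le⟩ (hx.2.trans_lt hy.2).ne
  · intro y hy
    refine (hf.2 y hy).fun_inv fun x hx => ?_
    rw [uIcc_of_le hy.2.le] at hx
    exact h x ⟨((hx₀.1.trans hy.1).trans_le hx.1).le, hx.2⟩ (hy.1.trans_le hx.1).ne'

theorem congr (hx₀ : x₀ ∈ Ioo (0 : ℝ) 1) (hf : LocAC x₀ f)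
    (h : ∀ x ∈ Icc (0 : ℝ) 1, x ≠ x₀ → g x = f x) : LocAC x₀ g := by
  constructor
  · intro y hy
    refine (hf.1 y hy).congr fun x hx => ?_
    rw [uIcc_of_le hy.1.le] at hx
    exact h x ⟨hx.1, (hx.2.trans_lt (hy.2.trans hx₀.2)).le⟩ (hx.2.trans_lt hy.2).ne
  · intro y hy
    refine (hf.2 y hy).congr fun x hx => ?_
    rw [uIcc_of_le hy.2.le] at hx
    exact h x ⟨((hx₀.1.trans hy.1).trans_le hx.1).le, hx.2⟩ (hy.1.trans_le hx.1).ne'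

theorem continuousWithinAt (hf : LocAC x₀ f) {x : ℝ} (hx : x ∈ Icc (0 : ℝ) 1) (hne : x ≠ x₀) :
    ContinuousWithinAt f (Icc 0 1) x := by
  rcases lt_or_gt_of_ne hne with h | h
  · obtain ⟨y, hy, hy'⟩ := exists_between h
    have h1 := (hf.1 y ⟨hx.1.trans_lt hy, hy'⟩).continuousOn
    rw [uIcc_of_le (hx.1.trans hy.le)] at h1
    refine (h1 x ⟨hx.1, hy.le⟩).mono_of_mem_nhdsWithin ?_
    filter_upwards [self_mem_nhdsWithin, nhdsWithin_le_nhds (Iio_mem_nhds hy)] with z hz hz'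
    exact ⟨hz.1, le_of_lt hz'⟩
  · obtain ⟨y, hy, hy'⟩ := exists_between h
    have h1 := (hf.2 y ⟨hy, hy'.trans_le hx.2⟩).continuousOn
    rw [uIcc_of_le (hy'.le.trans hx.2)] at h1
    refine (h1 x ⟨hy'.le, hx.2⟩).mono_of_mem_nhdsWithin ?_
    filter_upwards [self_mem_nhdsWithin, nhdsWithin_le_nhds (Ioi_mem_nhds hy')] with z hz hz'
    exact ⟨le_of_lt hz', hz.2⟩

theorem aemeasurable (hf : LocAC x₀ f) : AEMeasurable f muI := by
  have h1 : ContinuousOn f (Ioo 0 1 \ {x₀}) := fun x hx =>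
    (hf.continuousWithinAt (Ioo_subset_Icc_self hx.1) hx.2).mono
      (sdiff_subset.trans Ioo_subset_Icc_self)
  have h2 := h1.aemeasurable (μ := volume) (measurableSet_Ioo.diff (measurableSet_singleton x₀))
  rwa [Measure.restrict_congr_set (t := Ioo 0 1)] at h2
  exact sdiff_null_ae_eq_self (measure_singleton _)

end LocAC

namespace LocACDeriv

theorem add (hf : LocACDeriv x₀ f f') (hg : LocACDeriv x₀ g g') :
    LocACDeriv x₀ (fun x => f x + g x) (fun x => f' x + g' x) := by
  refine ⟨hf.ac.add hg.ac, ?_⟩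
  filter_upwards [hf.deriv, hg.deriv] with x h1 h2 using h1.add h2

theorem neg (hf : LocACDeriv x₀ f f') : LocACDeriv x₀ (fun x => -f x) (fun x => -f' x) := by
  refine ⟨hf.ac.neg, ?_⟩
  filter_upwards [hf.deriv] with x h1 using h1.neg

theorem sub (hf : LocACDeriv x₀ f f') (hg : LocACDeriv x₀ g g') :
    LocACDeriv x₀ (fun x => f x - g x) (fun x => f' x - g' x) := by
  simpa only [sub_eq_add_neg] using hf.add hg.neg

theorem mul (hf : LocACDeriv x₀ f f') (hg : LocACDeriv x₀ g g') :
    LocACDeriv x₀ (fun x => f x * g x) (fun x => f' x * g x + f x * g' x) := by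
  refine ⟨hf.ac.mul hg.ac, ?_⟩
  filter_upwards [hf.deriv, hg.deriv] with x h1 h2 using h1.mul h2

theorem of_contDiff (hf : ContDiff ℝ 1 f) (h : ∀ x, HasDerivAt f (f' x) x) :
    LocACDeriv x₀ f f' :=
  ⟨LocAC.of_contDiff hf, ae_of_all _ h⟩

theorem const_mul (c : ℝ) (hf : LocACDeriv x₀ f f') :
    LocACDeriv x₀ (fun x => c * f x) (fun x => c * f' x) := by
  refine ⟨(LocAC.of_contDiff (f := fun _ => c) contDiff_const).mul hf.ac, ?_⟩
  filter_upwards [hf.deriv] with x h1 using h1.const_mul c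

theorem exp (hf : LocACDeriv x₀ f f') :
    LocACDeriv x₀ (fun x => Real.exp (f x)) (fun x => Real.exp (f x) * f' x) := by
  refine ⟨hf.ac.comp_contDiff Real.contDiff_exp, ?_⟩
  filter_upwards [hf.deriv] with x h1 using h1.exp

theorem inv (hx₀ : x₀ ∈ Ioo (0 : ℝ) 1) (hf : LocACDeriv x₀ f f')
    (h : ∀ x ∈ Icc (0 : ℝ) 1, x ≠ x₀ → 0 < f x) :
    LocACDeriv x₀ (fun x => (f x)⁻¹) (fun x => -f' x / f x ^ 2) := by
  refine ⟨hf.ac.inv hx₀ h, ?_⟩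
  filter_upwards [hf.deriv, ae_Icc_ne x₀] with x h1 h2 using h1.fun_inv (h x h2.1 h2.2).ne'

theorem congr (hx₀ : x₀ ∈ Ioo (0 : ℝ) 1) (hf : LocACDeriv x₀ f f')
    (h : ∀ x ∈ Icc (0 : ℝ) 1, x ≠ x₀ → g x = f x) (h' : ∀ᵐ x ∂muI, g' x = f' x) :
    LocACDeriv x₀ g g' := by
  refine ⟨hf.ac.congr hx₀ h, ?_⟩
  filter_upwards [hf.deriv, h', ae_mem_Ioo, ae_ne x₀] with x h1 h2 h3 h4
  rw [h2]
  refine h1.congr_of_eventuallyEq ?_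
  filter_upwards [Icc_mem_nhds h3.1 h3.2, isOpen_ne.mem_nhds h4] with z hz hz' using h z hz hz'

theorem congr_deriv (hf : LocACDeriv x₀ f f') (h' : ∀ᵐ x ∂muI, g' x = f' x) :
    LocACDeriv x₀ f g' := by
  refine ⟨hf.ac, ?_⟩
  filter_upwards [hf.deriv, h'] with x h1 h2
  rwa [h2]

theorem restrict_right (hx₀ : x₀ ∈ Ioo (0 : ℝ) 1) {P : ℝ → Prop} (h : ∀ᵐ x ∂muI, P x) {y : ℝ}
    (hy : x₀ < y) : ∀ᵐ x ∂volume.restrict (Ioo y 1), P x :=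
  ae_restrict_of_ae_restrict_of_subset (Ioo_subset_Ioo_left (hx₀.1.trans hy).le) h

theorem restrict_left (hx₀ : x₀ ∈ Ioo (0 : ℝ) 1) {P : ℝ → Prop} (h : ∀ᵐ x ∂muI, P x) {y : ℝ}
    (hy : y < x₀) : ∀ᵐ x ∂volume.restrict (Ioo 0 y), P x :=
  ae_restrict_of_ae_restrict_of_subset (Ioo_subset_Ioo_right (hy.trans hx₀.2).le) h

theorem _root_.MeasureTheory.Integrable.intervalIntegrable_of_muI {q : ℝ → ℝ}
    (hq : Integrable q muI) {y z : ℝ} (hy : y ∈ Icc (0 : ℝ) 1) (hz : z ∈ Icc (0 : ℝ) 1) :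
    IntervalIntegrable q volume y z := by
  have h1 : IntervalIntegrable q volume 0 1 := by
    rw [intervalIntegrable_iff_integrableOn_Ioo_of_le zero_le_one]
    exact hq
  refine h1.mono_set ?_
  rw [uIcc_of_le zero_le_one]
  exact (uIcc_subset_Icc hy hz)

theorem integral_muI (q : ℝ → ℝ) : ∫ x, q x ∂muI = ∫ x in (0 : ℝ)..1, q x := by
  rw [intervalIntegral.integral_of_le zero_le_one, ← restrict_Ioo_eq_restrict_Ioc, muI]

/-- If the derivative of `f` is at most `q`, then `f(1) - f(0) ≤ ∫ q`, provided the contributions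
of `f` on both sides of `x₀` cancel. -/
theorem sub_le_integral (hx₀ : x₀ ∈ Ioo (0 : ℝ) 1) (hf : LocACDeriv x₀ f f') {q : ℝ → ℝ}
    (hq : Integrable q muI) (hle : ∀ᵐ x ∂muI, f' x ≤ q x) {xs ys : ℕ → ℝ}
    (hxs : ∀ n, xs n ∈ Ioo x₀ 1) (hys : ∀ n, ys n ∈ Ioo 0 x₀)
    (hxs' : Tendsto xs atTop (𝓝 x₀)) (hys' : Tendsto ys atTop (𝓝 x₀)) {ℓ : ℝ}
    (h1 : Tendsto (fun n => f (xs n)) atTop (𝓝 ℓ)) (h2 : Tendsto (fun n => f (ys n)) atTop (𝓝 ℓ)) :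
    f 1 - f 0 ≤ ∫ x, q x ∂muI := by
  have mem0 : (0 : ℝ) ∈ Icc (0 : ℝ) 1 := by simp
  have mem1 : (1 : ℝ) ∈ Icc (0 : ℝ) 1 := by simp
  have hcont : ContinuousOn (fun z => ∫ x in (0 : ℝ)..z, q x) (Icc 0 1) := by
    have := intervalIntegral.continuousOn_primitive_interval (μ := volume) (f := q) (a := 0) (b := 1)
      (by
        rw [uIcc_of_le zero_le_one, integrableOn_Icc_iff_integrableOn_Ioo]
        exact hq)
    rwa [uIcc_of_le zero_le_one] at this
  -- Only `q` is integrable across `x₀`; `f'` need not be. Hence the limit is taken in the integrals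
  -- of `q`.
  have hlim : ∀ zs : ℕ → ℝ, (∀ n, zs n ∈ Icc (0 : ℝ) 1) → Tendsto zs atTop (𝓝 x₀) →
      Tendsto (fun n => ∫ x in (0 : ℝ)..zs n, q x) atTop (𝓝 (∫ x in (0 : ℝ)..x₀, q x)) := by
    intro zs hzs hzs'
    exact (hcont x₀ (Ioo_subset_Icc_self hx₀)).tendsto.comp
      (tendsto_nhdsWithin_iff.2 ⟨hzs', Eventually.of_forall hzs⟩)
  have hxm : ∀ n, xs n ∈ Icc (0 : ℝ) 1 := fun n => ⟨(hx₀.1.trans (hxs n).1).le, (hxs n).2.le⟩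
  have hym : ∀ n, ys n ∈ Icc (0 : ℝ) 1 := fun n => ⟨(hys n).1.le, ((hys n).2.trans hx₀.2).le⟩
  have e1 : ∀ n, f 1 - f (xs n) ≤
      (∫ x in (0 : ℝ)..1, q x) - ∫ x in (0 : ℝ)..xs n, q x := by
    intro n
    have hd := restrict_right hx₀ hf.deriv (hxs n).1
    have hl := restrict_right hx₀ hle (hxs n).1
    have hac := hf.ac.2 _ (hxs n)
    rw [← hac.integral_eq_sub_of_hasDerivAt (hxs n).2.le hd,
      intervalIntegral.integral_interval_sub_left (hq.intervalIntegrable_of_muI mem0 mem1)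
        (hq.intervalIntegrable_of_muI mem0 (hxm n))]
    refine intervalIntegral.integral_mono_ae_restrict (hxs n).2.le
      (hac.intervalIntegrable_of_hasDerivAt (hxs n).2.le hd)
      (hq.intervalIntegrable_of_muI (hxm n) mem1) ?_
    rw [← restrict_Ioo_eq_restrict_Icc]
    exact hl
  have e2 : ∀ n, f (ys n) - f 0 ≤ ∫ x in (0 : ℝ)..ys n, q x := by
    intro n
    have hd := restrict_left hx₀ hf.deriv (hys n).2
    have hl := restrict_left hx₀ hle (hys n).2
    have hac := hf.ac.1 _ (hys n)
    rw [← hac.integral_eq_sub_of_hasDerivAt (hys n).1.le hd]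
    refine intervalIntegral.integral_mono_ae_restrict (hys n).1.le
      (hac.intervalIntegrable_of_hasDerivAt (hys n).1.le hd)
      (hq.intervalIntegrable_of_muI mem0 (hym n)) ?_
    rw [← restrict_Ioo_eq_restrict_Icc]
    exact hl
  -- The limits are `f 1 - ℓ ≤ ∫ q` over `(x₀,1)` and `ℓ - f 0 ≤ ∫ q` over `(0,x₀)`; in the sum `ℓ`
  -- cancels.
  have l1 := le_of_tendsto_of_tendsto' (tendsto_const_nhds.sub h1)
    (tendsto_const_nhds.sub (hlim xs hxm hxs')) e1
  have l2 := le_of_tendsto_of_tendsto' (h2.sub tendsto_const_nhds) (hlim ys hym hys') e2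
  rw [integral_muI]
  linarith

end LocACDeriv

/-! ### Sequences approaching the degeneracy point -/

/-- Otherwise `q x ≥ ε / (x - y)` on the whole interval, contradicting the non-integrability of `1 /
(x - y)` at `y`. -/
theorem frequently_mul_lt_of_integrable {q : ℝ → ℝ} {y z : ℝ} (hyz : y < z)
    (hq : IntervalIntegrable q volume y z) {ε : ℝ} (hε : 0 < ε) :
    ∃ x ∈ Ioo y z, (x - y) * q x < ε := by
  by_contra! hcon
  have h1 : IntervalIntegrable (fun x => (x - y)⁻¹) volume y z := by
    have h2 : IntervalIntegrable (fun x => ε⁻¹ * q x) volume y z := hq.const_mul _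
    refine h2.mono_fun (by fun_prop) ?_
    rw [uIoc_of_le hyz.le, ← restrict_Ioo_eq_restrict_Ioc]
    filter_upwards [ae_restrict_mem measurableSet_Ioo] with x hx
    have hxy : 0 < x - y := sub_pos.2 hx.1
    have h3 := hcon x hx
    rw [Real.norm_eq_abs, abs_of_pos (inv_pos.2 hxy), Real.norm_eq_abs]
    refine le_trans ?_ (le_abs_self _)
    rw [inv_eq_one_div, div_le_iff₀ hxy, ← mul_le_mul_iff_right₀ hε]
    calc ε * 1 ≤ (x - y) * q x := by linarith
      _ = ε * (ε⁻¹ * q x * (x - y)) := by field_simp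
  rw [intervalIntegrable_sub_inv_iff] at h1
  rcases h1 with h1 | h1
  · exact hyz.ne h1
  · exact h1 left_mem_uIcc

/-- The previous lemma is applied on shrinking intervals `(y, u n)` with `ε = 1 / (n + 1)`. It makes
the boundary terms at the degeneracy point vanish although the energy density has no pointwise bound
there. -/
theorem exists_seq_right {q : ℝ → ℝ} {y z : ℝ} (hyz : y < z) (hq0 : ∀ x ∈ Ioo y z, 0 ≤ q x)
    (hq : IntervalIntegrable q volume y z) :
    ∃ xs : ℕ → ℝ, (∀ n, xs n ∈ Ioo y z) ∧ Tendsto xs atTop (𝓝 y) ∧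
      Tendsto (fun n => |xs n - y| * q (xs n)) atTop (𝓝 0) := by
  obtain ⟨u, -, hu, hu'⟩ := exists_seq_strictAnti_tendsto' hyz
  have h1 : ∀ n : ℕ, ∃ x ∈ Ioo y (u n), (x - y) * q x < 1 / ((n : ℝ) + 1) := by
    intro n
    refine frequently_mul_lt_of_integrable (hu n).1 (hq.mono_set ?_) (by positivity)
    rw [uIcc_of_le hyz.le, uIcc_of_le (hu n).1.le]
    exact Icc_subset_Icc_right (hu n).2.le
  choose xs hxs hxs' using h1
  refine ⟨xs, fun n => ⟨(hxs n).1, (hxs n).2.trans (hu n).2⟩, ?_, ?_⟩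
  · exact tendsto_of_tendsto_of_tendsto_of_le_of_le tendsto_const_nhds hu'
      (fun n => (hxs n).1.le) fun n => (hxs n).2.le
  · refine squeeze_zero (fun n => mul_nonneg (abs_nonneg _)
      (hq0 _ ⟨(hxs n).1, (hxs n).2.trans (hu n).2⟩)) (fun n => ?_)
      tendsto_one_div_add_atTop_nhds_zero_nat
    rw [abs_of_pos (sub_pos.2 (hxs n).1)]
    exact (hxs' n).le

theorem exists_seq_left {q : ℝ → ℝ} {y z : ℝ} (hyz : y < z) (hq0 : ∀ x ∈ Ioo y z, 0 ≤ q x)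
    (hq : IntervalIntegrable q volume y z) :
    ∃ xs : ℕ → ℝ, (∀ n, xs n ∈ Ioo y z) ∧ Tendsto xs atTop (𝓝 z) ∧
      Tendsto (fun n => |xs n - z| * q (xs n)) atTop (𝓝 0) := by
  have hq' : IntervalIntegrable (fun x => q (-x)) volume (-z) (-y) := by
    simpa using hq.symm.comp_sub_left 0
  obtain ⟨xs, h1, h2, h3⟩ := exists_seq_right (neg_lt_neg hyz)
    (fun x hx => hq0 (-x) ⟨by linarith [hx.2], by linarith [hx.1]⟩) hq'
  refine ⟨fun n => -xs n, fun n => ⟨by linarith [(h1 n).2], by linarith [(h1 n).1]⟩, ?_, ?_⟩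
  · simpa using h2.neg
  · convert h3 using 3
    rw [← abs_neg]
    congr 1
    ring

end

/-! ### The time weight -/

/-- The derivative of `Theta`. -/
def ThetaD (T t : ℝ) : ℝ := -4 * (T - 2 * t) / (t * (T - t)) ^ 5

/-- The second derivative of `Theta`. -/
def ThetaDD (T t : ℝ) : ℝ :=
  8 / (t * (T - t)) ^ 5 + 20 * (T - 2 * t) ^ 2 / (t * (T - t)) ^ 6

section Theta

variable {T t : ℝ}

theorem mul_sub_pos (ht : t ∈ Ioo 0 T) : 0 < t * (T - t) :=
  mul_pos ht.1 (sub_pos.2 ht.2)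

theorem Theta_pos (ht : t ∈ Ioo 0 T) : 0 < Theta T t := by
  have := mul_sub_pos ht
  unfold Theta
  positivity

theorem hasDerivAt_Theta (ht : t ∈ Ioo 0 T) : HasDerivAt (Theta T) (ThetaD T t) t := by
  have h0 := mul_sub_pos ht
  have h1 : HasDerivAt (fun t : ℝ => t * (T - t)) (T - 2 * t) t := by
    refine ((hasDerivAt_id t).mul ((hasDerivAt_id t).const_sub T)).congr_deriv ?_
    simp only [id]; ring
  have h2 := (h1.fun_pow 4).fun_inv (pow_pos h0 4).ne'
  have h3 : Theta T = fun t => ((t * (T - t)) ^ 4)⁻¹ := by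
    funext t; simp [Theta]
  rw [h3]
  refine h2.congr_deriv ?_
  unfold ThetaD
  have h0' := h0.ne'
  generalize t * (T - t) = y at *
  field_simp
  push_cast
  ring

theorem hasDerivAt_ThetaD (ht : t ∈ Ioo 0 T) : HasDerivAt (ThetaD T) (ThetaDD T t) t := by
  have h0 := mul_sub_pos ht
  have h1 : HasDerivAt (fun t : ℝ => t * (T - t)) (T - 2 * t) t := by
    refine ((hasDerivAt_id t).mul ((hasDerivAt_id t).const_sub T)).congr_deriv ?_
    simp only [id]; ring
  have h4 : HasDerivAt (fun t : ℝ => -4 * (T - 2 * t)) 8 t := by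
    refine ((((hasDerivAt_id t).const_mul 2).const_sub T).const_mul (-4)).congr_deriv ?_
    norm_num
  have h2 := h4.fun_div (h1.fun_pow 5) (pow_pos h0 5).ne'
  refine h2.congr_deriv ?_
  unfold ThetaDD
  have h0' := h0.ne'
  generalize t * (T - t) = y at *
  field_simp
  push_cast
  ring

theorem mul_sub_le (T t : ℝ) : t * (T - t) ≤ T ^ 2 := by
  nlinarith [sq_nonneg (t - T / 2), sq_nonneg T]

theorem Theta_ge (ht : t ∈ Ioo 0 T) : 1 / T ^ 8 ≤ Theta T t := by
  have h0 := mul_sub_pos ht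
  unfold Theta
  refine one_div_le_one_div_of_le (by positivity) ?_
  calc (t * (T - t)) ^ 4 ≤ (T ^ 2) ^ 4 := by gcongr; exact mul_sub_le T t
    _ = T ^ 8 := by ring

theorem abs_sub_two_mul_le (ht : t ∈ Ioo 0 T) : |T - 2 * t| ≤ T := by
  rw [abs_le]
  constructor <;> linarith [ht.1, ht.2]

/-- Differentiation raises the power of `1 / (t (T - t))` from 4 to 5, which is still below the 8 of
`Theta ^ 2`; the surplus factor `(t (T - t))³` is at most `T⁶`. -/
theorem abs_ThetaD_le (ht : t ∈ Ioo 0 T) : |ThetaD T t| ≤ 4 * T ^ 7 * Theta T t ^ 2 := by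
  have h0 := mul_sub_pos ht
  have hT : 0 < T := ht.1.trans ht.2
  have h1 := abs_sub_two_mul_le ht
  have h2 := mul_sub_le T t
  unfold ThetaD Theta
  generalize t * (T - t) = y at *
  rw [abs_div, abs_mul, abs_of_pos (pow_pos h0 5)]
  have h3 : y ^ 3 ≤ T ^ 6 := by
    calc y ^ 3 ≤ (T ^ 2) ^ 3 := by gcongr
      _ = T ^ 6 := by ring
  norm_num
  rw [div_le_iff₀ (by positivity)]
  calc 4 * |T - 2 * t| ≤ 4 * T := by gcongr
    _ = 4 * T * y ^ 3 * ((y ^ 4) ^ 2)⁻¹ * y ^ 5 := by field_simp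
    _ ≤ 4 * T * T ^ 6 * ((y ^ 4) ^ 2)⁻¹ * y ^ 5 := by gcongr
    _ = _ := by ring

/-- The powers 5 and 6 are again below 8. The resulting order `Theta ^ 2` is that of `l²`, so terms
with one factor `s` are small relative to `l²` for large `s`. -/
theorem abs_ThetaDD_le (ht : t ∈ Ioo 0 T) : |ThetaDD T t| ≤ 28 * T ^ 6 * Theta T t ^ 2 := by
  have h0 := mul_sub_pos ht
  have hT : 0 < T := ht.1.trans ht.2
  have h1 : (T - 2 * t) ^ 2 ≤ T ^ 2 := by
    rw [← sq_abs]
    gcongr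
    exact abs_sub_two_mul_le ht
  have h2 := mul_sub_le T t
  unfold ThetaDD Theta
  generalize t * (T - t) = y at *
  rw [abs_of_nonneg (by positivity)]
  calc 8 / y ^ 5 + 20 * (T - 2 * t) ^ 2 / y ^ 6 ≤ 8 / y ^ 5 + 20 * T ^ 2 / y ^ 6 := by gcongr
    _ = (8 * y ^ 3 + 20 * T ^ 2 * y ^ 2) * (1 / y ^ 4) ^ 2 := by field_simp
    _ ≤ (8 * (T ^ 2) ^ 3 + 20 * T ^ 2 * (T ^ 2) ^ 2) * (1 / y ^ 4) ^ 2 := by gcongr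
    _ = _ := by ring

theorem tendsto_Theta_zero (hT : 0 < T) : Tendsto (Theta T) (𝓝[>] 0) atTop := by
  have h1 : Tendsto (fun t : ℝ => (t * (T - t)) ^ 4) (𝓝[>] 0) (𝓝[>] 0) := by
    rw [tendsto_nhdsWithin_iff]
    constructor
    · have : Continuous fun t : ℝ => (t * (T - t)) ^ 4 := by fun_prop
      simpa using (this.tendsto 0).mono_left nhdsWithin_le_nhds
    · filter_upwards [Ioo_mem_nhdsGT hT] with t ht using pow_pos (mul_sub_pos ht) 4
  have := h1.inv_tendsto_nhdsGT_zero
  refine this.congr fun t => ?_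
  simp [Theta]

theorem tendsto_Theta_T (hT : 0 < T) : Tendsto (Theta T) (𝓝[<] T) atTop := by
  have h1 : Tendsto (fun t : ℝ => (t * (T - t)) ^ 4) (𝓝[<] T) (𝓝[>] 0) := by
    rw [tendsto_nhdsWithin_iff]
    constructor
    · have : Continuous fun t : ℝ => (t * (T - t)) ^ 4 := by fun_prop
      simpa using (this.tendsto T).mono_left nhdsWithin_le_nhds
    · filter_upwards [Ioo_mem_nhdsLT hT] with t ht using pow_pos (mul_sub_pos ht) 4
  have := h1.inv_tendsto_nhdsGT_zero
  refine this.congr fun t => ?_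
  simp [Theta]

theorem measurable_Theta (T : ℝ) : Measurable (Theta T) := by unfold Theta; fun_prop

theorem measurable_ThetaD (T : ℝ) : Measurable (ThetaD T) := by unfold ThetaD; fun_prop

theorem measurable_ThetaDD (T : ℝ) : Measurable (ThetaDD T) := by unfold ThetaDD; fun_prop

end Theta

/-! ### The pointwise identity -/

/-- The flux in the divergence identity, divided by the exponential weight. -/
def jFlux (κ γ M v w G l τ : ℝ) : ℝ :=
  (G + l * κ * v) * (w + τ * v) - l * γ * (G + l * κ * v) ^ 2 - l * M * (G + l * κ * v) * v
    - l * κ * (-τ + l ^ 2 * (κ * γ)) * v ^ 2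

/-- The space derivative of `jFlux`; `κ₁, …, τ₁` are the derivatives of `κ, …, τ`. -/
def jFluxD (κ κ₁ γ γ₁ M M₁ v v₁ w w₁ G G₁ l τ τ₁ : ℝ) : ℝ :=
  (G₁ + l * (κ₁ * v + κ * v₁)) * (w + τ * v) + (G + l * κ * v) * (w₁ + τ₁ * v + τ * v₁)
    - l * γ₁ * (G + l * κ * v) ^ 2
    - 2 * l * γ * (G + l * κ * v) * (G₁ + l * (κ₁ * v + κ * v₁))
    - l * (M₁ * (G + l * κ * v) * v + M * (G₁ + l * (κ₁ * v + κ * v₁)) * v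
        + M * (G + l * κ * v) * v₁)
    - l * κ₁ * (-τ + l ^ 2 * (κ * γ)) * v ^ 2
    - l * κ * (-τ₁ + l ^ 2 * (κ₁ * γ + κ * γ₁)) * v ^ 2
    - 2 * l * κ * (-τ + l ^ 2 * (κ * γ)) * v * v₁

/-- The energy in the divergence identity, divided by the exponential weight. -/
def sEnergy (A ρ κ v p l τ : ℝ) : ℝ :=
  -(1 / 2) * ρ * τ * v ^ 2 - l * κ * v * p - 1 / 2 * A * p ^ 2

/-- The time derivative of the weighted energy, divided by the exponential weight. -/
def sEnergyD (A ρ κ v w p b l l₁ τ τ₁ : ℝ) : ℝ :=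
  2 * τ * sEnergy A ρ κ v p l τ - 1 / 2 * ρ * τ₁ * v ^ 2 - ρ * τ * v * w
    - l₁ * κ * v * p - l * κ * (w * p + v * b) - A * p * b

/-- The left side is `ρ X Y`, the product of the symmetric and the skew part of the conjugated
operator, with the factor `e^{2sφ}` removed. The terms `2 l (κ/A) jFlux` here and `2 τ sEnergy`
inside `sEnergyD` come from differentiating this factor in space and in time. The derivatives that
`jFluxD` receives encode `κ' = ρ M`, `γ' = (D - M)/A` and `τ_x = l₁ κ/A`. All derivatives are
independent variables, so the statement is pure algebra. -/
theorem carleman_identity {A ρ γ κ : ℝ} (hA : 0 < A) (hρ : 0 < ρ) (hκ : κ = γ * (ρ * A))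
    (M M₁ D v w p b r l l₁ τ τ₂ : ℝ) :
    ρ * (r / ρ + l * M * v + 2 * l * (κ / ρ) * p + 2 * l ^ 2 * (κ * γ) * v - τ * v)
        * (w + τ * v - 2 * l * (κ / ρ) * (p + l * (κ / A) * v) - l * M * v)
      = jFluxD κ (ρ * M) γ ((D - M) / A) M M₁ v p w b (A * p) r l τ (l₁ * (κ / A))
        + 2 * l * (κ / A) * jFlux κ γ M v w (A * p) l τ
        + sEnergyD A ρ κ v w p b l l₁ τ τ₂
        + D * (l * A * (p + l * (κ / A) * v) ^ 2 + l ^ 3 * (κ ^ 2 / A) * v ^ 2)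
        + l * M₁ * (A * (p + l * (κ / A) * v)) * v + 1 / 2 * ρ * τ₂ * v ^ 2
        - 2 * l * l₁ * (κ ^ 2 / A) * v ^ 2 := by
  -- Naming the quotients by `ρ` and `A` turns the identity into a polynomial one.
  obtain ⟨q, hq⟩ : ∃ q, r = ρ * q := ⟨r / ρ, by field_simp⟩
  obtain ⟨z, hz⟩ : ∃ z, D = M + A * z := ⟨(D - M) / A, by field_simp; ring⟩
  have e1 : κ / ρ = γ * A := by rw [hκ]; field_simp
  have e2 : κ / A = γ * ρ := by rw [hκ]; field_simp
  have e3 : κ ^ 2 / A = γ ^ 2 * ρ ^ 2 * A := by rw [hκ]; field_simp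
  have e4 : (D - M) / A = z := by rw [hz]; field_simp; ring
  have e5 : r / ρ = q := by rw [hq]; field_simp
  rw [e1, e2, e3, e4, e5, hκ, hq, hz]
  unfold jFluxD jFlux sEnergyD sEnergy
  ring

/-- Bookkeeping for the principal terms, of which at least `δ` times each is available. Half of the
gradient term pays for the term with `M₁`, a quarter of the zero order term pays for the one with
`l₁`, and a quarter of both is kept. What is only of the form `ρ v²` is collected in `ε l² ρ v²`. -/
theorem carleman_pointwise {A ρ γ κ : ℝ} (hA : 0 < A) (hρ : 0 < ρ) (hκ : κ = γ * (ρ * A))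
    {M M₁ D v w p b r l l₁ τ τ₂ c h N δ ε Cc : ℝ} (heq : w + r / ρ - c * v = h)
    (hl : 0 < l) (hδ : 0 < δ) (hD : δ ≤ D) (hM₁ : |M₁| ≤ N) (hAρ : A ≤ N * ρ) (hc : |c| ≤ Cc)
    (hε : 1 / 2 * |τ₂| + N ^ 3 / (2 * δ) * l + Cc ^ 2 / 2 ≤ ε * l ^ 2)
    (hl₁ : 2 * |l₁| ≤ δ / 4 * l ^ 2) :
    jFluxD κ (ρ * M) γ ((D - M) / A) M M₁ v p w b (A * p) r l τ (l₁ * (κ / A))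
        + 2 * l * (κ / A) * jFlux κ γ M v w (A * p) l τ
      ≤ 1 / 2 * (ρ * h ^ 2) - sEnergyD A ρ κ v w p b l l₁ τ τ₂
        - δ / 4 * (l * A * (p + l * (κ / A) * v) ^ 2 + l ^ 3 * (κ ^ 2 / A) * v ^ 2)
        + ε * (l ^ 2 * ρ * v ^ 2) := by
  have hid := carleman_identity hA hρ hκ M M₁ D v w p b r l l₁ τ τ₂
  -- This is `X Y ≤ (X + Y)² / 4`. The equation gives `X + Y = h + c v`, the terms of order `l²`
  -- cancelling because `(κ/ρ)(κ/A) = κ γ`.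
  have hsum : ρ * (r / ρ + l * M * v + 2 * l * (κ / ρ) * p + 2 * l ^ 2 * (κ * γ) * v - τ * v)
        * (w + τ * v - 2 * l * (κ / ρ) * (p + l * (κ / A) * v) - l * M * v)
      ≤ 1 / 4 * (ρ * (h + c * v) ^ 2) := by
    have e1 : κ / ρ * (κ / A) = κ * γ := by
      rw [hκ]; field_simp
    have : h + c * v = (r / ρ + l * M * v + 2 * l * (κ / ρ) * p + 2 * l ^ 2 * (κ * γ) * v - τ * v)
        + (w + τ * v - 2 * l * (κ / ρ) * (p + l * (κ / A) * v) - l * M * v) := by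
      rw [← e1, ← heq]; ring
    rw [this]
    generalize r / ρ + l * M * v + 2 * l * (κ / ρ) * p + 2 * l ^ 2 * (κ * γ) * v - τ * v = X
    generalize w + τ * v - 2 * l * (κ / ρ) * (p + l * (κ / A) * v) - l * M * v = Y
    nlinarith [mul_nonneg hρ.le (sq_nonneg (X - Y))]
  rw [hid] at hsum
  clear hid
  generalize jFluxD κ (ρ * M) γ ((D - M) / A) M M₁ v p w b (A * p) r l τ (l₁ * (κ / A))
    + 2 * l * (κ / A) * jFlux κ γ M v w (A * p) l τ = Z at *
  generalize sEnergyD A ρ κ v w p b l l₁ τ τ₂ = S at *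
  have hN : 0 ≤ N := (abs_nonneg _).trans hM₁
  have h1 : 1 / 4 * (ρ * (h + c * v) ^ 2) ≤ 1 / 2 * (ρ * h ^ 2) + Cc ^ 2 / 2 * (ρ * v ^ 2) := by
    have h2 : c ^ 2 ≤ Cc ^ 2 := by rw [← sq_abs]; gcongr
    have h3 : c ^ 2 * (ρ * v ^ 2) ≤ Cc ^ 2 * (ρ * v ^ 2) := by gcongr
    nlinarith [mul_nonneg hρ.le (sq_nonneg (h - c * v))]
  set W := p + l * (κ / A) * v with hW
  have h2 : δ * (l * A * W ^ 2 + l ^ 3 * (κ ^ 2 / A) * v ^ 2)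
      ≤ D * (l * A * W ^ 2 + l ^ 3 * (κ ^ 2 / A) * v ^ 2) := by gcongr
  -- Young's inequality with parameter `δ`; then `A ≤ N ρ` replaces the leftover `A v²` by `ρ v²`,
  -- which accounts for the third power of `N`.
  have h3 : -(l * M₁ * (A * W) * v) ≤ δ / 2 * (l * A * W ^ 2)
      + N ^ 3 / (2 * δ) * l * (ρ * v ^ 2) := by
    have e1 : -(l * M₁ * (A * W) * v) ≤ l * A * (N * |W| * |v|) := by
      calc -(l * M₁ * (A * W) * v) ≤ |l * M₁ * (A * W) * v| := neg_le_abs _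
        _ = l * A * (|M₁| * |W| * |v|) := by
            simp only [abs_mul, abs_of_pos hA, abs_of_pos hl]; ring
        _ ≤ _ := by gcongr
    have e2 : N * |W| * |v| ≤ δ / 2 * W ^ 2 + N ^ 2 / (2 * δ) * v ^ 2 := by
      have : 0 ≤ (δ * |W| - N * |v|) ^ 2 / (2 * δ) := by positivity
      have e : (δ * |W| - N * |v|) ^ 2 / (2 * δ)
          = δ / 2 * |W| ^ 2 + N ^ 2 / (2 * δ) * |v| ^ 2 - N * |W| * |v| := by
        field_simp; ring
      rw [e, sq_abs, sq_abs] at this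
      linarith
    have e3 : N ^ 2 / (2 * δ) * v ^ 2 * l * A ≤ N ^ 2 / (2 * δ) * v ^ 2 * l * (N * ρ) := by
      gcongr
    calc -(l * M₁ * (A * W) * v) ≤ l * A * (N * |W| * |v|) := e1
      _ ≤ l * A * (δ / 2 * W ^ 2 + N ^ 2 / (2 * δ) * v ^ 2) := by gcongr
      _ = δ / 2 * (l * A * W ^ 2) + N ^ 2 / (2 * δ) * v ^ 2 * l * A := by ring
      _ ≤ δ / 2 * (l * A * W ^ 2) + N ^ 2 / (2 * δ) * v ^ 2 * l * (N * ρ) := by linarith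
      _ = _ := by ring
  have h4 : -(1 / 2 * ρ * τ₂ * v ^ 2) ≤ 1 / 2 * |τ₂| * (ρ * v ^ 2) := by
    have : -τ₂ * (ρ * v ^ 2) ≤ |τ₂| * (ρ * v ^ 2) := by
      gcongr; exact neg_le_abs _
    linarith
  have h5 : 2 * l * l₁ * (κ ^ 2 / A) * v ^ 2 ≤ δ / 4 * (l ^ 3 * (κ ^ 2 / A) * v ^ 2) := by
    have e1 : 2 * l₁ ≤ δ / 4 * l ^ 2 := by linarith [le_abs_self l₁]
    calc 2 * l * l₁ * (κ ^ 2 / A) * v ^ 2 = (2 * l₁) * (l * (κ ^ 2 / A) * v ^ 2) := by ring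
      _ ≤ (δ / 4 * l ^ 2) * (l * (κ ^ 2 / A) * v ^ 2) := by gcongr
      _ = _ := by ring
  have h6 : (1 / 2 * |τ₂| + N ^ 3 / (2 * δ) * l + Cc ^ 2 / 2) * (ρ * v ^ 2)
      ≤ ε * l ^ 2 * (ρ * v ^ 2) := by gcongr
  have h7 : 0 ≤ δ * (l * A * W ^ 2) := by positivity
  have h8 : 0 ≤ δ * (l ^ 3 * (κ ^ 2 / A) * v ^ 2) := by positivity
  linarith

/-! ### Weights and solutions in a unified setting

The equation `v_t + ρ⁻¹ (A v_x)_x - c v = h` covers both the divergence form (`A = a`, `ρ = 1`) and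
the non divergence form (`A = 1`, `ρ = 1/a`). -/

/-- The structural assumptions on the coefficients `A`, `ρ` and on the weight `ψ`, whose derivative
is `d κ / A`. The function `k` is an auxiliary multiplier which yields the coercivity of the
principal terms with respect to `∫ ρ v²`. -/
structure CarlemanWeights (x₀ d δ N : ℝ) (n : ℕ) (A ρ κ γ M M' D ψ k k' : ℝ → ℝ) : Prop where
  x₀_mem : x₀ ∈ Ioo (0 : ℝ) 1
  d_pos : 0 < d
  δ_pos : 0 < δ
  A_pos : ∀ x ∈ Icc (0 : ℝ) 1, x ≠ x₀ → 0 < A x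
  ρ_pos : ∀ x ∈ Icc (0 : ℝ) 1, x ≠ x₀ → 0 < ρ x
  aemeasurable_A : AEMeasurable A muI
  aemeasurable_ρ : AEMeasurable ρ muI
  κ_eq : ∀ x ∈ Icc (0 : ℝ) 1, x ≠ x₀ → κ x = γ x * (ρ x * A x)
  κ_ac : LocACDeriv x₀ κ (fun x => ρ x * M x)
  γ_ac : LocACDeriv x₀ γ (fun x => (D x - M x) / A x)
  M_ac : LocACDeriv x₀ M M'
  ψ_ac : LocACDeriv x₀ ψ (fun x => d * (κ x / A x))
  k_ac : LocACDeriv x₀ k k'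
  le_D : ∀ᵐ x ∂muI, δ ≤ D x
  abs_M_le : ∀ x ∈ Icc (0 : ℝ) 1, x ≠ x₀ → |M x| ≤ N
  abs_M'_le : ∀ᵐ x ∂muI, |M' x| ≤ N
  κγ_le : ∀ x ∈ Icc (0 : ℝ) 1, x ≠ x₀ → κ x * γ x ≤ N
  A_le : ∀ x ∈ Icc (0 : ℝ) 1, x ≠ x₀ → A x ≤ N
  A_le_ρ : ∀ x ∈ Icc (0 : ℝ) 1, x ≠ x₀ → A x ≤ N * ρ x
  ρA_le : ∀ x ∈ Icc (0 : ℝ) 1, x ≠ x₀ → ρ x * A x * (x - x₀) ^ 2 ≤ N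
  abs_κ_le : ∀ x ∈ Icc (0 : ℝ) 1, x ≠ x₀ → |κ x| ≤ N * |x - x₀| * ρ x
  ψ_le : ∀ x ∈ Icc (0 : ℝ) 1, ψ x ≤ -δ
  le_ψ : ∀ x ∈ Icc (0 : ℝ) 1, -N ≤ ψ x
  ψ_cont : ContinuousWithinAt ψ (Icc 0 1) x₀
  -- For `X = v` and `Y = v_x + l (κ/A) v`, the last bracket times the exponential weight is the
  -- derivative of the weighted `k v²`. It therefore integrates to zero once `k v²` vanishes at `x₀`
  -- and at the end points.
  coercive : ∀ᵐ x ∂muI, ∀ l > 0, ∀ X Y : ℝ, l ^ 2 * ρ x * X ^ 2 ≤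
    N * (l * A x * Y ^ 2 + l ^ 3 * (κ x ^ 2 / A x) * X ^ 2)
      + l ^ n * (k' x * X ^ 2 + 2 * k x * X * Y)

/-- A sequence tending to `x₀` along which all boundary terms have a limit. -/
structure TraceSeq (x₀ : ℝ) (A ρ M k v w p G : ℝ → ℝ) (ℓ₁ ℓ₂ ℓ₃ : ℝ) (zs : ℕ → ℝ) : Prop where
  tendsto : Tendsto zs atTop (𝓝 x₀)
  energy : Tendsto (fun n => |zs n - x₀| * (ρ (zs n) * v (zs n) ^ 2 + ρ (zs n) * w (zs n) ^ 2
    + A (zs n) * p (zs n) ^ 2)) atTop (𝓝 0)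
  kv : Tendsto (fun n => k (zs n) * v (zs n) ^ 2) atTop (𝓝 0)
  Gv : Tendsto (fun n => G (zs n) * v (zs n)) atTop (𝓝 ℓ₁)
  Gw : Tendsto (fun n => G (zs n) * w (zs n)) atTop (𝓝 ℓ₂)
  MGv : Tendsto (fun n => M (zs n) * G (zs n) * v (zs n)) atTop (𝓝 ℓ₃)

/-- The regularity of a solution `v` at a fixed time: `w` is the time derivative, `p = v_x`,
`b = w_x`, `G = A v_x` and `r = G_x`. -/
structure SliceRegular (x₀ : ℝ) (A ρ M k v w p b G r : ℝ → ℝ) : Prop where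
  v_ac : LocACDeriv x₀ v p
  w_ac : LocACDeriv x₀ w b
  G_ac : LocACDeriv x₀ G r
  G_eq : ∀ x ∈ Icc (0 : ℝ) 1, x ≠ x₀ → G x = A x * p x
  v_zero : v 0 = 0
  v_one : v 1 = 0
  w_zero : w 0 = 0
  w_one : w 1 = 0
  trace : ∃ xs ys : ℕ → ℝ, (∀ n, xs n ∈ Ioo x₀ 1) ∧ (∀ n, ys n ∈ Ioo 0 x₀) ∧
    ∃ ℓ₁ ℓ₂ ℓ₃, TraceSeq x₀ A ρ M k v w p G ℓ₁ ℓ₂ ℓ₃ xs ∧ TraceSeq x₀ A ρ M k v w p G ℓ₁ ℓ₂ ℓ₃ ys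

/-- Here `e` plays the role of `|x - x₀|`. The bound `|κ| ≤ N e ρ` also gives `|γ| A ≤ N e`, so
every flux term containing `κ` or `γ` is at most a constant times `e` times the energy density. Near
`x₀` only the products of `A p` with `w` and `v` remain. -/
theorem jFlux_sub_le {A ρ γ κ N e B : ℝ} (hA : 0 < A) (hρ : 0 < ρ) (hκ : κ = γ * (ρ * A))
    (he : 0 ≤ e) (hκN : |κ| ≤ N * e * ρ) (hκγ : κ * γ ≤ N) {M v w p l τ : ℝ} (hl : 0 < l)
    (hM : |M| ≤ N) (hτ : |τ| ≤ B) :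
    |jFlux κ γ M v w (A * p) l τ
        - (A * p * w + τ * (A * p * v) - l * (M * (A * p) * v))|
      ≤ (l * N + 2 * l * B * N + 2 * l * N + 3 * l ^ 3 * N ^ 2 + l ^ 2 * N ^ 2) *
        (e * (ρ * v ^ 2 + ρ * w ^ 2 + A * p ^ 2)) := by
  have hN : 0 ≤ N := (abs_nonneg _).trans hM
  have hB : 0 ≤ B := (abs_nonneg _).trans hτ
  have hκγ0 : 0 ≤ κ * γ := by
    have : κ * γ = γ ^ 2 * (ρ * A) := by rw [hκ]; ring
    rw [this]; positivity
  have hγ : |γ| * A ≤ N * e := by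
    have : |κ| = |γ| * A * ρ := by rw [hκ, abs_mul, abs_of_pos (mul_pos hρ hA)]; ring
    rw [this] at hκN
    exact le_of_mul_le_mul_right hκN hρ
  set F := e * (ρ * v ^ 2 + ρ * w ^ 2 + A * p ^ 2) with hF
  have f1 : |κ| * v ^ 2 ≤ N * F := by
    calc |κ| * v ^ 2 ≤ N * e * ρ * v ^ 2 := by gcongr
      _ = N * (e * (ρ * v ^ 2)) := by ring
      _ ≤ N * F := by
        rw [hF]; gcongr
        have : 0 ≤ ρ * w ^ 2 := by positivity
        have : 0 ≤ A * p ^ 2 := by positivity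
        linarith
  have f2 : |κ| * |v| * |w| ≤ N * F := by
    calc |κ| * |v| * |w| ≤ |κ| * (v ^ 2 + w ^ 2) := by
          rw [mul_assoc]; gcongr
          nlinarith [sq_nonneg (|v| - |w|), sq_abs v, sq_abs w, sq_nonneg v, sq_nonneg w]
      _ ≤ N * e * ρ * (v ^ 2 + w ^ 2) := by gcongr
      _ = N * (e * (ρ * v ^ 2 + ρ * w ^ 2)) := by ring
      _ ≤ N * F := by
        rw [hF]
        have : 0 ≤ A * p ^ 2 := by positivity
        exact mul_le_mul_of_nonneg_left
          (mul_le_mul_of_nonneg_left (by linarith) he) hN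
  have f3 : |γ| * (A * p) ^ 2 ≤ N * F := by
    calc |γ| * (A * p) ^ 2 = |γ| * A * (A * p ^ 2) := by ring
      _ ≤ N * e * (A * p ^ 2) := by gcongr
      _ = N * (e * (A * p ^ 2)) := by ring
      _ ≤ N * F := by
        rw [hF]; gcongr
        have : 0 ≤ ρ * w ^ 2 := by positivity
        have : 0 ≤ ρ * v ^ 2 := by positivity
        linarith
  have f4 : |γ| * (κ * v) ^ 2 ≤ N * (N * F) := by
    calc |γ| * (κ * v) ^ 2 = |κ * γ| * (|κ| * v ^ 2) := by
          rw [abs_mul, mul_pow, ← sq_abs κ]; ring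
      _ ≤ N * (N * F) := by rw [abs_of_nonneg hκγ0]; gcongr
  have hFn : 0 ≤ F := by rw [hF]; positivity
  have key : jFlux κ γ M v w (A * p) l τ - (A * p * w + τ * (A * p * v) - l * (M * (A * p) * v))
      = l * (κ * v * w) + 2 * l * (τ * (κ * v ^ 2)) - l * (γ * (A * p + l * (κ * v)) ^ 2)
        - l ^ 2 * (M * (κ * v ^ 2)) - l ^ 3 * ((κ * γ) * (κ * v ^ 2)) := by
    unfold jFlux; ring
  rw [key]
  have g1 : |l * (κ * v * w)| ≤ l * (N * F) := by
    rw [abs_mul, abs_of_pos hl, abs_mul, abs_mul]; gcongr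
  have g2 : |2 * l * (τ * (κ * v ^ 2))| ≤ 2 * l * (B * (N * F)) := by
    rw [abs_mul, abs_of_pos (by positivity : 0 < 2 * l), abs_mul, abs_mul,
      abs_of_nonneg (sq_nonneg v)]
    gcongr
  have g3 : |l * (γ * (A * p + l * (κ * v)) ^ 2)| ≤ l * (2 * (N * F) + 2 * l ^ 2 * (N * (N * F))) := by
    rw [abs_mul, abs_of_pos hl, abs_mul, abs_of_nonneg (sq_nonneg (A * p + l * (κ * v)))]
    gcongr
    have : (A * p + l * (κ * v)) ^ 2 ≤ 2 * (A * p) ^ 2 + 2 * l ^ 2 * (κ * v) ^ 2 := by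
      nlinarith [sq_nonneg (A * p - l * (κ * v))]
    calc |γ| * (A * p + l * (κ * v)) ^ 2 ≤ |γ| * (2 * (A * p) ^ 2 + 2 * l ^ 2 * (κ * v) ^ 2) := by
          gcongr
      _ = 2 * (|γ| * (A * p) ^ 2) + 2 * l ^ 2 * (|γ| * (κ * v) ^ 2) := by ring
      _ ≤ _ := by gcongr
  have g4 : |l ^ 2 * (M * (κ * v ^ 2))| ≤ l ^ 2 * (N * (N * F)) := by
    rw [abs_mul, abs_of_pos (by positivity : 0 < l ^ 2), abs_mul, abs_mul,
      abs_of_nonneg (sq_nonneg v)]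
    gcongr
  have g5 : |l ^ 3 * ((κ * γ) * (κ * v ^ 2))| ≤ l ^ 3 * (N * (N * F)) := by
    rw [abs_mul, abs_of_pos (by positivity : 0 < l ^ 3), abs_mul, abs_mul κ (v ^ 2),
      abs_of_nonneg (sq_nonneg v), abs_of_nonneg hκγ0]
    gcongr
  have t1 := abs_sub (l * (κ * v * w) + 2 * l * (τ * (κ * v ^ 2))
    - l * (γ * (A * p + l * (κ * v)) ^ 2) - l ^ 2 * (M * (κ * v ^ 2))) (l ^ 3 * ((κ * γ) * (κ * v ^ 2)))
  have t2 := abs_sub (l * (κ * v * w) + 2 * l * (τ * (κ * v ^ 2))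
    - l * (γ * (A * p + l * (κ * v)) ^ 2)) (l ^ 2 * (M * (κ * v ^ 2)))
  have t3 := abs_sub (l * (κ * v * w) + 2 * l * (τ * (κ * v ^ 2)))
    (l * (γ * (A * p + l * (κ * v)) ^ 2))
  have t4 := abs_add_le (l * (κ * v * w)) (2 * l * (τ * (κ * v ^ 2)))
  refine (t1.trans (add_le_add (t2.trans (add_le_add (t3.trans (add_le_add
    (t4.trans (add_le_add g1 g2)) g3)) g4)) g5)).trans (le_of_eq ?_)
  ring

/-! ### Inequalities in space at a fixed time. -/

section Slice

variable {x₀ d δ N : ℝ} {n : ℕ} {A ρ κ γ M M' D ψ k k' : ℝ → ℝ}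

namespace CarlemanWeights

theorem weight_ac (H : CarlemanWeights x₀ d δ N n A ρ κ γ M M' D ψ k k') (y : ℝ) :
    LocACDeriv x₀ (fun x => Real.exp (2 * y * ψ x))
      (fun x => Real.exp (2 * y * ψ x) * (2 * (y * d) * (κ x / A x))) := by
  refine (H.ψ_ac.const_mul (2 * y)).exp.congr_deriv (ae_of_all _ fun x => ?_)
  ring

theorem abs_ψ_le (H : CarlemanWeights x₀ d δ N n A ρ κ γ M M' D ψ k k') {x : ℝ}
    (hx : x ∈ Icc (0 : ℝ) 1) : |ψ x| ≤ N :=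
  abs_le.2 ⟨H.le_ψ x hx, by linarith [H.le_ψ x hx, H.ψ_le x hx, H.δ_pos]⟩

theorem N_nonneg (H : CarlemanWeights x₀ d δ N n A ρ κ γ M M' D ψ k k') : 0 ≤ N :=
  (abs_nonneg _).trans (H.abs_ψ_le (x := 0) (by simp))

theorem κ_sq_div (H : CarlemanWeights x₀ d δ N n A ρ κ γ M M' D ψ k k') {x : ℝ}
    (hx : x ∈ Icc (0 : ℝ) 1) (hne : x ≠ x₀) : κ x ^ 2 / A x = κ x * γ x * ρ x := by
  have h1 := H.A_pos x hx hne
  rw [H.κ_eq x hx hne]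
  field_simp

theorem κ_sq_div_le (H : CarlemanWeights x₀ d δ N n A ρ κ γ M M' D ψ k k') {x : ℝ}
    (hx : x ∈ Icc (0 : ℝ) 1) (hne : x ≠ x₀) : κ x ^ 2 / A x ≤ N * ρ x := by
  rw [H.κ_sq_div hx hne]
  have := H.ρ_pos x hx hne
  gcongr
  exact H.κγ_le x hx hne

theorem Ioo_right (H : CarlemanWeights x₀ d δ N n A ρ κ γ M M' D ψ k k') {x : ℝ}
    (hx : x ∈ Ioo x₀ 1) : x ∈ Icc (0 : ℝ) 1 ∧ x ≠ x₀ :=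
  ⟨⟨(H.x₀_mem.1.trans hx.1).le, hx.2.le⟩, hx.1.ne'⟩

theorem Ioo_left (H : CarlemanWeights x₀ d δ N n A ρ κ γ M M' D ψ k k') {x : ℝ}
    (hx : x ∈ Ioo 0 x₀) : x ∈ Icc (0 : ℝ) 1 ∧ x ≠ x₀ :=
  ⟨⟨hx.1.le, (hx.2.trans H.x₀_mem.2).le⟩, hx.2.ne⟩

variable {v w p b G r : ℝ → ℝ}

/-- The weighted flux has a limit along trace sequences. -/
theorem tendsto_flux (H : CarlemanWeights x₀ d δ N n A ρ κ γ M M' D ψ k k')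
    (hS : SliceRegular x₀ A ρ M k v w p b G r) {ℓ₁ ℓ₂ ℓ₃ : ℝ} {zs : ℕ → ℝ}
    (hz : TraceSeq x₀ A ρ M k v w p G ℓ₁ ℓ₂ ℓ₃ zs)
    (hzs : ∀ n, zs n ∈ Icc (0 : ℝ) 1 ∧ zs n ≠ x₀) {y l σ : ℝ} (hl : 0 < l) :
    Tendsto (fun n => Real.exp (2 * y * ψ (zs n)) *
      jFlux (κ (zs n)) (γ (zs n)) (M (zs n)) (v (zs n)) (w (zs n)) (G (zs n)) l (σ * ψ (zs n)))
      atTop (𝓝 (Real.exp (2 * y * ψ x₀) * (ℓ₂ + σ * ψ x₀ * ℓ₁ - l * ℓ₃))) := by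
  have hψ : Tendsto (fun n => ψ (zs n)) atTop (𝓝 (ψ x₀)) :=
    H.ψ_cont.tendsto.comp (tendsto_nhdsWithin_iff.2
      ⟨hz.tendsto, Eventually.of_forall fun n => (hzs n).1⟩)
  have hE : Tendsto (fun n => Real.exp (2 * y * ψ (zs n))) atTop
      (𝓝 (Real.exp (2 * y * ψ x₀))) :=
    (Real.continuous_exp.tendsto _).comp (hψ.const_mul _)
  refine hE.mul ?_
  have hmain : Tendsto (fun n => G (zs n) * w (zs n) + σ * ψ (zs n) * (G (zs n) * v (zs n))
      - l * (M (zs n) * G (zs n) * v (zs n))) atTop (𝓝 (ℓ₂ + σ * ψ x₀ * ℓ₁ - l * ℓ₃)) :=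
    (hz.Gw.add ((hψ.const_mul σ).mul hz.Gv)).sub (hz.MGv.const_mul l)
  have hrem := hz.energy.const_mul (l * N + 2 * l * (|σ| * N) * N + 2 * l * N
    + 3 * l ^ 3 * N ^ 2 + l ^ 2 * N ^ 2)
  rw [mul_zero] at hrem
  have hdiff : Tendsto (fun n =>
      jFlux (κ (zs n)) (γ (zs n)) (M (zs n)) (v (zs n)) (w (zs n)) (G (zs n)) l (σ * ψ (zs n))
      - (G (zs n) * w (zs n) + σ * ψ (zs n) * (G (zs n) * v (zs n))
      - l * (M (zs n) * G (zs n) * v (zs n)))) atTop (𝓝 0) := by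
    refine squeeze_zero_norm (fun n => ?_) hrem
    obtain ⟨hx, hne⟩ := hzs n
    rw [hS.G_eq _ hx hne, Real.norm_eq_abs]
    refine jFlux_sub_le (H.A_pos _ hx hne) (H.ρ_pos _ hx hne) (H.κ_eq _ hx hne) (abs_nonneg _)
      (H.abs_κ_le _ hx hne) (H.κγ_le _ hx hne) hl (H.abs_M_le _ hx hne) ?_
    rw [abs_mul]
    gcongr
    exact H.abs_ψ_le hx
  simpa using hdiff.add hmain

/-- The flux is locally absolutely continuous. -/
theorem flux_ac (H : CarlemanWeights x₀ d δ N n A ρ κ γ M M' D ψ k k')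
    (hS : SliceRegular x₀ A ρ M k v w p b G r) (y σ : ℝ) :
    LocACDeriv x₀ (fun x => Real.exp (2 * y * ψ x) *
      jFlux (κ x) (γ x) (M x) (v x) (w x) (G x) (y * d) (σ * ψ x))
      (fun x => Real.exp (2 * y * ψ x) *
        (jFluxD (κ x) (ρ x * M x) (γ x) ((D x - M x) / A x) (M x) (M' x) (v x) (p x) (w x) (b x)
            (A x * p x) (r x) (y * d) (σ * ψ x) (σ * d * (κ x / A x))
          + 2 * (y * d) * (κ x / A x) *
            jFlux (κ x) (γ x) (M x) (v x) (w x) (A x * p x) (y * d) (σ * ψ x))) := by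
  have hf := hS.G_ac.add ((H.κ_ac.mul hS.v_ac).const_mul (y * d))
  have hτ := H.ψ_ac.const_mul σ
  have h1 := hf.mul (hS.w_ac.add (hτ.mul hS.v_ac))
  have h2 := (H.γ_ac.mul (hf.mul hf)).const_mul (y * d)
  have h3 := ((H.M_ac.mul hf).mul hS.v_ac).const_mul (y * d)
  have h4 := ((H.κ_ac.mul (((H.κ_ac.mul H.γ_ac).const_mul ((y * d) ^ 2)).sub hτ)).mul
    (hS.v_ac.mul hS.v_ac)).const_mul (y * d)
  have h5 := (H.weight_ac y).mul (((h1.sub h2).sub h3).sub h4)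
  refine h5.congr H.x₀_mem (fun x hx hne => ?_) ?_
  · unfold jFlux; ring
  · filter_upwards [ae_Icc_ne x₀] with x hx
    rw [hS.G_eq x hx.1 hx.2]
    unfold jFlux jFluxD
    ring

/-- The spatial part of the Carleman inequality at a fixed time. -/
theorem slice_carleman (H : CarlemanWeights x₀ d δ N n A ρ κ γ M M' D ψ k k')
    (hS : SliceRegular x₀ A ρ M k v w p b G r) {c h : ℝ → ℝ} {y σ σ₂ ε Cc : ℝ} (hy : 0 < y)
    (heq : ∀ᵐ x ∂muI, w x + r x / ρ x - c x * v x = h x) (hc : ∀ᵐ x ∂muI, |c x| ≤ Cc)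
    (hε : 1 / 2 * (|σ₂| * N) + N ^ 3 / (2 * δ) * (y * d) + Cc ^ 2 / 2 ≤ ε * (y * d) ^ 2)
    (hσ : 2 * |σ * d| ≤ δ / 4 * (y * d) ^ 2) {q : ℝ → ℝ} (hq : Integrable q muI)
    (hqe : ∀ᵐ x ∂muI, q x = Real.exp (2 * y * ψ x) * (1 / 2 * (ρ x * h x ^ 2)
        - sEnergyD (A x) (ρ x) (κ x) (v x) (w x) (p x) (b x) (y * d) (σ * d) (σ * ψ x) (σ₂ * ψ x)
        - δ / 4 * (y * d * A x * (p x + y * d * (κ x / A x) * v x) ^ 2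
          + (y * d) ^ 3 * (κ x ^ 2 / A x) * v x ^ 2)
        + ε * ((y * d) ^ 2 * ρ x * v x ^ 2))) :
    -(y * d * (γ 1 * G 1 ^ 2 * Real.exp (2 * y * ψ 1) - γ 0 * G 0 ^ 2 * Real.exp (2 * y * ψ 0)))
      ≤ ∫ x, q x ∂muI := by
  have hl : 0 < y * d := mul_pos hy H.d_pos
  obtain ⟨xs, ys, hxs, hys, ℓ₁, ℓ₂, ℓ₃, hX, hY⟩ := hS.trace
  have hmain := (H.flux_ac hS y σ).sub_le_integral H.x₀_mem hq ?_ hxs hys hX.tendsto hY.tendsto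
    (H.tendsto_flux hS hX (fun n => H.Ioo_right (hxs n)) hl)
    (H.tendsto_flux hS hY (fun n => H.Ioo_left (hys n)) hl)
  -- At the end points `v = w = 0`, and only `-l γ G²` survives in the flux.
  · refine le_trans (le_of_eq ?_) hmain
    rw [hS.v_one, hS.v_zero, hS.w_one, hS.w_zero]
    unfold jFlux
    ring
  · filter_upwards [heq, hc, hqe, ae_Icc_ne x₀, H.le_D, H.abs_M'_le] with x e1 e2 e3 e4 e5 e6
    rw [e3]
    refine mul_le_mul_of_nonneg_left ?_ (Real.exp_pos _).le
    refine carleman_pointwise (H.A_pos x e4.1 e4.2) (H.ρ_pos x e4.1 e4.2) (H.κ_eq x e4.1 e4.2)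
      e1 hl H.δ_pos e5 e6 (H.A_le_ρ x e4.1 e4.2) e2 (le_trans ?_ hε) hσ
    have : |σ₂ * ψ x| ≤ |σ₂| * N := by
      rw [abs_mul]
      gcongr
      exact H.abs_ψ_le e4.1
    linarith

/-- Coercivity at a fixed time. -/
theorem slice_coercive (H : CarlemanWeights x₀ d δ N n A ρ κ γ M M' D ψ k k')
    (hS : SliceRegular x₀ A ρ M k v w p b G r) {y : ℝ} (hy : 0 < y) {q : ℝ → ℝ}
    (hq : Integrable q muI)
    (hqe : ∀ᵐ x ∂muI, q x = Real.exp (2 * y * ψ x) *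
      (N * (y * d * A x * (p x + y * d * (κ x / A x) * v x) ^ 2
          + (y * d) ^ 3 * (κ x ^ 2 / A x) * v x ^ 2) - (y * d) ^ 2 * ρ x * v x ^ 2)) :
    0 ≤ ∫ x, q x ∂muI := by
  have hl : 0 < y * d := mul_pos hy H.d_pos
  obtain ⟨xs, ys, hxs, hys, ℓ₁, ℓ₂, ℓ₃, hX, hY⟩ := hS.trace
  -- The function `-l^n e^{2yψ} k v²` vanishes at both end points and tends to zero along the trace
  -- sequences, so subtracting its derivative from the coercivity bound costs nothing.
  have hac := ((H.weight_ac y).mul (H.k_ac.mul (hS.v_ac.mul hS.v_ac))).const_mul (-(y * d) ^ n)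
  have hlim : ∀ zs : ℕ → ℝ, TraceSeq x₀ A ρ M k v w p G ℓ₁ ℓ₂ ℓ₃ zs →
      (∀ n, zs n ∈ Icc (0 : ℝ) 1 ∧ zs n ≠ x₀) →
      Tendsto (fun m => -(y * d) ^ n * (Real.exp (2 * y * ψ (zs m)) *
        (k (zs m) * (v (zs m) * v (zs m))))) atTop (𝓝 0) := by
    intro zs hz hzs
    have hψ : Tendsto (fun n => ψ (zs n)) atTop (𝓝 (ψ x₀)) :=
      H.ψ_cont.tendsto.comp (tendsto_nhdsWithin_iff.2
        ⟨hz.tendsto, Eventually.of_forall fun n => (hzs n).1⟩)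
    have hE : Tendsto (fun n => Real.exp (2 * y * ψ (zs n))) atTop
        (𝓝 (Real.exp (2 * y * ψ x₀))) :=
      (Real.continuous_exp.tendsto _).comp (hψ.const_mul _)
    have := (hE.mul hz.kv).const_mul (-(y * d) ^ n)
    simpa [sq] using this
  have hmain := hac.sub_le_integral H.x₀_mem hq ?_ hxs hys hX.tendsto hY.tendsto
    (hlim xs hX (fun n => H.Ioo_right (hxs n))) (hlim ys hY (fun n => H.Ioo_left (hys n)))
  · simpa [hS.v_one, hS.v_zero] using hmain
  · filter_upwards [hqe, H.coercive] with x e1 e2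
    rw [e1]
    have e3 := e2 (y * d) hl (v x) (p x + y * d * (κ x / A x) * v x)
    have e4 := mul_le_mul_of_nonneg_left e3 (Real.exp_pos (2 * y * ψ x)).le
    linarith

/-- The fluxes at the end points are controlled by the interior energy. -/
theorem slice_boundary (H : CarlemanWeights x₀ d δ N n A ρ κ γ M M' D ψ k k')
    (hS : SliceRegular x₀ A ρ M k v w p b G r) {q : ℝ → ℝ} (hq : Integrable q muI)
    (hqe : ∀ᵐ x ∂muI, q x = (2 * N + 1) * (A x * p x ^ 2) + r x ^ 2 / ρ x) :
    (1 - x₀) * G 1 ^ 2 + x₀ * G 0 ^ 2 ≤ ∫ x, q x ∂muI := by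
  obtain ⟨xs, ys, hxs, hys, ℓ₁, ℓ₂, ℓ₃, hX, hY⟩ := hS.trace
  have hid : LocACDeriv x₀ (fun x => x - x₀) (fun _ => 1) :=
    LocACDeriv.of_contDiff (by fun_prop) fun x => (hasDerivAt_id x).sub_const x₀
  -- The multiplier `x - x₀` gives both end point values of `G²` a favourable sign and removes `x₀`,
  -- since `|x - x₀| G² ≤ N |x - x₀| A p²`.
  have hac := hid.mul (hS.G_ac.mul hS.G_ac)
  have hN := H.N_nonneg
  have hlim : ∀ zs : ℕ → ℝ, TraceSeq x₀ A ρ M k v w p G ℓ₁ ℓ₂ ℓ₃ zs →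
      (∀ n, zs n ∈ Icc (0 : ℝ) 1 ∧ zs n ≠ x₀) →
      Tendsto (fun m => (zs m - x₀) * (G (zs m) * G (zs m))) atTop (𝓝 0) := by
    intro zs hz hzs
    have := hz.energy.const_mul N
    rw [mul_zero] at this
    refine squeeze_zero_norm (fun m => ?_) this
    obtain ⟨hx, hne⟩ := hzs m
    have hA := H.A_pos _ hx hne
    have hρ := H.ρ_pos _ hx hne
    have hAN := H.A_le _ hx hne
    rw [hS.G_eq _ hx hne, Real.norm_eq_abs, abs_mul, ← sq,
      abs_of_nonneg (sq_nonneg (A (zs m) * p (zs m)))]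
    generalize zs m = x at *
    have e1 : (A x * p x) ^ 2 ≤ N * (A x * p x ^ 2) := by
      calc (A x * p x) ^ 2 = A x * (A x * p x ^ 2) := by ring
        _ ≤ _ := by gcongr
    have e2 : 0 ≤ ρ x * v x ^ 2 + ρ x * w x ^ 2 := by positivity
    calc |x - x₀| * (A x * p x) ^ 2 ≤ |x - x₀| * (N * (A x * p x ^ 2)) := by gcongr
      _ = N * (|x - x₀| * (A x * p x ^ 2)) := by ring
      _ ≤ _ := by gcongr; linarith
  have hmain := hac.sub_le_integral H.x₀_mem hq ?_ hxs hys hX.tendsto hY.tendsto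
    (hlim xs hX (fun n => H.Ioo_right (hxs n))) (hlim ys hY (fun n => H.Ioo_left (hys n)))
  · refine le_trans (le_of_eq ?_) hmain
    ring
  · filter_upwards [hqe, ae_Icc_ne x₀] with x e1 e4
    rw [e1, hS.G_eq x e4.1 e4.2]
    have hA := H.A_pos _ e4.1 e4.2
    have hρ := H.ρ_pos _ e4.1 e4.2
    have hAN := H.A_le _ e4.1 e4.2
    have hρA := H.ρA_le _ e4.1 e4.2
    have f1 : A x * (A x * p x ^ 2) ≤ N * (A x * p x ^ 2) := by gcongr
    have f2 : ρ x * A x * (x - x₀) ^ 2 * (A x * p x ^ 2) ≤ N * (A x * p x ^ 2) := by gcongr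
    -- Young's inequality weighted by `ρ`, so that `r² / ρ`, which is integrable, appears.
    have f3 : 2 * ((x - x₀) * (A x * p x) * r x)
        ≤ ρ x * A x * (x - x₀) ^ 2 * (A x * p x ^ 2) + r x ^ 2 / ρ x := by
      have : 0 ≤ (ρ x * ((x - x₀) * (A x * p x)) - r x) ^ 2 / ρ x := by positivity
      have e : (ρ x * ((x - x₀) * (A x * p x)) - r x) ^ 2 / ρ x
          = ρ x * A x * (x - x₀) ^ 2 * (A x * p x ^ 2) + r x ^ 2 / ρ x
            - 2 * ((x - x₀) * (A x * p x) * r x) := by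
        field_simp; ring
      linarith
    have f4 : 0 ≤ A x * p x ^ 2 := by positivity
    linarith

end CarlemanWeights

end Slice

/-! ### Integration in time -/

/-- The time weights blow up at both ends, so absolute continuity holds only on compact subintervals
of `(0,T)`. The fundamental theorem is applied there and the end values are obtained as limits. -/
theorem integral_eq_zero_of_tendsto {T : ℝ} (hT : 0 < T) {S S' : ℝ → ℝ}
    (hac : ∀ t₁ ∈ Ioo 0 T, ∀ t₂ ∈ Ioo 0 T, t₁ ≤ t₂ → AbsolutelyContinuousOnInterval S t₁ t₂)
    (hd : ∀ᵐ t ∂volume.restrict (Ioo 0 T), HasDerivAt S (S' t) t)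
    (hint : Integrable S' (volume.restrict (Ioo 0 T)))
    (h0 : Tendsto S (𝓝[>] 0) (𝓝 0)) (h1 : Tendsto S (𝓝[<] T) (𝓝 0)) :
    ∫ t, S' t ∂(volume.restrict (Ioo 0 T)) = 0 := by
  have hii : IntervalIntegrable S' volume 0 T := by
    rw [intervalIntegrable_iff_integrableOn_Ioo_of_le hT.le]
    exact hint
  have hcont : ContinuousOn (fun z => ∫ x in (0 : ℝ)..z, S' x) (Icc 0 T) := by
    have := intervalIntegral.continuousOn_primitive_interval (μ := volume) (f := S') (a := 0)
      (b := T) (by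
        rw [uIcc_of_le hT.le, integrableOn_Icc_iff_integrableOn_Ioo]
        exact hint)
    rwa [uIcc_of_le hT.le] at this
  obtain ⟨u, -, hu, hu'⟩ := exists_seq_strictAnti_tendsto' (show (0 : ℝ) < T / 2 by positivity)
  obtain ⟨z, -, hz, hz'⟩ := exists_seq_strictMono_tendsto' (show T / 2 < T by linarith)
  have hum : ∀ n, u n ∈ Ioo 0 T := fun n => ⟨(hu n).1, by linarith [(hu n).2]⟩
  have hzm : ∀ n, z n ∈ Ioo 0 T := fun n => ⟨by linarith [(hz n).1], (hz n).2⟩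
  have e : ∀ n, (∫ x in (0 : ℝ)..z n, S' x) - (∫ x in (0 : ℝ)..u n, S' x) = S (z n) - S (u n) := by
    intro n
    have huz : u n ≤ z n := by linarith [(hu n).2, (hz n).1]
    rw [← (hac _ (hum n) _ (hzm n) huz).integral_eq_sub_of_hasDerivAt huz
      (ae_restrict_of_ae_restrict_of_subset (Ioo_subset_Ioo (hum n).1.le (hzm n).2.le) hd)]
    refine intervalIntegral.integral_interval_sub_left (hii.mono_set ?_) (hii.mono_set ?_)
    · rw [uIcc_of_le hT.le, uIcc_of_le (hzm n).1.le]
      exact Icc_subset_Icc_right (hzm n).2.le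
    · rw [uIcc_of_le hT.le, uIcc_of_le (hum n).1.le]
      exact Icc_subset_Icc_right (hum n).2.le
  have l1 : Tendsto (fun n => (∫ x in (0 : ℝ)..z n, S' x) - ∫ x in (0 : ℝ)..u n, S' x) atTop
      (𝓝 ((∫ x in (0 : ℝ)..T, S' x) - ∫ x in (0 : ℝ)..0, S' x)) := by
    refine ((hcont T ⟨hT.le, le_rfl⟩).tendsto.comp ?_).sub
      ((hcont 0 ⟨le_rfl, hT.le⟩).tendsto.comp ?_)
    · exact tendsto_nhdsWithin_iff.2 ⟨hz', Eventually.of_forall fun n => Ioo_subset_Icc_self (hzm n)⟩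
    · exact tendsto_nhdsWithin_iff.2 ⟨hu', Eventually.of_forall fun n => Ioo_subset_Icc_self (hum n)⟩
  have l2 : Tendsto (fun n => S (z n) - S (u n)) atTop (𝓝 (0 - 0)) := by
    refine (h1.comp ?_).sub (h0.comp ?_)
    · exact tendsto_nhdsWithin_iff.2 ⟨hz', Eventually.of_forall fun n => (hzm n).2⟩
    · exact tendsto_nhdsWithin_iff.2 ⟨hu', Eventually.of_forall fun n => (hum n).1⟩
  simp only [e] at l1
  have := tendsto_nhds_unique l1 l2
  rw [intervalIntegral.integral_same, sub_zero, sub_zero, intervalIntegral.integral_of_le hT.le,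
    ← restrict_Ioo_eq_restrict_Ioc] at this
  exact this

theorem contDiffOn_Theta (T : ℝ) : ContDiffOn ℝ 1 (Theta T) (Ioo 0 T) := by
  unfold Theta
  refine ContDiffOn.div (by fun_prop) (by fun_prop) fun t ht => ?_
  exact (pow_pos (mul_sub_pos ht) 4).ne'

theorem contDiffOn_ThetaD (T : ℝ) : ContDiffOn ℝ 1 (ThetaD T) (Ioo 0 T) := by
  unfold ThetaD
  refine ContDiffOn.div (by fun_prop) (by fun_prop) fun t ht => ?_
  exact (pow_pos (mul_sub_pos ht) 5).ne'

/-- The exponential weight dominates the powers of `Theta`. -/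
theorem exists_weight_bound {T s δ : ℝ} (hs : 0 < s) (hδ : 0 < δ) :
    ∃ K > 0, ∀ t ∈ Ioo 0 T, ∀ z ≤ -δ, ∀ j ∈ Finset.range 5,
      Real.exp (2 * (s * Theta T t) * z) * Theta T t ^ j ≤ K := by
  -- Each summand comes from `x^j / j! ≤ e^x` at `x = 2 s Θ δ`, and the sum serves all `j ≤ 4` at
  -- once. The power 4 is the largest needed: the energy derivative is bounded by the square of `Q
  -- (1 + Θ²)`.
  refine ⟨∑ j ∈ Finset.range 5, (j.factorial : ℝ) / (2 * s * δ) ^ j, by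
    refine Finset.sum_pos (fun j _ => by positivity) ⟨0, by simp⟩, fun t ht z hz j hj => ?_⟩
  have hΘ := Theta_pos ht
  refine le_trans ?_ (Finset.single_le_sum (f := fun j : ℕ => (j.factorial : ℝ) / (2 * s * δ) ^ j)
    (fun j _ => by positivity) hj)
  have h1 := Real.pow_div_factorial_le_exp (2 * (s * Theta T t) * δ) (by positivity) j
  have h2 : Real.exp (2 * (s * Theta T t) * z) ≤ (Real.exp (2 * (s * Theta T t) * δ))⁻¹ := by
    rw [← Real.exp_neg]
    apply Real.exp_le_exp.2
    have := mul_le_mul_of_nonneg_left hz (by positivity : 0 ≤ 2 * (s * Theta T t))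
    linarith
  have hx := Real.exp_pos (2 * (s * Theta T t) * δ)
  calc Real.exp (2 * (s * Theta T t) * z) * Theta T t ^ j
      ≤ (Real.exp (2 * (s * Theta T t) * δ))⁻¹ * Theta T t ^ j := by gcongr
    _ ≤ (j.factorial : ℝ) / (2 * s * δ) ^ j := by
      rw [inv_mul_eq_div, div_le_div_iff₀ hx (by positivity)]
      rw [div_le_iff₀ (by positivity)] at h1
      calc Theta T t ^ j * (2 * s * δ) ^ j = (2 * (s * Theta T t) * δ) ^ j := by
            rw [← mul_pow]; congr 1; ring
        _ ≤ _ := by linarith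

theorem abs_mul_le_energy {A ρ κ N x y : ℝ} (hA : 0 < A) (hκ : κ ^ 2 / A ≤ N * ρ) :
    |κ * x * y| ≤ N * (ρ * x ^ 2) + A * y ^ 2 := by
  have h1 : 0 ≤ (|κ * x| - A * |y|) ^ 2 / A := by positivity
  have h2 : (|κ * x| - A * |y|) ^ 2 / A = κ ^ 2 / A * x ^ 2 + A * y ^ 2 - 2 * |κ * x * y| := by
    have : (|κ * x| - A * |y|) ^ 2 = κ ^ 2 * x ^ 2 + A ^ 2 * y ^ 2 - 2 * A * |κ * x * y| := by
      rw [abs_mul (κ * x) y, sub_sq, sq_abs, mul_pow, mul_pow A, sq_abs]; ring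
    rw [this]; field_simp
  have h3 : κ ^ 2 / A * x ^ 2 ≤ N * ρ * x ^ 2 := by gcongr
  have h4 : 0 ≤ A * y ^ 2 := by positivity
  have h5 : 0 ≤ N * ρ * x ^ 2 := le_trans (by positivity) h3
  linarith

theorem abs_mul_le_sq_add_sq (x y : ℝ) : |x * y| ≤ x ^ 2 + y ^ 2 := by
  rw [abs_le]
  constructor <;> nlinarith [sq_nonneg (x + y), sq_nonneg (x - y)]

theorem abs_sEnergy_le {A ρ κ N v p l τ Z : ℝ} (hA : 0 < A) (hρ : 0 < ρ)
    (hκ : κ ^ 2 / A ≤ N * ρ) (hN : 0 ≤ N) (hZ : 1 ≤ Z) (hl : |l| ≤ Z) (hτ : |τ| ≤ Z) :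
    |sEnergy A ρ κ v p l τ| ≤ (N + 2) * Z * (ρ * v ^ 2 + A * p ^ 2) := by
  have h1 := abs_mul_le_energy (x := v) (y := p) hA hκ
  have h2 : 0 ≤ ρ * v ^ 2 := by positivity
  have h3 : 0 ≤ A * p ^ 2 := by positivity
  have e : sEnergy A ρ κ v p l τ = -(1 / 2 * τ * (ρ * v ^ 2)) - l * (κ * v * p)
      - 1 / 2 * (A * p ^ 2) := by unfold sEnergy; ring
  have a1 : |1 / 2 * τ * (ρ * v ^ 2)| ≤ 1 / 2 * Z * (ρ * v ^ 2) := by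
    rw [abs_mul, abs_mul, abs_of_nonneg h2]
    norm_num
    gcongr
  have a2 : |l * (κ * v * p)| ≤ Z * (N * (ρ * v ^ 2) + A * p ^ 2) := by
    rw [abs_mul]; gcongr
  have a3 : A * p ^ 2 ≤ Z * (A * p ^ 2) := le_mul_of_one_le_left h3 hZ
  rw [e, abs_le]
  rw [abs_le] at a1 a2
  have a4 : 0 ≤ Z * (ρ * v ^ 2) := by positivity
  have a5 : 0 ≤ N * Z * (A * p ^ 2) := by positivity
  constructor <;> linarith

/-- Each term has at most two of the coefficients `l, l₁, τ, τ₁`, all bounded by `Z ≥ 1`, times a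
product of two of `v, w, p, b`. The mixed products with `κ` are controlled by `κ² / A ≤ N ρ`. -/
theorem abs_sEnergyD_le {A ρ κ N v w p b l l₁ τ τ₁ Z : ℝ} (hA : 0 < A) (hρ : 0 < ρ)
    (hκ : κ ^ 2 / A ≤ N * ρ) (hN : 0 ≤ N) (hZ : 1 ≤ Z) (hl : |l| ≤ Z) (hl₁ : |l₁| ≤ Z)
    (hτ : |τ| ≤ Z) (hτ₁ : |τ₁| ≤ Z) :
    |sEnergyD A ρ κ v w p b l l₁ τ τ₁|
      ≤ 6 * (N + 2) * Z ^ 2 * (ρ * v ^ 2 + ρ * w ^ 2 + A * p ^ 2 + A * b ^ 2) := by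
  have h0 := abs_sEnergy_le (v := v) (p := p) hA hρ hκ hN hZ hl hτ
  have h2 : 0 ≤ ρ * v ^ 2 := by positivity
  have h3 : 0 ≤ A * p ^ 2 := by positivity
  have h4 : 0 ≤ ρ * w ^ 2 := by positivity
  have h5 : 0 ≤ A * b ^ 2 := by positivity
  have hZ0 : 0 ≤ Z := by linarith
  have hZZ : Z ≤ Z ^ 2 := by nlinarith
  set F := ρ * v ^ 2 + ρ * w ^ 2 + A * p ^ 2 + A * b ^ 2 with hF
  have hF0 : 0 ≤ F := by positivity
  have e : sEnergyD A ρ κ v w p b l l₁ τ τ₁ = 2 * (τ * sEnergy A ρ κ v p l τ)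
      - 1 / 2 * (τ₁ * (ρ * v ^ 2)) - τ * (ρ * (v * w)) - l₁ * (κ * v * p)
      - l * (κ * w * p) - l * (κ * v * b) - A * (p * b) := by unfold sEnergyD; ring
  have hmul : ∀ {x y B : ℝ}, |x| ≤ Z → |y| ≤ B * F → 0 ≤ B → |x * y| ≤ B * (Z ^ 2 * F) := by
    intro x y B hx hy hB
    rw [abs_mul]
    calc |x| * |y| ≤ Z ^ 2 * (B * F) :=
          mul_le_mul (hx.trans hZZ) hy (abs_nonneg _) (by positivity)
      _ = _ := by ring
  have hNF : N * F = N * (ρ * v ^ 2) + N * (ρ * w ^ 2) + N * (A * p ^ 2) + N * (A * b ^ 2) := by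
    rw [hF]; ring
  have n2 := mul_nonneg hN h2
  have n3 := mul_nonneg hN h3
  have n4 := mul_nonneg hN h4
  have n5 := mul_nonneg hN h5
  have a0 : |τ * sEnergy A ρ κ v p l τ| ≤ (N + 2) * (Z ^ 2 * F) := by
    rw [abs_mul]
    calc |τ| * |sEnergy A ρ κ v p l τ| ≤ Z * ((N + 2) * Z * F) := by
          gcongr
          refine h0.trans ?_
          gcongr
          rw [hF]
          linarith only [h4, h5]
      _ = _ := by ring
  have a1 : |τ₁ * (ρ * v ^ 2)| ≤ 1 * (Z ^ 2 * F) := by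
    refine hmul hτ₁ ?_ zero_le_one
    rw [abs_of_nonneg h2, hF]; linarith only [h3, h4, h5]
  have a2 : |τ * (ρ * (v * w))| ≤ 1 * (Z ^ 2 * F) := by
    refine hmul hτ ?_ zero_le_one
    rw [abs_mul, abs_of_pos hρ]
    have := abs_mul_le_sq_add_sq v w
    calc ρ * |v * w| ≤ ρ * (v ^ 2 + w ^ 2) := by gcongr
      _ ≤ 1 * F := by rw [hF]; linarith only [h3, h5]
  have a3 : |l₁ * (κ * v * p)| ≤ (N + 1) * (Z ^ 2 * F) :=
    hmul hl₁ ((abs_mul_le_energy hA hκ).trans (by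
      rw [add_mul, hNF, hF]; linarith only [h2, h3, h4, h5, n2, n3, n4, n5])) (by linarith only [hN])
  have a4 : |l * (κ * w * p)| ≤ (N + 1) * (Z ^ 2 * F) :=
    hmul hl ((abs_mul_le_energy hA hκ).trans (by
      rw [add_mul, hNF, hF]; linarith only [h2, h3, h4, h5, n2, n3, n4, n5])) (by linarith only [hN])
  have a5 : |l * (κ * v * b)| ≤ (N + 1) * (Z ^ 2 * F) :=
    hmul hl ((abs_mul_le_energy hA hκ).trans (by
      rw [add_mul, hNF, hF]; linarith only [h2, h3, h4, h5, n2, n3, n4, n5])) (by linarith only [hN])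
  have a6 : |A * (p * b)| ≤ 1 * (Z ^ 2 * F) := by
    have e1 : A * (p * b) = 1 * (A * (p * b)) := by ring
    rw [e1]
    refine hmul (by simpa using hZ) ?_ zero_le_one
    rw [abs_mul, abs_of_pos hA]
    have := abs_mul_le_sq_add_sq p b
    calc A * |p * b| ≤ A * (p ^ 2 + b ^ 2) := by gcongr
      _ ≤ 1 * F := by rw [hF]; linarith only [h2, h4]
  rw [e, show 6 * (N + 2) * Z ^ 2 * F = 6 * (N + 2) * (Z ^ 2 * F) by ring]
  have hY : 0 ≤ Z ^ 2 * F := by positivity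
  have hNY := mul_nonneg hN hY
  generalize Z ^ 2 * F = Y at *
  generalize τ * sEnergy A ρ κ v p l τ = y0 at *
  generalize τ₁ * (ρ * v ^ 2) = y1 at *
  generalize τ * (ρ * (v * w)) = y2 at *
  generalize l₁ * (κ * v * p) = y3 at *
  generalize l * (κ * w * p) = y4 at *
  generalize l * (κ * v * b) = y5 at *
  generalize A * (p * b) = y6 at *
  rw [abs_le] at a0 a1 a2 a3 a4 a5 a6 ⊢
  constructor
  · linarith [a0.1, a1.2, a2.2, a3.2, a4.2, a5.2, a6.2]
  · linarith [a0.2, a1.1, a2.1, a3.1, a4.1, a5.1, a6.1]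

/-- Bounds on the coefficients depending on time. -/
theorem exists_coeff_bound {T s d N : ℝ} (hT : 0 < T) (hs : 0 < s) (hN : 0 ≤ N) :
    ∃ Q > 0, ∀ t ∈ Ioo 0 T, ∀ z, |z| ≤ N →
      1 ≤ Q * (1 + Theta T t ^ 2) ∧ |s * Theta T t * d| ≤ Q * (1 + Theta T t ^ 2) ∧
      |s * ThetaD T t * d| ≤ Q * (1 + Theta T t ^ 2) ∧
      |s * ThetaD T t * z| ≤ Q * (1 + Theta T t ^ 2) ∧
      |s * ThetaDD T t * z| ≤ Q * (1 + Theta T t ^ 2) := by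
  refine ⟨1 + s * (1 + 4 * T ^ 7 + 28 * T ^ 6) * (|d| + N), by positivity, fun t ht z hz => ?_⟩
  have hΘ := Theta_pos ht
  have h1 := abs_ThetaD_le ht
  have h2 := abs_ThetaDD_le ht
  have key : ∀ x y : ℝ, |x| ≤ (1 + 4 * T ^ 7 + 28 * T ^ 6) * (1 + Theta T t ^ 2) →
      |y| ≤ |d| + N → |s * x * y| ≤
        (1 + s * (1 + 4 * T ^ 7 + 28 * T ^ 6) * (|d| + N)) * (1 + Theta T t ^ 2) := by
    intro x y hx hy
    rw [abs_mul, abs_mul, abs_of_pos hs]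
    calc s * |x| * |y| ≤ s * ((1 + 4 * T ^ 7 + 28 * T ^ 6) * (1 + Theta T t ^ 2)) * (|d| + N) := by
          gcongr
      _ = (s * (1 + 4 * T ^ 7 + 28 * T ^ 6) * (|d| + N)) * (1 + Theta T t ^ 2) := by ring
      _ ≤ _ := by gcongr; linarith
  have b0 : |Theta T t| ≤ (1 + 4 * T ^ 7 + 28 * T ^ 6) * (1 + Theta T t ^ 2) := by
    rw [abs_of_pos hΘ]
    calc Theta T t ≤ 1 * (1 + Theta T t ^ 2) := by nlinarith [sq_nonneg (Theta T t - 1)]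
      _ ≤ _ := by
        gcongr
        have : 0 ≤ 4 * T ^ 7 + 28 * T ^ 6 := by positivity
        linarith
  have b1 : |ThetaD T t| ≤ (1 + 4 * T ^ 7 + 28 * T ^ 6) * (1 + Theta T t ^ 2) := by
    refine h1.trans ?_
    gcongr
    · have : 0 ≤ 28 * T ^ 6 := by positivity
      linarith
    · linarith
  have b2 : |ThetaDD T t| ≤ (1 + 4 * T ^ 7 + 28 * T ^ 6) * (1 + Theta T t ^ 2) := by
    refine h2.trans ?_
    gcongr
    · have : 0 ≤ 4 * T ^ 7 := by positivity
      linarith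
    · linarith
  have hz' : |z| ≤ |d| + N := hz.trans (by linarith [abs_nonneg d])
  have hd' : |d| ≤ |d| + N := by linarith
  refine ⟨?_, key _ _ b0 hd', key _ _ b1 hd', key _ _ b1 hz', key _ _ b2 hz'⟩
  have : 0 ≤ s * (1 + 4 * T ^ 7 + 28 * T ^ 6) * (|d| + N) := by positivity
  nlinarith [sq_nonneg (Theta T t)]

/-- The weighted energy at a fixed point integrates to zero in time. -/
theorem integral_sEnergyD_eq_zero {T s d N δ A ρ κ z : ℝ} (hT : 0 < T) (hs : 0 < s) (hδ : 0 < δ)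
    (hA : 0 < A) (hρ : 0 < ρ) (hκ : κ ^ 2 / A ≤ N * ρ) (hN : 0 ≤ N) (hz : z ≤ -δ) (hzN : |z| ≤ N)
    {v w P p b : ℝ → ℝ} (hv : AbsolutelyContinuousOnInterval v 0 T)
    (hvd : ∀ᵐ t ∂volume.restrict (Ioo 0 T), HasDerivAt v (w t) t)
    (hP : AbsolutelyContinuousOnInterval P 0 T)
    (hPd : ∀ᵐ t ∂volume.restrict (Ioo 0 T), HasDerivAt P (b t) t)
    (hPp : ∀ᵐ t ∂volume.restrict (Ioo 0 T), P t = p t)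
    (hint : Integrable (fun t => Real.exp (2 * (s * Theta T t) * z) *
      sEnergyD A ρ κ (v t) (w t) (p t) (b t) (s * Theta T t * d) (s * ThetaD T t * d)
        (s * ThetaD T t * z) (s * ThetaDD T t * z)) (volume.restrict (Ioo 0 T))) :
    ∫ t, Real.exp (2 * (s * Theta T t) * z) *
      sEnergyD A ρ κ (v t) (w t) (p t) (b t) (s * Theta T t * d) (s * ThetaD T t * d)
        (s * ThetaD T t * z) (s * ThetaDD T t * z) ∂(volume.restrict (Ioo 0 T)) = 0 := by
  obtain ⟨K, hK, hKb⟩ := exists_weight_bound (T := T) hs hδ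
  obtain ⟨Q, hQ, hQb⟩ := exists_coeff_bound (d := d) hT hs hN
  obtain ⟨Cv, hCv⟩ := hv.exists_bound
  obtain ⟨CP, hCP⟩ := hP.exists_bound
  rw [uIcc_of_le hT.le] at hCv hCP
  set S : ℝ → ℝ := fun t => Real.exp (2 * (s * Theta T t) * z) *
      sEnergy A ρ κ (v t) (P t) (s * Theta T t * d) (s * ThetaD T t * z) with hS
  -- The exponential absorbs one power of `Θ` more than necessary. The factor `Θ⁻¹` left over makes
  -- the energy tend to zero at both ends.
  have hbound : ∀ t ∈ Ioo 0 T, |S t| ≤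
      (N + 2) * Q * (2 * K) * (ρ * Cv ^ 2 + A * CP ^ 2) * (Theta T t)⁻¹ := by
    intro t ht
    have hΘ := Theta_pos ht
    obtain ⟨q1, q2, q3, q4, q5⟩ := hQb t ht z hzN
    have e1 := abs_sEnergy_le (v := v t) (p := P t) hA hρ hκ hN q1 q2 q4
    have c1 : v t ^ 2 ≤ Cv ^ 2 := by
      rw [← sq_abs]; gcongr; exact hCv t (Ioo_subset_Icc_self ht)
    have c2 : P t ^ 2 ≤ CP ^ 2 := by
      rw [← sq_abs]; gcongr; exact hCP t (Ioo_subset_Icc_self ht)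
    have k1 := hKb t ht z hz 1 (by simp)
    have k3 := hKb t ht z hz 3 (by simp)
    rw [hS]
    simp only [abs_mul, abs_of_pos (Real.exp_pos _)]
    calc Real.exp (2 * (s * Theta T t) * z) *
          |sEnergy A ρ κ (v t) (P t) (s * Theta T t * d) (s * ThetaD T t * z)|
        ≤ Real.exp (2 * (s * Theta T t) * z) * ((N + 2) * (Q * (1 + Theta T t ^ 2)) *
          (ρ * Cv ^ 2 + A * CP ^ 2)) := by
          gcongr
          refine e1.trans ?_
          gcongr
      _ = (N + 2) * Q * (Real.exp (2 * (s * Theta T t) * z) * Theta T t ^ 1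
          + Real.exp (2 * (s * Theta T t) * z) * Theta T t ^ 3) *
          (ρ * Cv ^ 2 + A * CP ^ 2) * (Theta T t)⁻¹ := by field_simp
      _ ≤ (N + 2) * Q * (2 * K) * (ρ * Cv ^ 2 + A * CP ^ 2) * (Theta T t)⁻¹ := by
          gcongr
          linarith
  have hlim0 : ∀ l : Filter ℝ, Tendsto (Theta T) l atTop → (∀ᶠ t in l, t ∈ Ioo 0 T) →
      Tendsto S l (𝓝 0) := by
    intro l hl hmem
    have h1 := (tendsto_inv_atTop_zero.comp hl).const_mul
      ((N + 2) * Q * (2 * K) * (ρ * Cv ^ 2 + A * CP ^ 2))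
    rw [mul_zero] at h1
    refine squeeze_zero_norm' ?_ h1
    filter_upwards [hmem] with t ht using hbound t ht
  have hderiv : ∀ᵐ t ∂volume.restrict (Ioo 0 T), HasDerivAt S
      (Real.exp (2 * (s * Theta T t) * z) *
      sEnergyD A ρ κ (v t) (w t) (p t) (b t) (s * Theta T t * d) (s * ThetaD T t * d)
        (s * ThetaD T t * z) (s * ThetaDD T t * z)) t := by
    filter_upwards [hvd, hPd, hPp, ae_restrict_mem measurableSet_Ioo] with t h1 h2 h3 ht
    have d1 := hasDerivAt_Theta ht
    have d2 := hasDerivAt_ThetaD ht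
    have dE := (((d1.const_mul s).const_mul 2).mul_const z).exp
    have dl := (d1.const_mul s).mul_const d
    have dτ := (d2.const_mul s).mul_const z
    have t1 := ((dτ.const_mul (-(1 / 2) * ρ)).mul (h1.fun_pow 2))
    have t2 := (((dl.mul_const κ).mul h1).mul h2)
    have t3 := (h2.fun_pow 2).const_mul (1 / 2 * A)
    have := dE.mul ((t1.sub t2).sub t3)
    refine (this.congr_of_eventuallyEq (Eventually.of_forall fun t => ?_)).congr_deriv ?_
    · simp only [hS, sEnergy, Pi.mul_apply, Pi.sub_apply]
    · rw [← h3]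
      simp only [sEnergyD, sEnergy, Pi.mul_apply, Pi.sub_apply]
      ring
  refine integral_eq_zero_of_tendsto hT (S := S) (fun t₁ h₁ t₂ h₂ h₁₂ => ?_) hderiv hint
    (hlim0 _ (tendsto_Theta_zero hT) (Ioo_mem_nhdsGT hT))
    (hlim0 _ (tendsto_Theta_T hT) (Ioo_mem_nhdsLT hT))
  have hsub : uIcc t₁ t₂ ⊆ Ioo 0 T := by
    rw [uIcc_of_le h₁₂]; exact Icc_subset_Ioo h₁.1 h₂.2
  have hsub' : uIcc t₁ t₂ ⊆ uIcc 0 T := by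
    rw [uIcc_of_le hT.le]; exact hsub.trans Ioo_subset_Icc_self
  have a1 := ((contDiffOn_Theta T).mono hsub).absolutelyContinuousOnInterval
  have a2 := ((contDiffOn_ThetaD T).mono hsub).absolutelyContinuousOnInterval
  have av := hv.mono hsub'
  have aP := hP.mono hsub'
  have aE := (a1.const_mul (2 * s * z)).comp_contDiff Real.contDiff_exp
  have t1 := (a2.const_mul (-(1 / 2) * ρ * s * z)).fun_mul (av.fun_mul av)
  have t2 := (a1.const_mul (s * d * κ)).fun_mul (av.fun_mul aP)
  have t3 := (aP.fun_mul aP).const_mul (1 / 2 * A)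
  refine (aE.fun_mul ((t1.fun_sub t2).fun_sub t3)).congr fun t _ => ?_
  simp only [hS, sEnergy]
  congr 1
  · ring_nf
  · ring

/-! ### The Carleman inequality in the unified setting -/

theorem muQ_eq_prod (T : ℝ) : muQ T = (volume.restrict (Ioo 0 T)).prod muI := by
  unfold muQ muI cyl
  rw [Measure.prod_restrict, ← Measure.volume_eq_prod]

theorem ae_muQ_snd (T : ℝ) {P : ℝ → Prop} (h : ∀ᵐ x ∂muI, P x) : ∀ᵐ q ∂muQ T, P q.2 := by
  rw [muQ_eq_prod]
  exact Measure.quasiMeasurePreserving_snd.ae h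

theorem ae_muQ_fst (T : ℝ) {P : ℝ → Prop} (h : ∀ᵐ t ∂volume.restrict (Ioo 0 T), P t) :
    ∀ᵐ q ∂muQ T, P q.1 := by
  rw [muQ_eq_prod]
  exact Measure.quasiMeasurePreserving_fst.ae h

theorem ae_muQ_mem (T x₀ : ℝ) :
    ∀ᵐ q ∂muQ T, q.1 ∈ Ioo 0 T ∧ q.2 ∈ Icc (0 : ℝ) 1 ∧ q.2 ≠ x₀ := by
  filter_upwards [ae_muQ_fst T (ae_restrict_mem measurableSet_Ioo), ae_muQ_snd T (ae_Icc_ne x₀)]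
    with q h1 h2 using ⟨h1, h2⟩

theorem ae_ae_of_ae_muQ {T : ℝ} {P : ℝ × ℝ → Prop} (h : ∀ᵐ q ∂muQ T, P q) :
    ∀ᵐ t ∂volume.restrict (Ioo 0 T), ∀ᵐ x ∂muI, P (t, x) := by
  rw [muQ_eq_prod] at h
  exact Measure.ae_ae_of_ae_prod h

theorem ae_ae_of_ae_muQ' {T : ℝ} {P : ℝ × ℝ → Prop} (h : ∀ᵐ q ∂muQ T, P q) :
    ∀ᵐ x ∂muI, ∀ᵐ t ∂volume.restrict (Ioo 0 T), P (t, x) := by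
  rw [muQ_eq_prod] at h
  have h2 : ∀ᵐ z ∂(muI.prod (volume.restrict (Ioo 0 T))), P z.swap := by
    rw [← Measure.prod_swap] at h
    exact ae_of_ae_map measurable_swap.aemeasurable h
  exact Measure.ae_ae_of_ae_prod h2

theorem aemeasurable_snd_muQ (T : ℝ) {f : ℝ → ℝ} (hf : AEMeasurable f muI) :
    AEMeasurable (fun q : ℝ × ℝ => f q.2) (muQ T) := by
  rw [muQ_eq_prod]
  exact hf.comp_snd

/-- A solution of the unified equation: `w = v_t`, `p = v_x`, `b = v_{tx}`, `G = A v_x` and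
`r = (A v_x)_x`. -/
structure WeightedSolution (T x₀ : ℝ) (A ρ M k : ℝ → ℝ) (v w p b G r : ℝ → ℝ → ℝ) : Prop where
  slice : ∀ᵐ t ∂(volume.restrict (Ioo 0 T)),
    SliceRegular x₀ A ρ M k (v t) (w t) (p t) (b t) (G t) (r t)
  memLp_v : MemLp (fun q : ℝ × ℝ => √(ρ q.2) * v q.1 q.2) 2 (muQ T)
  memLp_w : MemLp (fun q : ℝ × ℝ => √(ρ q.2) * w q.1 q.2) 2 (muQ T)
  memLp_p : MemLp (fun q : ℝ × ℝ => √(A q.2) * p q.1 q.2) 2 (muQ T)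
  memLp_b : MemLp (fun q : ℝ × ℝ => √(A q.2) * b q.1 q.2) 2 (muQ T)
  memLp_r : MemLp (fun q : ℝ × ℝ => r q.1 q.2 / √(ρ q.2)) 2 (muQ T)
  time : ∀ᵐ x ∂muI, AbsolutelyContinuousOnInterval (fun t => v t x) 0 T ∧
    (∀ᵐ t ∂volume.restrict (Ioo 0 T), HasDerivAt (fun t => v t x) (w t x) t) ∧
    ∃ P : ℝ → ℝ, AbsolutelyContinuousOnInterval P 0 T ∧
      (∀ᵐ t ∂volume.restrict (Ioo 0 T), HasDerivAt P (b t x) t) ∧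
      ∀ᵐ t ∂volume.restrict (Ioo 0 T), P t = p t x
  aemeasurable_zero : AEMeasurable (fun t => G t 0) (volume.restrict (Ioo 0 T))
  aemeasurable_one : AEMeasurable (fun t => G t 1) (volume.restrict (Ioo 0 T))

/-- The principal terms of the Carleman inequality, after conjugation with the weight. -/
def mainTerm (T s d : ℝ) (A κ ψ : ℝ → ℝ) (v p : ℝ → ℝ → ℝ) (q : ℝ × ℝ) : ℝ :=
  Real.exp (2 * (s * Theta T q.1) * ψ q.2) *
    (s * Theta T q.1 * d * A q.2 *
        (p q.1 q.2 + s * Theta T q.1 * d * (κ q.2 / A q.2) * v q.1 q.2) ^ 2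
      + (s * Theta T q.1 * d) ^ 3 * (κ q.2 ^ 2 / A q.2) * v q.1 q.2 ^ 2)

/-- The lower order term controlled by coercivity. -/
def lowerTerm (T s d : ℝ) (ρ ψ : ℝ → ℝ) (v : ℝ → ℝ → ℝ) (q : ℝ × ℝ) : ℝ :=
  Real.exp (2 * (s * Theta T q.1) * ψ q.2) *
    ((s * Theta T q.1 * d) ^ 2 * ρ q.2 * v q.1 q.2 ^ 2)

/-- The weighted time derivative of the energy. -/
def energyTerm (T s d : ℝ) (A ρ κ ψ : ℝ → ℝ) (v w p b : ℝ → ℝ → ℝ) (q : ℝ × ℝ) : ℝ :=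
  Real.exp (2 * (s * Theta T q.1) * ψ q.2) *
    sEnergyD (A q.2) (ρ q.2) (κ q.2) (v q.1 q.2) (w q.1 q.2) (p q.1 q.2) (b q.1 q.2)
      (s * Theta T q.1 * d) (s * ThetaD T q.1 * d) (s * ThetaD T q.1 * ψ q.2)
      (s * ThetaDD T q.1 * ψ q.2)

/-- The terms on the left of the Carleman inequality. -/
def leftTerm (T s d : ℝ) (A κ ψ : ℝ → ℝ) (v p : ℝ → ℝ → ℝ) (q : ℝ × ℝ) : ℝ :=
  Real.exp (2 * (s * Theta T q.1) * ψ q.2) *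
    (s * Theta T q.1 * d * A q.2 * p q.1 q.2 ^ 2
      + (s * Theta T q.1 * d) ^ 3 * (κ q.2 ^ 2 / A q.2) * v q.1 q.2 ^ 2)

/-- The source term of the Carleman inequality. -/
def sourceTerm (T s : ℝ) (ρ ψ : ℝ → ℝ) (h : ℝ → ℝ → ℝ) (q : ℝ × ℝ) : ℝ :=
  Real.exp (2 * (s * Theta T q.1) * ψ q.2) * (ρ q.2 * h q.1 q.2 ^ 2)

/-- The boundary term of the Carleman inequality. -/
def boundaryTerm (T s d : ℝ) (γ ψ : ℝ → ℝ) (G : ℝ → ℝ → ℝ) (t : ℝ) : ℝ :=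
  s * Theta T t * d * (γ 1 * G t 1 ^ 2 * Real.exp (2 * (s * Theta T t) * ψ 1)
    - γ 0 * G t 0 ^ 2 * Real.exp (2 * (s * Theta T t) * ψ 0))

/-- The energy density. -/
def energyDensity (A ρ : ℝ → ℝ) (v w p b : ℝ → ℝ → ℝ) (q : ℝ × ℝ) : ℝ :=
  ρ q.2 * v q.1 q.2 ^ 2 + ρ q.2 * w q.1 q.2 ^ 2 + A q.2 * p q.1 q.2 ^ 2 + A q.2 * b q.1 q.2 ^ 2

/-- Dividing by the positive square root recovers measurability of `g` from its weighted square
integrability. -/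
theorem aemeasurable_of_sqrt_mul {α : Type*} [MeasurableSpace α] {μ : Measure α} {f g : α → ℝ}
    (hf : AEMeasurable f μ) (hpos : ∀ᵐ q ∂μ, 0 < f q)
    (hfg : AEMeasurable (fun q => √(f q) * g q) μ) : AEMeasurable g μ := by
  refine (hfg.div hf.sqrt).congr ?_
  filter_upwards [hpos] with q hq
  have := Real.sqrt_pos.2 hq
  simp only [Pi.div_apply]
  field_simp

theorem aemeasurable_of_div_sqrt {α : Type*} [MeasurableSpace α] {μ : Measure α} {f g : α → ℝ}
    (hf : AEMeasurable f μ) (hpos : ∀ᵐ q ∂μ, 0 < f q)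
    (hfg : AEMeasurable (fun q => g q / √(f q)) μ) : AEMeasurable g μ := by
  refine (hfg.mul hf.sqrt).congr ?_
  filter_upwards [hpos] with q hq
  have := Real.sqrt_pos.2 hq
  simp only [Pi.mul_apply]
  field_simp

theorem integrable_mul_sq_of_memLp {α : Type*} [MeasurableSpace α] {μ : Measure α} {f g : α → ℝ}
    (hpos : ∀ᵐ q ∂μ, 0 < f q) (hfg : MemLp (fun q => √(f q) * g q) 2 μ) :
    Integrable (fun q => f q * g q ^ 2) μ := by
  refine hfg.integrable_sq.congr ?_
  filter_upwards [hpos] with q hq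
  rw [mul_pow, Real.sq_sqrt hq.le]

section Measurability

variable {α : Type*} [MeasurableSpace α] {μ : Measure α} {A ρ κ v w p b l l₁ τ τ₁ : α → ℝ}

theorem aemeasurable_sEnergyD (hA : AEMeasurable A μ) (hρ : AEMeasurable ρ μ)
    (hκ : AEMeasurable κ μ) (hv : AEMeasurable v μ) (hw : AEMeasurable w μ)
    (hp : AEMeasurable p μ) (hb : AEMeasurable b μ) (hl : AEMeasurable l μ)
    (hl₁ : AEMeasurable l₁ μ) (hτ : AEMeasurable τ μ) (hτ₁ : AEMeasurable τ₁ μ) :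
    AEMeasurable (fun q => sEnergyD (A q) (ρ q) (κ q) (v q) (w q) (p q) (b q) (l q) (l₁ q) (τ q)
      (τ₁ q)) μ := by
  unfold sEnergyD sEnergy
  fun_prop

theorem aemeasurable_quadratic (hA : AEMeasurable A μ) (hκ : AEMeasurable κ μ)
    (hv : AEMeasurable v μ) (hp : AEMeasurable p μ) (hl : AEMeasurable l μ) :
    AEMeasurable (fun q => l q * A q * p q ^ 2 + l q ^ 3 * (κ q ^ 2 / A q) * v q ^ 2) μ := by
  fun_prop

theorem aemeasurable_quadratic_conj (hA : AEMeasurable A μ) (hκ : AEMeasurable κ μ)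
    (hv : AEMeasurable v μ) (hp : AEMeasurable p μ) (hl : AEMeasurable l μ) :
    AEMeasurable (fun q => l q * A q * (p q + l q * (κ q / A q) * v q) ^ 2
      + l q ^ 3 * (κ q ^ 2 / A q) * v q ^ 2) μ := by
  fun_prop

end Measurability

/-! ### Integrability over the cylinder and integration of the slice inequalities. -/

section Solution

variable {T x₀ d δ N : ℝ} {n : ℕ} {A ρ κ γ M M' D ψ k k' : ℝ → ℝ} {v w p b G r : ℝ → ℝ → ℝ}

namespace CarlemanWeights

variable (H : CarlemanWeights x₀ d δ N n A ρ κ γ M M' D ψ k k')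
include H

theorem aemeasurable_exp (T s : ℝ) :
    AEMeasurable (fun q : ℝ × ℝ => Real.exp (2 * (s * Theta T q.1) * ψ q.2)) (muQ T) := by
  have h8 := aemeasurable_snd_muQ T H.ψ_ac.ac.aemeasurable
  have m1 : AEMeasurable (fun q : ℝ × ℝ => Theta T q.1) (muQ T) :=
    ((measurable_Theta T).comp measurable_fst).aemeasurable
  exact Real.measurable_exp.comp_aemeasurable ((m1.const_mul s).const_mul 2 |>.mul h8)

theorem ae_A_pos (T : ℝ) : ∀ᵐ q ∂muQ T, 0 < A q.2 := by
  filter_upwards [ae_muQ_mem T x₀] with q hq using H.A_pos _ hq.2.1 hq.2.2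

theorem ae_ρ_pos (T : ℝ) : ∀ᵐ q ∂muQ T, 0 < ρ q.2 := by
  filter_upwards [ae_muQ_mem T x₀] with q hq using H.ρ_pos _ hq.2.1 hq.2.2

/-- With `W = l (κ/A) v`, one has `l A W² = l³ (κ²/A) v²`. So replacing `p` by `p + W` in the
gradient term changes it by a multiple of the zero order term already present. -/
theorem mainTerm_le_leftTerm {s : ℝ} (hs : 0 < s) {q : ℝ × ℝ} (ht : q.1 ∈ Ioo 0 T)
    (hx : q.2 ∈ Icc (0 : ℝ) 1) (hne : q.2 ≠ x₀) :
    mainTerm T s d A κ ψ v p q ≤ 3 * leftTerm T s d A κ ψ v p q ∧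
      leftTerm T s d A κ ψ v p q ≤ 3 * mainTerm T s d A κ ψ v p q ∧
      0 ≤ mainTerm T s d A κ ψ v p q := by
  have hΘ := Theta_pos ht
  have hA := H.A_pos _ hx hne
  have hd := H.d_pos
  have hl : 0 < s * Theta T q.1 * d := by positivity
  unfold mainTerm leftTerm
  have hE := Real.exp_pos (2 * (s * Theta T q.1) * ψ q.2)
  generalize Real.exp (2 * (s * Theta T q.1) * ψ q.2) = E at *
  generalize s * Theta T q.1 * d = l at *
  generalize v q.1 q.2 = V
  generalize p q.1 q.2 = P
  generalize κ q.2 = c at *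
  generalize A q.2 = a at *
  have e1 : (c / a) ^ 2 * a = c ^ 2 / a := by field_simp
  have e2 : l * a * (l * (c / a) * V) ^ 2 = l ^ 3 * (c ^ 2 / a) * V ^ 2 := by rw [← e1]; ring
  have e3 : 0 ≤ l ^ 3 * (c ^ 2 / a) * V ^ 2 := by positivity
  generalize l ^ 3 * (c ^ 2 / a) * V ^ 2 = Z at *
  generalize l * (c / a) * V = W at *
  have hla : 0 < l * a := by positivity
  generalize l * a = m at *
  refine ⟨?_, ?_, ?_⟩
  · rw [mul_left_comm 3 E]
    gcongr
    nlinarith [mul_nonneg hla.le (sq_nonneg (P - W)), mul_nonneg hla.le (sq_nonneg P)]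
  · rw [mul_left_comm 3 E]
    gcongr
    nlinarith [mul_nonneg hla.le (sq_nonneg (P + 2 * W)), mul_nonneg hla.le (sq_nonneg (P + W))]
  · positivity

variable (hV : WeightedSolution T x₀ A ρ M k v w p b G r)
include hV

theorem aemeasurable_v : AEMeasurable (fun q : ℝ × ℝ => v q.1 q.2) (muQ T) :=
  aemeasurable_of_sqrt_mul (aemeasurable_snd_muQ T H.aemeasurable_ρ) (H.ae_ρ_pos T)
    hV.memLp_v.aestronglyMeasurable.aemeasurable

theorem aemeasurable_w : AEMeasurable (fun q : ℝ × ℝ => w q.1 q.2) (muQ T) :=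
  aemeasurable_of_sqrt_mul (aemeasurable_snd_muQ T H.aemeasurable_ρ) (H.ae_ρ_pos T)
    hV.memLp_w.aestronglyMeasurable.aemeasurable

theorem aemeasurable_p : AEMeasurable (fun q : ℝ × ℝ => p q.1 q.2) (muQ T) :=
  aemeasurable_of_sqrt_mul (aemeasurable_snd_muQ T H.aemeasurable_A) (H.ae_A_pos T)
    hV.memLp_p.aestronglyMeasurable.aemeasurable

theorem aemeasurable_b : AEMeasurable (fun q : ℝ × ℝ => b q.1 q.2) (muQ T) :=
  aemeasurable_of_sqrt_mul (aemeasurable_snd_muQ T H.aemeasurable_A) (H.ae_A_pos T)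
    hV.memLp_b.aestronglyMeasurable.aemeasurable

theorem integrable_energyDensity : Integrable (energyDensity A ρ v w p b) (muQ T) :=
  (((integrable_mul_sq_of_memLp (H.ae_ρ_pos T) hV.memLp_v).add
    (integrable_mul_sq_of_memLp (H.ae_ρ_pos T) hV.memLp_w)).add
    (integrable_mul_sq_of_memLp (H.ae_A_pos T) hV.memLp_p)).add
    (integrable_mul_sq_of_memLp (H.ae_A_pos T) hV.memLp_b)

theorem integrable_of_le_energy {f : ℝ × ℝ → ℝ} {K : ℝ} (hf : AEMeasurable f (muQ T))
    (hle : ∀ q : ℝ × ℝ, q.1 ∈ Ioo 0 T → q.2 ∈ Icc (0 : ℝ) 1 → q.2 ≠ x₀ →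
      |f q| ≤ K * energyDensity A ρ v w p b q) : Integrable f (muQ T) := by
  refine ((H.integrable_energyDensity hV).const_mul K).mono' hf.aestronglyMeasurable ?_
  filter_upwards [ae_muQ_mem T x₀] with q hq using hle q hq.1 hq.2.1 hq.2.2

theorem integrable_energyTerm (hT : 0 < T) {s : ℝ} (hs : 0 < s) :
    Integrable (energyTerm T s d A ρ κ ψ v w p b) (muQ T) := by
  obtain ⟨K, hK, hKb⟩ := exists_weight_bound (T := T) hs H.δ_pos
  obtain ⟨Q, hQ, hQb⟩ := exists_coeff_bound (d := d) hT hs H.N_nonneg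
  -- The factor `4` comes from `(1 + Θ²)² = 1 + 2 Θ² + Θ⁴`, each power being bounded by `K` after
  -- multiplication by the exponential.
  refine H.integrable_of_le_energy hV (K := 6 * (N + 2) * Q ^ 2 * (4 * K)) ?_ ?_
  · have h1 := H.aemeasurable_v hV
    have h2 := H.aemeasurable_w hV
    have h3 := H.aemeasurable_p hV
    have h4 := H.aemeasurable_b hV
    have h5 := aemeasurable_snd_muQ T H.aemeasurable_A
    have h6 := aemeasurable_snd_muQ T H.aemeasurable_ρ
    have h7 := aemeasurable_snd_muQ T H.κ_ac.ac.aemeasurable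
    have h8 := aemeasurable_snd_muQ T H.ψ_ac.ac.aemeasurable
    have m1 : AEMeasurable (fun q : ℝ × ℝ => Theta T q.1) (muQ T) :=
      ((measurable_Theta T).comp measurable_fst).aemeasurable
    have m2 : AEMeasurable (fun q : ℝ × ℝ => ThetaD T q.1) (muQ T) :=
      ((measurable_ThetaD T).comp measurable_fst).aemeasurable
    have m3 : AEMeasurable (fun q : ℝ × ℝ => ThetaDD T q.1) (muQ T) :=
      ((measurable_ThetaDD T).comp measurable_fst).aemeasurable
    exact (H.aemeasurable_exp T s).mul (aemeasurable_sEnergyD h5 h6 h7 h1 h2 h3 h4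
      ((m1.const_mul s).mul_const d) ((m2.const_mul s).mul_const d) ((m2.const_mul s).mul h8)
      ((m3.const_mul s).mul h8))
  · intro q ht hx hne
    obtain ⟨q1, q2, q3, q4, q5⟩ := hQb q.1 ht (ψ q.2) (H.abs_ψ_le hx)
    have hΘ := Theta_pos ht
    have e1 := abs_sEnergyD_le (v := v q.1 q.2) (w := w q.1 q.2) (p := p q.1 q.2) (b := b q.1 q.2)
      (H.A_pos _ hx hne) (H.ρ_pos _ hx hne) (H.κ_sq_div_le hx hne) H.N_nonneg q1 q2 q3 q4 q5
    have hA := H.A_pos _ hx hne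
    have hρ := H.ρ_pos _ hx hne
    have hN := H.N_nonneg
    have hF : 0 ≤ energyDensity A ρ v w p b q := by unfold energyDensity; positivity
    have k0 := hKb q.1 ht _ (H.ψ_le _ hx) 0 (by simp)
    have k2 := hKb q.1 ht _ (H.ψ_le _ hx) 2 (by simp)
    have k4 := hKb q.1 ht _ (H.ψ_le _ hx) 4 (by simp)
    unfold energyTerm
    rw [abs_mul, abs_of_pos (Real.exp_pos _)]
    calc _ ≤ Real.exp (2 * (s * Theta T q.1) * ψ q.2) * (6 * (N + 2) *
          (Q * (1 + Theta T q.1 ^ 2)) ^ 2 * energyDensity A ρ v w p b q) := by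
          gcongr
          exact e1
      _ = 6 * (N + 2) * Q ^ 2 * (Real.exp (2 * (s * Theta T q.1) * ψ q.2) * Theta T q.1 ^ 0
          + 2 * (Real.exp (2 * (s * Theta T q.1) * ψ q.2) * Theta T q.1 ^ 2)
          + Real.exp (2 * (s * Theta T q.1) * ψ q.2) * Theta T q.1 ^ 4)
          * energyDensity A ρ v w p b q := by ring
      _ ≤ _ := by
          gcongr
          linarith

theorem integrable_leftTerm {s : ℝ} (hs : 0 < s) :
    Integrable (leftTerm T s d A κ ψ v p) (muQ T) := by
  obtain ⟨K, hK, hKb⟩ := exists_weight_bound (T := T) hs H.δ_pos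
  refine H.integrable_of_le_energy hV (K := s * d * K + (s * d) ^ 3 * K * N) ?_ ?_
  · have h1 := H.aemeasurable_v hV
    have h3 := H.aemeasurable_p hV
    have h5 := aemeasurable_snd_muQ T H.aemeasurable_A
    have h7 := aemeasurable_snd_muQ T H.κ_ac.ac.aemeasurable
    have h8 := aemeasurable_snd_muQ T H.ψ_ac.ac.aemeasurable
    have m1 : AEMeasurable (fun q : ℝ × ℝ => Theta T q.1) (muQ T) :=
      ((measurable_Theta T).comp measurable_fst).aemeasurable
    exact (H.aemeasurable_exp T s).mul
      (aemeasurable_quadratic h5 h7 h1 h3 ((m1.const_mul s).mul_const d))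
  · intro q ht hx hne
    have hΘ := Theta_pos ht
    have hA := H.A_pos _ hx hne
    have hρ := H.ρ_pos _ hx hne
    have hN := H.N_nonneg
    have hd := H.d_pos
    have hκ := H.κ_sq_div_le hx hne
    have k1 := hKb q.1 ht _ (H.ψ_le _ hx) 1 (by simp)
    have k3 := hKb q.1 ht _ (H.ψ_le _ hx) 3 (by simp)
    unfold leftTerm energyDensity
    rw [abs_of_nonneg (by positivity)]
    calc _ = s * d * (Real.exp (2 * (s * Theta T q.1) * ψ q.2) * Theta T q.1 ^ 1) *
          (A q.2 * p q.1 q.2 ^ 2) + (s * d) ^ 3 *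
          (Real.exp (2 * (s * Theta T q.1) * ψ q.2) * Theta T q.1 ^ 3) *
          (κ q.2 ^ 2 / A q.2 * v q.1 q.2 ^ 2) := by ring
      _ ≤ s * d * K * (A q.2 * p q.1 q.2 ^ 2) + (s * d) ^ 3 * K *
          (N * ρ q.2 * v q.1 q.2 ^ 2) := by gcongr
      _ ≤ _ := by
          have e1 : 0 ≤ ρ q.2 * v q.1 q.2 ^ 2 := by positivity
          have e2 : 0 ≤ ρ q.2 * w q.1 q.2 ^ 2 := by positivity
          have e3 : 0 ≤ A q.2 * p q.1 q.2 ^ 2 := by positivity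
          have e4 : 0 ≤ A q.2 * b q.1 q.2 ^ 2 := by positivity
          have c1 : 0 ≤ s * d * K := by positivity
          have c2 : 0 ≤ (s * d) ^ 3 * K * N := by positivity
          rw [show (s * d) ^ 3 * K * (N * ρ q.2 * v q.1 q.2 ^ 2)
            = (s * d) ^ 3 * K * N * (ρ q.2 * v q.1 q.2 ^ 2) by ring]
          generalize ρ q.2 * v q.1 q.2 ^ 2 = x1 at *
          generalize ρ q.2 * w q.1 q.2 ^ 2 = x2 at *
          generalize A q.2 * p q.1 q.2 ^ 2 = x3 at *
          generalize A q.2 * b q.1 q.2 ^ 2 = x4 at *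
          generalize s * d * K = c at *
          generalize (s * d) ^ 3 * K * N = c' at *
          have f1 := mul_nonneg c1 e1
          have f2 := mul_nonneg c1 e2
          have f3 := mul_nonneg c1 e4
          have f4 := mul_nonneg c2 e2
          have f5 := mul_nonneg c2 e3
          have f6 := mul_nonneg c2 e4
          linarith only [f1, f2, f3, f4, f5, f6]


theorem integrable_mainTerm {s : ℝ} (hs : 0 < s) :
    Integrable (mainTerm T s d A κ ψ v p) (muQ T) := by
  refine ((H.integrable_leftTerm hV hs).const_mul 3).mono' ?_ ?_
  · have m1 : AEMeasurable (fun q : ℝ × ℝ => Theta T q.1) (muQ T) :=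
      ((measurable_Theta T).comp measurable_fst).aemeasurable
    exact ((H.aemeasurable_exp T s).mul (aemeasurable_quadratic_conj
      (aemeasurable_snd_muQ T H.aemeasurable_A) (aemeasurable_snd_muQ T H.κ_ac.ac.aemeasurable)
      (H.aemeasurable_v hV) (H.aemeasurable_p hV)
      ((m1.const_mul s).mul_const d))).aestronglyMeasurable
  · filter_upwards [ae_muQ_mem T x₀] with q hq
    have h1 := H.mainTerm_le_leftTerm (v := v) (p := p) hs hq.1 hq.2.1 hq.2.2
    rw [Real.norm_eq_abs, abs_of_nonneg h1.2.2]
    exact h1.1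

theorem integrable_lowerTerm {s : ℝ} (hs : 0 < s) :
    Integrable (lowerTerm T s d ρ ψ v) (muQ T) := by
  obtain ⟨K, hK, hKb⟩ := exists_weight_bound (T := T) hs H.δ_pos
  refine H.integrable_of_le_energy hV (K := (s * d) ^ 2 * K) ?_ ?_
  · have m1 : AEMeasurable (fun q : ℝ × ℝ => Theta T q.1) (muQ T) :=
      ((measurable_Theta T).comp measurable_fst).aemeasurable
    exact (H.aemeasurable_exp T s).mul ((((((m1.const_mul s).mul_const d).pow_const 2).mul
      (aemeasurable_snd_muQ T H.aemeasurable_ρ))).mul ((H.aemeasurable_v hV).pow_const 2))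
  · intro q ht hx hne
    have hΘ := Theta_pos ht
    have hA := H.A_pos _ hx hne
    have hρ := H.ρ_pos _ hx hne
    have hd := H.d_pos
    have k2 := hKb q.1 ht _ (H.ψ_le _ hx) 2 (by simp)
    unfold lowerTerm energyDensity
    rw [abs_of_nonneg (by positivity)]
    calc _ = (s * d) ^ 2 * (Real.exp (2 * (s * Theta T q.1) * ψ q.2) * Theta T q.1 ^ 2) *
          (ρ q.2 * v q.1 q.2 ^ 2) := by ring
      _ ≤ (s * d) ^ 2 * K * (ρ q.2 * v q.1 q.2 ^ 2) := by gcongr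
      _ ≤ _ := by
          gcongr
          have e2 : 0 ≤ ρ q.2 * w q.1 q.2 ^ 2 := by positivity
          have e3 : 0 ≤ A q.2 * p q.1 q.2 ^ 2 := by positivity
          have e4 : 0 ≤ A q.2 * b q.1 q.2 ^ 2 := by positivity
          linarith

/-- By the equation, `√ρ h` is the combination `√ρ w + r/√ρ - c √ρ v` of square integrable
functions, and the exponential is at most one. -/
theorem integrable_sourceTerm {s Cc : ℝ} (hs : 0 < s) {c h : ℝ → ℝ → ℝ}
    (hcm : AEMeasurable (fun q : ℝ × ℝ => c q.1 q.2) (muQ T))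
    (hc : ∀ᵐ q ∂muQ T, |c q.1 q.2| ≤ Cc)
    (heq : ∀ᵐ q ∂muQ T, w q.1 q.2 + r q.1 q.2 / ρ q.2 - c q.1 q.2 * v q.1 q.2 = h q.1 q.2) :
    Integrable (sourceTerm T s ρ ψ h) (muQ T) := by
  have h1 : MemLp (fun q : ℝ × ℝ => c q.1 q.2) ⊤ (muQ T) :=
    memLp_top_of_bound hcm.aestronglyMeasurable Cc (by simpa using hc)
  have h2 : MemLp (fun q : ℝ × ℝ => c q.1 q.2 * (√(ρ q.2) * v q.1 q.2)) 2 (muQ T) :=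
    hV.memLp_v.mul h1
  have h3 := ((hV.memLp_w.add hV.memLp_r).sub h2).integrable_sq
  refine h3.mono' ?_ ?_
  · have h4 : AEMeasurable (fun q : ℝ × ℝ => h q.1 q.2) (muQ T) := by
      have hr := aemeasurable_of_div_sqrt (aemeasurable_snd_muQ T H.aemeasurable_ρ)
        (H.ae_ρ_pos T) hV.memLp_r.aestronglyMeasurable.aemeasurable
      exact (((H.aemeasurable_w hV).add (hr.div (aemeasurable_snd_muQ T H.aemeasurable_ρ))).sub
        (hcm.mul (H.aemeasurable_v hV))).congr heq
    exact ((H.aemeasurable_exp T s).mul ((aemeasurable_snd_muQ T H.aemeasurable_ρ).mul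
      (h4.pow_const 2))).aestronglyMeasurable
  · filter_upwards [ae_muQ_mem T x₀, heq] with q hq he
    have hρ := H.ρ_pos _ hq.2.1 hq.2.2
    have hE : Real.exp (2 * (s * Theta T q.1) * ψ q.2) ≤ 1 := by
      rw [Real.exp_le_one_iff]
      have := H.ψ_le _ hq.2.1
      have hδ := H.δ_pos
      have hΘ := Theta_pos hq.1
      have : 0 ≤ 2 * (s * Theta T q.1) * (-ψ q.2) := mul_nonneg (by positivity) (by linarith)
      linarith
    unfold sourceTerm
    rw [Real.norm_eq_abs, abs_of_nonneg (by positivity), ← he]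
    have hsq : √(ρ q.2) ^ 2 = ρ q.2 := Real.sq_sqrt hρ.le
    have hsq0 := Real.sqrt_pos.2 hρ
    calc _ ≤ 1 * (ρ q.2 * (w q.1 q.2 + r q.1 q.2 / ρ q.2 - c q.1 q.2 * v q.1 q.2) ^ 2) := by
          gcongr
      _ = _ := by
          simp only [Pi.add_apply, Pi.sub_apply]
          rw [← hsq]
          simp only [Real.sqrt_sq hsq0.le]
          field_simp

/-- `slice_boundary` dominates the end point fluxes at each time by an integral over `(0,1)`, which
is integrable in time by Fubini; the exponential absorbs the factor `Θ`. -/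
theorem integrable_boundaryTerm {s : ℝ} (hs : 0 < s) (γ' : ℝ → ℝ) :
    Integrable (boundaryTerm T s d γ' ψ G) (volume.restrict (Ioo 0 T)) := by
  obtain ⟨K, hK, hKb⟩ := exists_weight_bound (T := T) hs H.δ_pos
  have hd := H.d_pos
  set f : ℝ × ℝ → ℝ := fun q => (2 * N + 1) * (A q.2 * p q.1 q.2 ^ 2) + r q.1 q.2 ^ 2 / ρ q.2
    with hf
  have hfi : Integrable f (muQ T) := by
    refine ((integrable_mul_sq_of_memLp (H.ae_A_pos T) hV.memLp_p).const_mul (2 * N + 1)).add ?_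
    refine hV.memLp_r.integrable_sq.congr ?_
    filter_upwards [H.ae_ρ_pos T] with q hq
    rw [div_pow, Real.sq_sqrt hq.le]
  rw [muQ_eq_prod] at hfi
  have h1 := hfi.integral_prod_left
  have h2 := hfi.prod_right_ae
  have hx0 := H.x₀_mem.1
  have hx1 := sub_pos.2 H.x₀_mem.2
  refine (h1.const_mul (s * d * K * (|γ' 1| / (1 - x₀) + |γ' 0| / x₀))).mono' ?_ ?_
  · have m1 : Measurable (fun t : ℝ => s * Theta T t) := (measurable_Theta T).const_mul s
    have mE : ∀ z : ℝ, AEMeasurable (fun t : ℝ => Real.exp (2 * (s * Theta T t) * z))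
        (volume.restrict (Ioo 0 T)) := fun z =>
      (Real.measurable_exp.comp ((m1.const_mul 2).mul_const z)).aemeasurable
    exact ((m1.mul_const d).aemeasurable.mul
      ((((hV.aemeasurable_one.pow_const 2).const_mul (γ' 1)).mul (mE (ψ 1))).sub
      (((hV.aemeasurable_zero.pow_const 2).const_mul (γ' 0)).mul (mE (ψ 0))))).aestronglyMeasurable
  · filter_upwards [h2, hV.slice, ae_restrict_mem measurableSet_Ioo] with t e1 e2 ht
    have e3 := H.slice_boundary e2 e1 (ae_of_all _ fun x => rfl)
    have hΘ := Theta_pos ht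
    have b1 : G t 1 ^ 2 ≤ (∫ x, f (t, x) ∂muI) / (1 - x₀) := by
      rw [le_div_iff₀ hx1]
      have : 0 ≤ x₀ * G t 0 ^ 2 := by positivity
      linarith
    have b0 : G t 0 ^ 2 ≤ (∫ x, f (t, x) ∂muI) / x₀ := by
      rw [le_div_iff₀ hx0]
      have : 0 ≤ (1 - x₀) * G t 1 ^ 2 := by positivity
      linarith
    have k1 := hKb t ht _ (H.ψ_le 1 (by simp)) 1 (by simp)
    have k0 := hKb t ht _ (H.ψ_le 0 (by simp)) 1 (by simp)
    unfold boundaryTerm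
    rw [Real.norm_eq_abs]
    have hsplit : s * Theta T t * d * (γ' 1 * G t 1 ^ 2 * Real.exp (2 * (s * Theta T t) * ψ 1)
        - γ' 0 * G t 0 ^ 2 * Real.exp (2 * (s * Theta T t) * ψ 0))
        = s * d * (Real.exp (2 * (s * Theta T t) * ψ 1) * Theta T t ^ 1) * (γ' 1 * G t 1 ^ 2)
        - s * d * (Real.exp (2 * (s * Theta T t) * ψ 0) * Theta T t ^ 1) * (γ' 0 * G t 0 ^ 2) := by
      ring
    rw [hsplit]
    have key : ∀ {E g X B : ℝ}, 0 ≤ E → E ≤ K → 0 ≤ X → X ≤ B →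
        |s * d * E * (g * X)| ≤ s * d * K * (|g| * B) := by
      intro E g X B hE hEK hX hXB
      rw [abs_mul, abs_mul g, abs_of_nonneg hX, abs_of_nonneg (by positivity)]
      gcongr
    calc _ ≤ s * d * K * (|γ' 1| * ((∫ x, f (t, x) ∂muI) / (1 - x₀)))
          + s * d * K * (|γ' 0| * ((∫ x, f (t, x) ∂muI) / x₀)) :=
          (abs_sub _ _).trans (add_le_add (key (by positivity) k1 (sq_nonneg _) b1)
            (key (by positivity) k0 (sq_nonneg _) b0))
      _ = _ := by ring

/-- Fubini with the time integral inside: for almost every `x` the inner integrand is the derivative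
of an energy vanishing at both ends. -/
theorem integral_energyTerm (hT : 0 < T) {s : ℝ} (hs : 0 < s) :
    ∫ q, energyTerm T s d A ρ κ ψ v w p b q ∂(muQ T) = 0 := by
  have hi := H.integrable_energyTerm hV hT hs
  rw [muQ_eq_prod] at hi ⊢
  rw [integral_prod_symm _ hi]
  refine integral_eq_zero_of_ae ?_
  filter_upwards [hV.time, hi.prod_left_ae, ae_Icc_ne x₀] with x h1 h2 hx
  obtain ⟨hv, hvd, P, hP, hPd, hPp⟩ := h1
  exact integral_sEnergyD_eq_zero hT hs H.δ_pos (H.A_pos _ hx.1 hx.2) (H.ρ_pos _ hx.1 hx.2)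
    (H.κ_sq_div_le hx.1 hx.2) H.N_nonneg (H.ψ_le _ hx.1) (H.abs_ψ_le hx.1) hv hvd hP hPd hPp h2

theorem integral_lowerTerm_le {s : ℝ} (hs : 0 < s) :
    ∫ q, lowerTerm T s d ρ ψ v q ∂(muQ T) ≤ N * ∫ q, mainTerm T s d A κ ψ v p q ∂(muQ T) := by
  have h1 := H.integrable_lowerTerm hV hs
  have h2 := H.integrable_mainTerm hV hs
  have h3 := (h2.const_mul N).sub h1
  rw [← integral_const_mul, ← sub_nonneg, ← integral_sub (h2.const_mul N) h1]
  have h4 : Integrable (fun q => N * mainTerm T s d A κ ψ v p q - lowerTerm T s d ρ ψ v q)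
    ((volume.restrict (Ioo 0 T)).prod muI) := by rw [← muQ_eq_prod]; exact h3
  rw [muQ_eq_prod, integral_prod _ h4]
  refine integral_nonneg_of_ae ?_
  filter_upwards [hV.slice, h4.prod_right_ae, ae_restrict_mem measurableSet_Ioo] with t e1 e2 ht
  have hΘ := Theta_pos ht
  refine H.slice_coercive (y := s * Theta T t) e1 (by positivity) e2 (ae_of_all _ fun x => ?_)
  unfold mainTerm lowerTerm
  ring

/-- The Carleman inequality for a fixed parameter. -/
theorem carleman_of_le (hT : 0 < T) {s Cc ε : ℝ} (hs : 0 < s) {c h : ℝ → ℝ → ℝ}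
    (hcm : AEMeasurable (fun q : ℝ × ℝ => c q.1 q.2) (muQ T))
    (hc : ∀ᵐ q ∂muQ T, |c q.1 q.2| ≤ Cc)
    (heq : ∀ᵐ q ∂muQ T, w q.1 q.2 + r q.1 q.2 / ρ q.2 - c q.1 q.2 * v q.1 q.2 = h q.1 q.2)
    (hε0 : 0 ≤ ε) (hεN : ε * N ≤ δ / 8)
    (hε : ∀ t ∈ Ioo 0 T, 1 / 2 * (|s * ThetaDD T t| * N) + N ^ 3 / (2 * δ) * (s * Theta T t * d)
      + Cc ^ 2 / 2 ≤ ε * (s * Theta T t * d) ^ 2)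
    (hσ : ∀ t ∈ Ioo 0 T, 2 * |s * ThetaD T t * d| ≤ δ / 4 * (s * Theta T t * d) ^ 2) :
    ∫ q, leftTerm T s d A κ ψ v p q ∂(muQ T) ≤ 24 / δ *
      ((∫ q, sourceTerm T s ρ ψ h q ∂(muQ T)) + ∫ t in Ioo 0 T, boundaryTerm T s d γ ψ G t) := by
  have i1 := H.integrable_mainTerm hV hs
  have i2 := H.integrable_lowerTerm hV hs
  have i3 := H.integrable_energyTerm hV hT hs
  have i4 := H.integrable_sourceTerm hV hs hcm hc heq
  have i5 := H.integrable_boundaryTerm hV hs γ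
  have i6 := H.integrable_leftTerm hV hs
  have hδ := H.δ_pos
  have j1 : Integrable (fun q => 1 / 2 * sourceTerm T s ρ ψ h q
      - energyTerm T s d A ρ κ ψ v w p b q) (muQ T) := (i4.const_mul (1 / 2)).sub i3
  have j2 : Integrable (fun q => 1 / 2 * sourceTerm T s ρ ψ h q
      - energyTerm T s d A ρ κ ψ v w p b q - δ / 4 * mainTerm T s d A κ ψ v p q) (muQ T) :=
    j1.sub (i1.const_mul (δ / 4))
  have hq : Integrable (fun q => 1 / 2 * sourceTerm T s ρ ψ h q
      - energyTerm T s d A ρ κ ψ v w p b q - δ / 4 * mainTerm T s d A κ ψ v p q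
      + ε * lowerTerm T s d ρ ψ v q) (muQ T) :=
    j2.add (i2.const_mul ε)
  have hqi : ∫ q, (1 / 2 * sourceTerm T s ρ ψ h q
      - energyTerm T s d A ρ κ ψ v w p b q - δ / 4 * mainTerm T s d A κ ψ v p q
      + ε * lowerTerm T s d ρ ψ v q) ∂(muQ T)
      = 1 / 2 * (∫ q, sourceTerm T s ρ ψ h q ∂(muQ T)) - 0
        - δ / 4 * (∫ q, mainTerm T s d A κ ψ v p q ∂(muQ T))
        + ε * ∫ q, lowerTerm T s d ρ ψ v q ∂(muQ T) := by
    rw [integral_add j2 (i2.const_mul ε), integral_sub j1 (i1.const_mul (δ / 4)),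
      integral_sub (i4.const_mul (1 / 2)) i3, integral_const_mul, integral_const_mul,
      integral_const_mul, H.integral_energyTerm hV hT hs]
  have hmain : -(∫ t in Ioo 0 T, boundaryTerm T s d γ ψ G t)
      ≤ ∫ q, (1 / 2 * sourceTerm T s ρ ψ h q
      - energyTerm T s d A ρ κ ψ v w p b q - δ / 4 * mainTerm T s d A κ ψ v p q
      + ε * lowerTerm T s d ρ ψ v q) ∂(muQ T) := by
    rw [muQ_eq_prod] at hq ⊢
    rw [integral_prod _ hq, ← integral_neg]
    refine integral_mono_ae i5.neg hq.integral_prod_left ?_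
    filter_upwards [hV.slice, hq.prod_right_ae, ae_restrict_mem measurableSet_Ioo,
      ae_ae_of_ae_muQ heq, ae_ae_of_ae_muQ hc] with t e1 e2 ht e3 e4
    have hΘ := Theta_pos ht
    refine H.slice_carleman (y := s * Theta T t) e1 (by positivity) e3 e4 (hε t ht) (hσ t ht) e2
      (ae_of_all _ fun x => ?_)
    unfold mainTerm lowerTerm energyTerm sourceTerm
    ring
  rw [hqi] at hmain
  have hlow := H.integral_lowerTerm_le hV hs
  have hleft : ∫ q, leftTerm T s d A κ ψ v p q ∂(muQ T)
      ≤ 3 * ∫ q, mainTerm T s d A κ ψ v p q ∂(muQ T) := by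
    rw [← integral_const_mul]
    refine integral_mono_ae i6 (i1.const_mul 3) ?_
    filter_upwards [ae_muQ_mem T x₀] with q hq
    exact (H.mainTerm_le_leftTerm (v := v) (p := p) hs hq.1 hq.2.1 hq.2.2).2.1
  have hm0 : 0 ≤ ∫ q, mainTerm T s d A κ ψ v p q ∂(muQ T) := by
    refine integral_nonneg_of_ae ?_
    filter_upwards [ae_muQ_mem T x₀] with q hq
    exact (H.mainTerm_le_leftTerm (v := v) (p := p) hs hq.1 hq.2.1 hq.2.2).2.2
  have hs0 : 0 ≤ ∫ q, sourceTerm T s ρ ψ h q ∂(muQ T) := by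
    refine integral_nonneg_of_ae ?_
    filter_upwards [H.ae_ρ_pos T] with q hq
    unfold sourceTerm
    simp only [Pi.zero_apply]
    positivity
  generalize ∫ q, mainTerm T s d A κ ψ v p q ∂(muQ T) = m at *
  generalize ∫ q, lowerTerm T s d ρ ψ v q ∂(muQ T) = l at *
  generalize ∫ q, leftTerm T s d A κ ψ v p q ∂(muQ T) = L at *
  generalize ∫ q, sourceTerm T s ρ ψ h q ∂(muQ T) = S at *
  generalize ∫ t in Ioo 0 T, boundaryTerm T s d γ ψ G t = B at *
  -- Half of the retained `δ/4` absorbs the lower order term. What remains is `(δ/8) m ≤ S/2 - 0 +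
  -- B`, and `L ≤ 3 m` together with `0 ≤ S` gives the constant `24/δ`.
  have f1 : ε * l ≤ δ / 8 * m := by
    calc ε * l ≤ ε * (N * m) := by gcongr
      _ = ε * N * m := by ring
      _ ≤ _ := by gcongr
  rw [div_mul_eq_mul_div, le_div_iff₀ hδ]
  have f2 : L * δ ≤ 3 * m * δ := by gcongr
  linarith

end CarlemanWeights

/-- The Carleman inequality in the unified setting. -/
theorem CarlemanWeights.carleman (H : CarlemanWeights x₀ d δ N n A ρ κ γ M M' D ψ k k')
    (hT : 0 < T) {c : ℝ → ℝ → ℝ} {Cc : ℝ}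
    (hcm : AEMeasurable (fun q : ℝ × ℝ => c q.1 q.2) (muQ T))
    (hc : ∀ᵐ q ∂muQ T, |c q.1 q.2| ≤ Cc) :
    ∃ C > 0, ∃ s₀ > 0, ∀ v w p b G r h : ℝ → ℝ → ℝ, WeightedSolution T x₀ A ρ M k v w p b G r →
      (∀ᵐ q ∂muQ T, w q.1 q.2 + r q.1 q.2 / ρ q.2 - c q.1 q.2 * v q.1 q.2 = h q.1 q.2) →
      ∀ s ≥ s₀, Integrable (leftTerm T s d A κ ψ v p) (muQ T) ∧
        Integrable (sourceTerm T s ρ ψ h) (muQ T) ∧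
        Integrable (boundaryTerm T s d γ ψ G) (volume.restrict (Ioo 0 T)) ∧
        ∫ q, leftTerm T s d A κ ψ v p q ∂(muQ T) ≤ C *
          ((∫ q, sourceTerm T s ρ ψ h q ∂(muQ T))
            + ∫ t in Ioo 0 T, boundaryTerm T s d γ ψ G t) := by
  have hδ := H.δ_pos
  have hd := H.d_pos
  have hN := H.N_nonneg
  set ε : ℝ := δ / (8 * (N + 1)) with hεd
  have hε : 0 < ε := by positivity
  have hεN : ε * N ≤ δ / 8 := by
    rw [hεd, div_mul_eq_mul_div, div_le_div_iff₀ (by positivity) (by norm_num)]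
    nlinarith
  -- `C₁` collects the coefficients of `s Θ²` in the lower order terms, after `Θ ≤ T⁸ Θ²`, `1 ≤ T¹⁶
  -- Θ²` and `1 ≤ s`.
  set C₁ : ℝ := 14 * T ^ 6 * N + N ^ 3 / (2 * δ) * d * T ^ 8 + Cc ^ 2 / 2 * T ^ 16 with hC₁
  have hC₁0 : 0 ≤ C₁ := by positivity
  -- The three summands of `s₀` ensure `1 ≤ s`, `C₁ ≤ s ε d²` (absorption into `ε l²`) and `32 T⁷ ≤
  -- s δ d` (absorption of `l₁`).
  refine ⟨24 / δ, by positivity, 1 + C₁ / (ε * d ^ 2) + 32 * T ^ 7 / (δ * d), by positivity,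
    fun v w p b G r h hV heq s hs => ?_⟩
  have e0 : 0 ≤ C₁ / (ε * d ^ 2) := by positivity
  have e0' : 0 ≤ 32 * T ^ 7 / (δ * d) := by positivity
  have hs1 : 1 ≤ s := by linarith
  have hs0 : 0 < s := by linarith
  have hsC : C₁ ≤ s * (ε * d ^ 2) := by
    rw [← div_le_iff₀ (by positivity)]; linarith
  have hsT : 32 * T ^ 7 ≤ s * (δ * d) := by
    rw [← div_le_iff₀ (by positivity)]; linarith
  refine ⟨H.integrable_leftTerm hV hs0, H.integrable_sourceTerm hV hs0 hcm hc heq,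
    H.integrable_boundaryTerm hV hs0 γ,
    H.carleman_of_le hV hT hs0 hcm hc heq hε.le hεN (fun t ht => ?_) fun t ht => ?_⟩
  · have hΘ := Theta_pos ht
    have h1 := abs_ThetaDD_le ht
    have h2 : 1 ≤ T ^ 8 * Theta T t := by
      have := Theta_ge ht
      rwa [div_le_iff₀' (by positivity)] at this
    have h3 : Theta T t ≤ T ^ 8 * Theta T t ^ 2 := by
      calc Theta T t = 1 * Theta T t := by ring
        _ ≤ T ^ 8 * Theta T t * Theta T t := by gcongr
        _ = _ := by ring
    have h4 : 1 ≤ T ^ 16 * Theta T t ^ 2 := by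
      calc (1 : ℝ) ≤ (T ^ 8 * Theta T t) ^ 2 := one_le_pow₀ h2
        _ = _ := by ring
    have g1 : 1 / 2 * (|s * ThetaDD T t| * N) ≤ s * (14 * T ^ 6 * N * Theta T t ^ 2) := by
      rw [abs_mul, abs_of_pos hs0]
      calc _ ≤ 1 / 2 * (s * (28 * T ^ 6 * Theta T t ^ 2) * N) := by gcongr
        _ = _ := by ring
    have g2 : N ^ 3 / (2 * δ) * (s * Theta T t * d)
        ≤ s * (N ^ 3 / (2 * δ) * d * T ^ 8 * Theta T t ^ 2) := by
      calc _ ≤ N ^ 3 / (2 * δ) * (s * (T ^ 8 * Theta T t ^ 2) * d) := by gcongr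
        _ = _ := by ring
    have g3 : Cc ^ 2 / 2 ≤ s * (Cc ^ 2 / 2 * T ^ 16 * Theta T t ^ 2) := by
      calc Cc ^ 2 / 2 = 1 * (Cc ^ 2 / 2 * 1) := by ring
        _ ≤ s * (Cc ^ 2 / 2 * (T ^ 16 * Theta T t ^ 2)) := by gcongr
        _ = _ := by ring
    calc _ ≤ s * C₁ * Theta T t ^ 2 := by rw [hC₁]; linarith
      _ ≤ s * (s * (ε * d ^ 2)) * Theta T t ^ 2 := by gcongr
      _ = _ := by ring
  · have hΘ := Theta_pos ht
    have h1 := abs_ThetaD_le ht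
    rw [abs_mul, abs_mul, abs_of_pos hs0, abs_of_pos hd]
    calc 2 * (s * |ThetaD T t| * d) ≤ 2 * (s * (4 * T ^ 7 * Theta T t ^ 2) * d) := by gcongr
      _ = (32 * T ^ 7) * (s * d * Theta T t ^ 2 / 4) := by ring
      _ ≤ (s * (δ * d)) * (s * d * Theta T t ^ 2 / 4) := by gcongr
      _ = _ := by ring

end Solution

/-! ### Exchange of time and space derivatives -/

theorem muQ_eq_Ioc (T : ℝ) : muQ T = volume.restrict (Ioc 0 T ×ˢ Ioc (0 : ℝ) 1) := by
  rw [muQ_eq_prod, muI, restrict_Ioo_eq_restrict_Ioc, restrict_Ioo_eq_restrict_Ioc,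
    Measure.prod_restrict, ← Measure.volume_eq_prod]

/-- If `u = ∫₀ᵗ w(τ, ·) dτ` and `w(τ, e) = 0` then `u' = ∫₀ᵗ w_x(τ, ·) dτ` almost everywhere. -/
theorem ae_hasDerivAt_of_time_integral {T t y z e : ℝ} (hyz : y ≤ z) (he : e ∈ Icc y z)
    (ht : t ∈ Icc 0 T) {u : ℝ → ℝ} {w b : ℝ → ℝ → ℝ}
    (hb : IntegrableOn (Function.uncurry b) (Ioc 0 T ×ˢ Ioc y z))
    (hw : ∀ᵐ τ ∂volume.restrict (Ioo 0 T), AbsolutelyContinuousOnInterval (w τ) y z ∧ w τ e = 0 ∧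
      ∀ᵐ x ∂volume.restrict (Ioo y z), HasDerivAt (w τ) (b τ x) x)
    (hu : ∀ x ∈ Icc y z, u x = ∫ τ in (0 : ℝ)..t, w τ x) :
    ∀ᵐ x, x ∈ Ioo y z → HasDerivAt u (∫ τ in (0 : ℝ)..t, b τ x) x := by
  have hbt : IntegrableOn (Function.uncurry b) (Ioc 0 t ×ˢ Ioc y z) :=
    hb.mono_set (prod_mono (Ioc_subset_Ioc_right ht.2) le_rfl)
  have hK : IntervalIntegrable (fun x => ∫ τ in (0 : ℝ)..t, b τ x) volume y z := by
    rw [intervalIntegrable_iff_integrableOn_Ioc_of_le hyz]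
    simp only [intervalIntegral.integral_of_le ht.1]
    have h1 := hbt
    rw [IntegrableOn, Measure.volume_eq_prod, ← Measure.prod_restrict] at h1
    exact h1.integral_prod_right
  -- Each `w τ` is the primitive of `b τ` vanishing at `e`. Exchanging the integrals exhibits `u` as
  -- a primitive in space, and Lebesgue differentiation concludes.
  have hrep : ∀ x ∈ Icc y z, u x = ∫ ξ in e..x, ∫ τ in (0 : ℝ)..t, b τ ξ := by
    intro x hx
    rw [hu x hx]
    have hsub : uIoc e x ⊆ Ioc y z := by
      intro ξ hξ
      rcases le_total e x with h | h
      · rw [uIoc_of_le h] at hξ; exact ⟨he.1.trans_lt hξ.1, hξ.2.trans hx.2⟩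
      · rw [uIoc_of_ge h] at hξ; exact ⟨hx.1.trans_lt hξ.1, hξ.2.trans he.2⟩
    rw [intervalIntegral_intervalIntegral_swap (F := fun ξ τ => b τ ξ)]
    · rw [intervalIntegral.integral_of_le ht.1, intervalIntegral.integral_of_le ht.1]
      refine integral_congr_ae ?_
      rw [← restrict_Ioo_eq_restrict_Ioc]
      filter_upwards [ae_restrict_of_ae_restrict_of_subset (Ioo_subset_Ioo_right ht.2) hw]
        with τ h
      obtain ⟨h1, h2, h3⟩ := h
      have hsub2 : uIcc e x ⊆ uIcc y z := by
        rw [uIcc_of_le hyz]; exact uIcc_subset_Icc he hx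
      have h4 := (h1.mono hsub2).integral_deriv_eq_sub
      rw [h2, sub_zero] at h4
      rw [← h4]
      refine intervalIntegral.integral_congr_ae_restrict ?_
      have h5 := ae_restrict_of_ae_restrict_of_subset hsub
        (by rwa [restrict_Ioo_eq_restrict_Ioc] at h3)
      filter_upwards [h5] with ξ hξ using hξ.deriv
    · have h1 : IntegrableOn (Function.uncurry b) (uIoc 0 t ×ˢ uIoc e x) := by
        rw [uIoc_of_le ht.1]
        exact hbt.mono_set (prod_mono le_rfl hsub)
      rw [IntegrableOn, Measure.volume_eq_prod, ← Measure.prod_restrict] at h1 ⊢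
      exact h1.swap
  filter_upwards [hK.ae_hasDerivAt_integral] with x hx hxm
  have h1 := hx (by rw [uIcc_of_le hyz]; exact Ioo_subset_Icc_self hxm) e
    (by rwa [uIcc_of_le hyz])
  refine h1.congr_of_eventuallyEq ?_
  filter_upwards [Icc_mem_nhds hxm.1 hxm.2] with ξ hξ using hrep ξ hξ

/-- Passing from almost every slice to almost every point of the cylinder requires measurability of
the exceptional set, which is obtained by replacing `g` with a measurable version. -/
theorem ae_muQ_of_ae_ae {T : ℝ} {g : ℝ × ℝ → ℝ} (hg : AEMeasurable g (muQ T))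
    (h : ∀ᵐ t ∂volume.restrict (Ioo 0 T), ∀ᵐ x ∂muI, g (t, x) = 0) : ∀ᵐ q ∂muQ T, g q = 0 := by
  obtain ⟨B, hB, hgB⟩ := hg
  have h1 : ∀ᵐ q ∂muQ T, B q = 0 := by
    have h2 := ae_ae_of_ae_muQ hgB
    have hm : MeasurableSet {q | B q = 0} := hB (measurableSet_singleton 0)
    rw [muQ_eq_prod, Measure.ae_prod_iff_ae_ae hm]
    filter_upwards [h, h2] with t e1 e2
    filter_upwards [e1, e2] with x f1 f2
    rw [← f2, f1]
  filter_upwards [h1, hgB] with q e1 e2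
  rw [e2, e1]

/-- Measurability of the primitive in time. -/
theorem aemeasurable_time_primitive {T : ℝ} {b : ℝ → ℝ → ℝ}
    (hb : AEMeasurable (fun q : ℝ × ℝ => b q.1 q.2) (muQ T)) :
    AEMeasurable (fun q : ℝ × ℝ => ∫ τ in (0 : ℝ)..q.1, b τ q.2) (muQ T) := by
  set B := hb.mk _ with hB
  have hBm : Measurable B := hb.measurable_mk
  -- The variable upper limit is encoded by an indicator in a third variable, so that measurability
  -- of parameter integrals applies.
  have h1 : Measurable (fun z : (ℝ × ℝ) × ℝ =>
      indicator {z : (ℝ × ℝ) × ℝ | 0 < z.2 ∧ z.2 < z.1.1} (fun z => B (z.2, z.1.2)) z) := by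
    refine Measurable.indicator (by fun_prop) ?_
    exact (measurableSet_lt measurable_const measurable_snd).inter
      (measurableSet_lt measurable_snd (measurable_fst.comp measurable_fst))
  have h2 := h1.stronglyMeasurable.integral_prod_right' (ν := (volume : Measure ℝ))
  refine ⟨_, h2.measurable, ?_⟩
  have h3 := ae_ae_of_ae_muQ' hb.ae_eq_mk
  filter_upwards [ae_muQ_snd T h3, ae_muQ_fst T (ae_restrict_mem measurableSet_Ioo)] with q hq ht
  rw [intervalIntegral.integral_of_le ht.1.le, ← restrict_Ioo_eq_restrict_Ioc]
  have e1 : (fun τ => indicator {z : (ℝ × ℝ) × ℝ | 0 < z.2 ∧ z.2 < z.1.1}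
      (fun z => B (z.2, z.1.2)) (q, τ)) = indicator (Ioo 0 q.1) (fun τ => B (τ, q.2)) := by
    funext τ
    simp only [indicator, mem_Ioo, mem_ofPred_eq]
  rw [e1, integral_indicator measurableSet_Ioo]
  refine integral_congr_ae ?_
  exact ae_restrict_of_ae_restrict_of_subset (Ioo_subset_Ioo_right ht.2.le) hq

theorem primitive_ac {T c : ℝ} (hT : 0 < T) {u f : ℝ → ℝ} (hf : IntervalIntegrable f volume 0 T)
    (hu : ∀ t ∈ Icc 0 T, u t = c + ∫ τ in (0 : ℝ)..t, f τ) :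
    AbsolutelyContinuousOnInterval u 0 T ∧
      ∀ᵐ t ∂volume.restrict (Ioo 0 T), HasDerivAt u (f t) t := by
  constructor
  · have h1 := hf.absolutelyContinuousOnInterval_intervalIntegral (c := 0) (by simp)
    have h2 : AbsolutelyContinuousOnInterval (fun _ : ℝ => c) 0 T :=
      (contDiff_const (c := c)).contDiffOn.absolutelyContinuousOnInterval
    refine (h2.fun_add h1).congr fun t ht => ?_
    rw [uIcc_of_le hT.le] at ht
    exact hu t ht
  · filter_upwards [ae_restrict_of_ae hf.ae_hasDerivAt_integral,
      ae_restrict_mem measurableSet_Ioo] with t h1 ht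
    have h2 := (h1 (by rw [uIcc_of_le hT.le]; exact Ioo_subset_Icc_self ht) 0 (by simp)).const_add c
    refine h2.congr_of_eventuallyEq ?_
    filter_upwards [Icc_mem_nhds ht.1 ht.2] with τ hτ using hu τ hτ

section TimeDeriv

variable {T x₀ : ℝ} {A : ℝ → ℝ} {v w : ℝ → ℝ → ℝ}

theorem HasTimeDeriv.ac (h : HasTimeDeriv T x₀ v w) (hT : 0 < T) {x : ℝ}
    (hx : x ∈ Icc (0 : ℝ) 1) (hne : x ≠ x₀) :
    AbsolutelyContinuousOnInterval (fun t => v t x) 0 T ∧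
      ∀ᵐ t ∂volume.restrict (Ioo 0 T), HasDerivAt (fun t => v t x) (w t x) t :=
  primitive_ac hT (h T ⟨hT.le, le_rfl⟩ x hx hne).1 fun t ht => (h t ht x hx hne).2

/-- A function which is square integrable with a weight is integrable away from `x₀`. -/
theorem integrableOn_of_memLp_sqrt (hA : LocAC x₀ A) (hx₀ : x₀ ∈ Ioo (0 : ℝ) 1)
    (hpos : ∀ x ∈ Icc (0 : ℝ) 1, x ≠ x₀ → 0 < A x) {b : ℝ → ℝ → ℝ}
    (hb : MemLp (fun q : ℝ × ℝ => √(A q.2) * b q.1 q.2) 2 (muQ T)) {y z : ℝ} (hy : 0 ≤ y)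
    (hz : z ≤ 1) (hyz : y ≤ z) (hne : x₀ ∉ Icc y z) :
    IntegrableOn (Function.uncurry b) (Ioc 0 T ×ˢ Ioc y z) := by
  have hsub : Ioc 0 T ×ˢ Ioc y z ⊆ Ioc 0 T ×ˢ Ioc (0 : ℝ) 1 :=
    prod_mono le_rfl (Ioc_subset_Ioc hy hz)
  have hAc : ContinuousOn A (Icc y z) := fun x hx =>
    (hA.continuousWithinAt ⟨hy.trans hx.1, hx.2.trans hz⟩ (by rintro rfl; exact hne hx)).mono
      (Icc_subset_Icc hy hz)
  -- On a strip away from `x₀` the weight is at least its positive minimum, and `|b| ≤ 1 + b²` on a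
  -- set of finite measure.
  obtain ⟨ξ, hξ, hmin⟩ := isCompact_Icc.exists_isMinOn (nonempty_Icc.2 hyz) hAc
  have hm : 0 < A ξ := hpos ξ ⟨hy.trans hξ.1, hξ.2.trans hz⟩ (by rintro rfl; exact hne hξ)
  have hbm : AEMeasurable (fun q : ℝ × ℝ => b q.1 q.2) (muQ T) := by
    refine aemeasurable_of_sqrt_mul (aemeasurable_snd_muQ T hA.aemeasurable) ?_
      hb.aestronglyMeasurable.aemeasurable
    filter_upwards [ae_muQ_mem T x₀] with q hq using hpos _ hq.2.1 hq.2.2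
  have h1 : IntegrableOn (fun q : ℝ × ℝ => (1 + (√(A q.2) * b q.1 q.2) ^ 2 / A ξ))
      (Ioc 0 T ×ˢ Ioc y z) := by
    refine IntegrableOn.add ?_ ?_
    · refine integrableOn_const ?_
      rw [Measure.volume_eq_prod, Measure.prod_prod]
      simpa using ENNReal.mul_ne_top ENNReal.ofReal_ne_top ENNReal.ofReal_ne_top
    · have h2 := (hb.integrable_sq).div_const (A ξ)
      rw [muQ_eq_Ioc] at h2
      exact IntegrableOn.mono_set h2 hsub
  refine Integrable.mono' h1 ?_ ?_
  · rw [muQ_eq_Ioc] at hbm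
    exact (hbm.mono_measure (Measure.restrict_mono hsub le_rfl)).aestronglyMeasurable
  · filter_upwards [ae_restrict_mem (measurableSet_Ioc.prod measurableSet_Ioc)] with q hq
    have hq2 := Ioc_subset_Icc_self hq.2
    have hle : A ξ ≤ A q.2 := hmin hq2
    have hpos2 : 0 < A q.2 := hm.trans_le hle
    rw [mul_pow, Real.sq_sqrt hpos2.le, Real.norm_eq_abs]
    change |b q.1 q.2| ≤ _
    have h3 : b q.1 q.2 ^ 2 ≤ A q.2 * b q.1 q.2 ^ 2 / A ξ := by
      rw [le_div_iff₀ hm, mul_comm]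
      gcongr
    have h4 := sq_nonneg (|b q.1 q.2| - 1 / 2)
    nlinarith [sq_abs (b q.1 q.2)]

/-- The space derivative of a function in `H¹(0,T; H¹)` is absolutely continuous in time. -/
theorem HasTimeDeriv.time_regular (h : HasTimeDeriv T x₀ v w) (hT : 0 < T)
    (hx₀ : x₀ ∈ Ioo (0 : ℝ) 1) (hA : LocAC x₀ A)
    (hpos : ∀ x ∈ Icc (0 : ℝ) 1, x ≠ x₀ → 0 < A x)
    (hv : ∀ t ∈ Icc 0 T, LocAC x₀ (v t))
    (hw : ∀ᵐ t ∂volume.restrict (Ioo 0 T), LocAC x₀ (w t) ∧ w t 0 = 0 ∧ w t 1 = 0)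
    (hp : AEMeasurable (fun q : ℝ × ℝ => Dx (v q.1) q.2) (muQ T))
    (hb : MemLp (fun q : ℝ × ℝ => √(A q.2) * Dx (w q.1) q.2) 2 (muQ T)) :
    ∀ᵐ x ∂muI, AbsolutelyContinuousOnInterval (fun t => v t x) 0 T ∧
    (∀ᵐ t ∂volume.restrict (Ioo 0 T), HasDerivAt (fun t => v t x) (w t x) t) ∧
    ∃ P : ℝ → ℝ, AbsolutelyContinuousOnInterval P 0 T ∧
      (∀ᵐ t ∂volume.restrict (Ioo 0 T), HasDerivAt P (Dx (w t) x) t) ∧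
      ∀ᵐ t ∂volume.restrict (Ioo 0 T), P t = Dx (v t) x := by
  have h0T : (0 : ℝ) ∈ Icc 0 T := ⟨le_rfl, hT.le⟩
  set b : ℝ → ℝ → ℝ := fun t => Dx (w t) with hbd
  have hbm : AEMeasurable (fun q : ℝ × ℝ => b q.1 q.2) (muQ T) := by
    refine aemeasurable_of_sqrt_mul (aemeasurable_snd_muQ T hA.aemeasurable) ?_
      hb.aestronglyMeasurable.aemeasurable
    filter_upwards [ae_muQ_mem T x₀] with q hq using hpos _ hq.2.1 hq.2.2
  have hright : ∀ y ∈ Ioo x₀ 1, IntegrableOn (Function.uncurry b) (Ioc 0 T ×ˢ Ioc y 1) :=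
    fun y hy => integrableOn_of_memLp_sqrt hA hx₀ hpos hb (hx₀.1.trans hy.1).le le_rfl hy.2.le
      fun hmem => (hy.1.trans_le hmem.1).ne rfl
  have hleft : ∀ y ∈ Ioo 0 x₀, IntegrableOn (Function.uncurry b) (Ioc 0 T ×ˢ Ioc 0 y) :=
    fun y hy => integrableOn_of_memLp_sqrt hA hx₀ hpos hb le_rfl (hy.2.trans hx₀.2).le hy.1.le
      fun hmem => (hmem.2.trans_lt hy.2).ne rfl
  have hbi : ∀ᵐ x ∂muI, IntervalIntegrable (fun τ => b τ x) volume 0 T := by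
    have key : ∀ y z : ℝ, IntegrableOn (Function.uncurry b) (Ioc 0 T ×ˢ Ioc y z) →
        ∀ᵐ x, x ∈ Ioc y z → IntervalIntegrable (fun τ => b τ x) volume 0 T := by
      intro y z hyz
      rw [IntegrableOn, Measure.volume_eq_prod, ← Measure.prod_restrict] at hyz
      have h1 := hyz.prod_left_ae
      rw [ae_restrict_iff' measurableSet_Ioc] at h1
      filter_upwards [h1] with x hx hxm
      rw [intervalIntegrable_iff_integrableOn_Ioc_of_le hT.le]
      exact hx hxm
    refine ae_muI_of_restrict hx₀ (fun y hy => ?_) fun y hy => ?_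
    · have hn : ∀ᵐ x : ℝ, x ≠ 0 := by simp [ae_iff, measure_singleton]
      filter_upwards [key 0 y (hleft y hy), hn] with x hx hx0 hxm
      exact hx ⟨lt_of_le_of_ne hxm.1 hx0.symm, hxm.2⟩
    · have hn : ∀ᵐ x : ℝ, x ≠ y := by simp [ae_iff, measure_singleton]
      filter_upwards [key y 1 (hright y hy), hn] with x hx hxy hxm
      exact hx ⟨lt_of_le_of_ne hxm.1 hxy.symm, hxm.2⟩
  -- The exceptional set of points `x` depends on `t` here. Joint measurability in `hall` then
  -- allows the order of the quantifiers to be exchanged.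
  have hslice : ∀ t ∈ Icc 0 T, ∀ᵐ x ∂muI,
      Dx (v t) x - (Dx (v 0) x + ∫ τ in (0 : ℝ)..t, b τ x) = 0 := by
    intro t ht
    have key : ∀ᵐ x ∂muI, HasDerivAt (fun x => v t x - v 0 x) (∫ τ in (0 : ℝ)..t, b τ x) x := by
      refine ae_muI_of_restrict hx₀ (fun y hy => ?_) fun y hy => ?_
      · have hn : ∀ᵐ x : ℝ, x ≠ 0 ∧ x ≠ y := by
          have h1 : ∀ᵐ x : ℝ, x ≠ 0 := by simp [ae_iff, measure_singleton]
          have h2 : ∀ᵐ x : ℝ, x ≠ y := by simp [ae_iff, measure_singleton]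
          filter_upwards [h1, h2] with x h1 h2 using ⟨h1, h2⟩
        have := ae_hasDerivAt_of_time_integral (w := w) (u := fun x => v t x - v 0 x) hy.1.le
          (left_mem_Icc.2 hy.1.le) ht (hleft y hy) ?_ ?_
        · filter_upwards [this, hn] with x h1 h2 h3
          exact h1 ⟨lt_of_le_of_ne h3.1 h2.1.symm, lt_of_le_of_ne h3.2 h2.2⟩
        · filter_upwards [hw] with τ hτ
          exact ⟨hτ.1.1 y hy, hτ.2.1,
            LocACDeriv.restrict_left hx₀ (hτ.1.locACDeriv_Dx hx₀).deriv hy.2⟩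
        · intro x hx
          rw [(h t ht x ⟨hx.1, (hx.2.trans_lt (hy.2.trans hx₀.2)).le⟩ (hx.2.trans_lt hy.2).ne).2]
          ring
      · have hn : ∀ᵐ x : ℝ, x ≠ y ∧ x ≠ 1 := by
          have h1 : ∀ᵐ x : ℝ, x ≠ y := by simp [ae_iff, measure_singleton]
          have h2 : ∀ᵐ x : ℝ, x ≠ 1 := by simp [ae_iff, measure_singleton]
          filter_upwards [h1, h2] with x h1 h2 using ⟨h1, h2⟩
        have := ae_hasDerivAt_of_time_integral (w := w) (u := fun x => v t x - v 0 x) hy.2.le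
          (right_mem_Icc.2 hy.2.le) ht (hright y hy) ?_ ?_
        · filter_upwards [this, hn] with x h1 h2 h3
          exact h1 ⟨lt_of_le_of_ne h3.1 h2.1.symm, lt_of_le_of_ne h3.2 h2.2⟩
        · filter_upwards [hw] with τ hτ
          exact ⟨hτ.1.2 y hy, hτ.2.2,
            LocACDeriv.restrict_right hx₀ (hτ.1.locACDeriv_Dx hx₀).deriv hy.1⟩
        · intro x hx
          rw [(h t ht x ⟨((hx₀.1.trans hy.1).trans_le hx.1).le, hx.2⟩ (hy.1.trans_le hx.1).ne').2]
          ring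
    filter_upwards [key, ((hv t ht).locACDeriv_Dx hx₀).deriv,
      ((hv 0 h0T).locACDeriv_Dx hx₀).deriv] with x h1 h2 h3
    have := h1.unique (h2.sub h3)
    linarith
  have hD0 : AEMeasurable (Dx (v 0)) muI := by
    refine (measurable_deriv (v 0)).aemeasurable.congr ?_
    filter_upwards [ae_mem_Ioo] with x hx using (Dx_eq_deriv _ hx).symm
  have hall := ae_muQ_of_ae_ae (T := T)
    (g := fun q => Dx (v q.1) q.2 - (Dx (v 0) q.2 + ∫ τ in (0 : ℝ)..q.1, b τ q.2))
    (hp.sub ((aemeasurable_snd_muQ T hD0).add (aemeasurable_time_primitive hbm))) (by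
      filter_upwards [ae_restrict_mem measurableSet_Ioo] with t ht
      exact hslice t (Ioo_subset_Icc_self ht))
  filter_upwards [hbi, ae_ae_of_ae_muQ' hall, ae_Icc_ne x₀] with x e1 e2 e3
  have h1 := h.ac hT e3.1 e3.2
  have h2 := primitive_ac (c := Dx (v 0) x) hT e1 (u := fun t => Dx (v 0) x
    + ∫ τ in (0 : ℝ)..t, b τ x) fun t _ => rfl
  refine ⟨h1.1, h1.2, _, h2.1, h2.2, ?_⟩
  filter_upwards [e2] with t ht
  linarith

/-- Measurability in time of the space derivative at a fixed point. -/
theorem HasTimeDeriv.aemeasurable_Dx (h : HasTimeDeriv T x₀ v w) (hT : 0 < T) {e : ℝ}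
    (he : e ∈ Icc (0 : ℝ) 1) (hne : e ≠ x₀)
    (hd : ∀ᵐ t ∂volume.restrict (Ioo 0 T), DifferentiableWithinAt ℝ (v t) (Icc 0 1) e) :
    AEMeasurable (fun t => Dx (v t) e) (volume.restrict (Ioo 0 T)) := by
  have hm : ∀ x ∈ Icc (0 : ℝ) 1, x ≠ x₀ →
      AEMeasurable (fun t => v t x) (volume.restrict (Ioo 0 T)) := by
    intro x hx hxne
    have h1 := (h.ac hT hx hxne).1.continuousOn
    rw [uIcc_of_le hT.le] at h1
    exact (h1.mono Ioo_subset_Icc_self).aemeasurable measurableSet_Ioo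
  -- The derivative at `e` is the limit of difference quotients along a fixed sequence inside
  -- `[0,1]`, one-sided if `e` is an end point. After a shift the sequence avoids `x₀`, so each
  -- quotient is measurable in time.
  have hacc : (𝓝[Icc 0 1 \ {e}] e).NeBot := by
    have h1 := (uniqueDiffOn_Icc (zero_lt_one' ℝ) e he).accPt
    rwa [accPt_principal_iff_nhdsWithin] at h1
  have hev : ∀ᶠ x in 𝓝[Icc 0 1 \ {e}] e, x ≠ x₀ :=
    (nhdsWithin_le_nhds (isOpen_ne.mem_nhds hne))
  obtain ⟨xs, hxs⟩ := exists_seq_tendsto (𝓝[Icc 0 1 \ {e}] e)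
  obtain ⟨m, hm'⟩ := eventually_atTop.1 (hxs.eventually (eventually_mem_nhdsWithin.and hev))
  have hshift := hxs.comp (tendsto_add_atTop_nat m)
  refine aemeasurable_of_tendsto_metrizable_ae (u := atTop)
    (f := fun n t => slope (v t) e (xs (n + m))) (fun n => ?_) ?_
  · have h1 := hm' (n + m) (Nat.le_add_left _ _)
    simp only [slope_def_field]
    exact ((hm _ h1.1.1 h1.2).sub (hm e he hne)).div_const _
  · filter_upwards [hd] with t ht
    exact (hasDerivWithinAt_iff_tendsto_slope.1 ht.hasDerivWithinAt).comp hshift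

end TimeDeriv

/-! ### Degenerate coefficients -/

theorem exists_ae_abs_le {α : Type*} [MeasurableSpace α] {μ : Measure α} {f : α → ℝ}
    (hf : MemLp f ⊤ μ) : ∃ L : ℝ, 0 < L ∧ ∀ᵐ x ∂μ, |f x| ≤ L := by
  have h1 : eLpNormEssSup f μ ≠ ⊤ := by
    have := hf.eLpNorm_ne_top
    rwa [eLpNorm_exponent_top] at this
  refine ⟨(eLpNormEssSup f μ).toReal + 1, by positivity, ?_⟩
  filter_upwards [ae_le_eLpNormEssSup (f := f) (μ := μ)] with x hx
  have h2 := (ENNReal.toReal_le_toReal (by simp) h1).2 hx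
  rw [toReal_enorm, Real.norm_eq_abs] at h2
  linarith

/-- The properties common to weakly and strongly degenerate coefficients. -/
structure DegenerateCoefficient (a : ℝ → ℝ) (x₀ K : ℝ) : Prop where
  x₀_mem : x₀ ∈ Ioo (0 : ℝ) 1
  K_lt : K < 2
  zero : a x₀ = 0
  pos : ∀ x ∈ Icc (0 : ℝ) 1, x ≠ x₀ → 0 < a x
  ac : AbsolutelyContinuousOnInterval a 0 1
  deriv_le : ∀ᵐ x ∂muI, (x - x₀) * Dx a x ≤ K * a x
  lipschitz : 1 ≤ K → ∃ L > 0, ∀ x ∈ Icc (0 : ℝ) 1, a x ≤ L * |x - x₀|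

theorem WeaklyDegenerate.degenerateCoefficient {a : ℝ → ℝ} {x₀ K : ℝ}
    (h : WeaklyDegenerate a x₀ K) : DegenerateCoefficient a x₀ K :=
  ⟨h.x₀_mem, by linarith [h.K_mem.2], h.zero, h.pos, h.sobolev.1, h.deriv_le,
    fun hK => absurd h.K_mem.2 hK.not_gt⟩

theorem _root_.AbsolutelyContinuousOnInterval.abs_sub_le_of_ae_abs_Dx_le {f : ℝ → ℝ} {L : ℝ}
    (hf : AbsolutelyContinuousOnInterval f 0 1) (hL : ∀ᵐ x ∂muI, |Dx f x| ≤ L) {x y : ℝ}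
    (hx : x ∈ Icc (0 : ℝ) 1) (hy : y ∈ Icc (0 : ℝ) 1) : |f x - f y| ≤ L * |x - y| := by
  have h1 : AbsolutelyContinuousOnInterval f y x :=
    hf.mono (by rw [uIcc_of_le zero_le_one]; exact uIcc_subset_Icc hy hx)
  have h3 : ∀ᵐ z, z ∈ uIoc y x → ‖deriv f z‖ ≤ L := by
    rw [muI, ae_restrict_iff' measurableSet_Ioo] at hL
    have hn : ∀ᵐ z : ℝ, z ≠ 1 := by simp [ae_iff, measure_singleton]
    filter_upwards [hL, hn] with z hz hz1 hzx
    rw [uIoc, mem_Ioc] at hzx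
    have hz2 : z ∈ Ioo (0 : ℝ) 1 := ⟨(le_min hy.1 hx.1).trans_lt hzx.1,
      lt_of_le_of_ne (hzx.2.trans (max_le hy.2 hx.2)) hz1⟩
    rw [← Dx_eq_deriv f hz2]
    exact hz hz2
  have h4 := intervalIntegral.norm_integral_le_of_norm_le_const_ae h3
  rwa [h1.integral_deriv_eq_sub] at h4

theorem StronglyDegenerate.degenerateCoefficient {a : ℝ → ℝ} {x₀ K : ℝ}
    (h : StronglyDegenerate a x₀ K) : DegenerateCoefficient a x₀ K := by
  refine ⟨h.x₀_mem, h.K_mem.2, h.zero, h.pos, h.sobolev.1, h.deriv_le, fun _ => ?_⟩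
  obtain ⟨L, hL, hL'⟩ := exists_ae_abs_le h.sobolev.2
  refine ⟨L, hL, fun x hx => ?_⟩
  have h1 := h.sobolev.1.abs_sub_le_of_ae_abs_Dx_le hL' hx (Ioo_subset_Icc_self h.x₀_mem)
  rw [h.zero, sub_zero] at h1
  exact (le_abs_self _).trans h1

/-! ### Consequences of the inequality `(x - x₀) a' ≤ K a`. -/

namespace DegenerateCoefficient

variable {a : ℝ → ℝ} {x₀ K : ℝ} (h : DegenerateCoefficient a x₀ K)
include h

theorem locAC : LocAC x₀ a := h.ac.locAC h.x₀_mem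

theorem exists_le : ∃ N : ℝ, 0 < N ∧ ∀ x ∈ Icc (0 : ℝ) 1, a x ≤ N := by
  obtain ⟨C, hC⟩ := h.ac.exists_bound
  refine ⟨|C| + 1, by positivity, fun x hx => ?_⟩
  have := hC x (by rwa [uIcc_of_le zero_le_one])
  linarith [le_abs_self (a x), le_abs_self C, Real.norm_eq_abs (a x)]

theorem nonneg {x : ℝ} (hx : x ∈ Icc (0 : ℝ) 1) : 0 ≤ a x := by
  by_cases hne : x = x₀
  · rw [hne, h.zero]
  · exact (h.pos x hx hne).le

theorem zero_mem_ne : (0 : ℝ) ∈ Icc (0 : ℝ) 1 ∧ (0 : ℝ) ≠ x₀ := ⟨by simp, h.x₀_mem.1.ne⟩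

theorem one_mem_ne : (1 : ℝ) ∈ Icc (0 : ℝ) 1 ∧ (1 : ℝ) ≠ x₀ := ⟨by simp, h.x₀_mem.2.ne'⟩

theorem locACDeriv_inv : LocACDeriv x₀ (fun x => (a x)⁻¹) (fun x => -Dx a x / a x ^ 2) :=
  (h.locAC.locACDeriv_Dx h.x₀_mem).inv h.x₀_mem h.pos

theorem locACDeriv_div : LocACDeriv x₀ (fun x => (x - x₀) / a x)
    (fun x => (1 - (x - x₀) * Dx a x / a x) / a x) := by
  have h1 : LocACDeriv x₀ (fun x => x - x₀) (fun _ => 1) :=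
    LocACDeriv.of_contDiff (by fun_prop) fun x => (hasDerivAt_id x).sub_const x₀
  refine (h1.mul h.locACDeriv_inv).congr h.x₀_mem (fun x _ _ => div_eq_mul_inv _ _) ?_
  filter_upwards [ae_Icc_ne x₀] with x hx
  have := (h.pos x hx.1 hx.2).ne'
  field_simp
  ring

/-- The last factor is at least `2 - K > 0`. Hence `(x - x₀)² / a` is monotone on each side of `x₀`,
and its values at the ends control the integral of `(x - x₀) / a`. Both facts are used below with
explicit constants. -/
theorem locACDeriv_sq_div : LocACDeriv x₀ (fun x => (x - x₀) ^ 2 / a x)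
    (fun x => (x - x₀) / a x * (2 - (x - x₀) * Dx a x / a x)) := by
  have h1 : LocACDeriv x₀ (fun x => x - x₀) (fun _ => 1) :=
    LocACDeriv.of_contDiff (by fun_prop) fun x => (hasDerivAt_id x).sub_const x₀
  refine (h1.mul h.locACDeriv_div).congr h.x₀_mem (fun x _ _ => by ring) ?_
  filter_upwards [ae_Icc_ne x₀] with x hx
  have := (h.pos x hx.1 hx.2).ne'
  field_simp
  ring

theorem ae_quotient_le : ∀ᵐ x ∂muI, (x - x₀) * Dx a x / a x ≤ K := by
  filter_upwards [h.deriv_le, ae_Icc_ne x₀] with x h1 h2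
  rwa [div_le_iff₀ (h.pos x h2.1 h2.2)]

theorem integral_right_le {y : ℝ} (hy : y ∈ Ioo x₀ 1) :
    IntervalIntegrable (fun x => (x - x₀) / a x) volume y 1 ∧
      (2 - K) * ∫ x in y..1, (x - x₀) / a x ≤ (1 - x₀) ^ 2 / a 1 - (y - x₀) ^ 2 / a y := by
  have hc : IntervalIntegrable (fun x => (x - x₀) / a x) volume y 1 := 
    (h.locACDeriv_div.ac.2 y hy).continuousOn.intervalIntegrable
  refine ⟨hc, ?_⟩
  have hd := LocACDeriv.restrict_right h.x₀_mem h.locACDeriv_sq_div.deriv hy.1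
  have hac := h.locACDeriv_sq_div.ac.2 y hy
  rw [← hac.integral_eq_sub_of_hasDerivAt hy.2.le hd, ← intervalIntegral.integral_const_mul]
  refine intervalIntegral.integral_mono_ae_restrict hy.2.le (hc.const_mul _)
    (hac.intervalIntegrable_of_hasDerivAt hy.2.le hd) ?_
  rw [← restrict_Ioo_eq_restrict_Icc]
  filter_upwards [LocACDeriv.restrict_right h.x₀_mem h.ae_quotient_le hy.1,
    LocACDeriv.restrict_right h.x₀_mem (ae_Icc_ne x₀) hy.1,
    ae_restrict_mem measurableSet_Ioo] with x h1 h2 h3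
  have h4 : 0 ≤ (x - x₀) / a x :=
    div_nonneg (sub_nonneg.2 (hy.1.trans h3.1).le) (h.pos x h2.1 h2.2).le
  rw [mul_comm]
  gcongr

theorem integral_left_le {y : ℝ} (hy : y ∈ Ioo 0 x₀) :
    IntervalIntegrable (fun x => (x - x₀) / a x) volume 0 y ∧
      (y - x₀) ^ 2 / a y - x₀ ^ 2 / a 0 ≤ (2 - K) * ∫ x in (0 : ℝ)..y, (x - x₀) / a x := by
  have hc : IntervalIntegrable (fun x => (x - x₀) / a x) volume 0 y := 
    (h.locACDeriv_div.ac.1 y hy).continuousOn.intervalIntegrable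
  refine ⟨hc, ?_⟩
  have hd := LocACDeriv.restrict_left h.x₀_mem h.locACDeriv_sq_div.deriv hy.2
  have hac := h.locACDeriv_sq_div.ac.1 y hy
  have e0 : x₀ ^ 2 / a 0 = (0 - x₀) ^ 2 / a 0 := by ring
  rw [e0, ← hac.integral_eq_sub_of_hasDerivAt hy.1.le hd, ← intervalIntegral.integral_const_mul]
  refine intervalIntegral.integral_mono_ae_restrict hy.1.le
    (hac.intervalIntegrable_of_hasDerivAt hy.1.le hd) (hc.const_mul _) ?_
  rw [← restrict_Ioo_eq_restrict_Icc]
  filter_upwards [LocACDeriv.restrict_left h.x₀_mem h.ae_quotient_le hy.2,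
    LocACDeriv.restrict_left h.x₀_mem (ae_Icc_ne x₀) hy.2,
    ae_restrict_mem measurableSet_Ioo] with x h1 h2 h3
  have h4 : (x - x₀) / a x ≤ 0 :=
    div_nonpos_of_nonpos_of_nonneg (sub_nonpos.2 (h3.2.trans hy.2).le) (h.pos x h2.1 h2.2).le
  rw [mul_comm (2 - K)]
  exact mul_le_mul_of_nonpos_left (by linarith) h4

theorem sq_div_le_right {y : ℝ} (hy : y ∈ Ioo x₀ 1) :
    (y - x₀) ^ 2 / a y ≤ (1 - x₀) ^ 2 / a 1 := by
  have h1 := (h.integral_right_le hy).2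
  have h2 : 0 ≤ ∫ x in y..1, (x - x₀) / a x := by
    refine intervalIntegral.integral_nonneg hy.2.le fun x hx => ?_
    exact div_nonneg (sub_nonneg.2 (hy.1.trans_le hx.1).le)
      (h.nonneg ⟨(h.x₀_mem.1.trans hy.1).le.trans hx.1, hx.2⟩)
  have h3 := mul_nonneg (sub_nonneg.2 h.K_lt.le) h2
  linarith

theorem sq_div_le_left {y : ℝ} (hy : y ∈ Ioo 0 x₀) :
    (y - x₀) ^ 2 / a y ≤ x₀ ^ 2 / a 0 := by
  have h1 := (h.integral_left_le hy).2
  have h2 : 0 ≤ ∫ x in (0 : ℝ)..y, -((x - x₀) / a x) := by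
    refine intervalIntegral.integral_nonneg hy.1.le fun x hx => ?_
    rw [neg_nonneg]
    exact div_nonpos_of_nonpos_of_nonneg (sub_nonpos.2 (hx.2.trans hy.2.le))
      (h.nonneg ⟨hx.1, (hx.2.trans hy.2.le).trans h.x₀_mem.2.le⟩)
  rw [intervalIntegral.integral_neg] at h2
  have h3 := mul_nonneg (sub_nonneg.2 h.K_lt.le) h2
  linarith

theorem exists_sq_div_le : ∃ N : ℝ, 0 < N ∧
    ∀ x ∈ Icc (0 : ℝ) 1, x ≠ x₀ → (x - x₀) ^ 2 / a x ≤ N := by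
  have h0 := h.pos 0 h.zero_mem_ne.1 h.zero_mem_ne.2
  have h1 := h.pos 1 h.one_mem_ne.1 h.one_mem_ne.2
  have f0 : 0 ≤ x₀ ^ 2 / a 0 := by positivity
  have f1 : 0 ≤ (1 - x₀) ^ 2 / a 1 := by positivity
  refine ⟨(1 - x₀) ^ 2 / a 1 + x₀ ^ 2 / a 0 + 1, by positivity, fun x hx hne => ?_⟩
  rcases lt_or_gt_of_ne hne with hlt | hgt
  · rcases hx.1.eq_or_lt with rfl | hx0
    · rw [zero_sub, neg_sq]; linarith
    · have := h.sq_div_le_left ⟨hx0, hlt⟩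
      linarith
  · rcases hx.2.eq_or_lt with rfl | hx1
    · linarith
    · have := h.sq_div_le_right ⟨hgt, hx1⟩
      linarith

/-- The integrand has constant sign on this side, and its integrals over `(u n, 1)` are bounded
uniformly once the nonnegative value of `(x - x₀)² / a` at `u n` is dropped. -/
theorem integrableOn_right : IntegrableOn (fun x => (x - x₀) / a x) (Ioc x₀ 1) := by
  obtain ⟨u, -, hu, hu'⟩ := exists_seq_strictAnti_tendsto' h.x₀_mem.2
  have h1 := h.pos 1 h.one_mem_ne.1 h.one_mem_ne.2
  refine integrableOn_Ioc_of_intervalIntegral_norm_bounded_left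
    (I := (1 - x₀) ^ 2 / a 1 / (2 - K)) (l := atTop) (a := u) (fun n => ?_) hu' ?_
  · have := (h.integral_right_le (hu n)).1
    rwa [intervalIntegrable_iff_integrableOn_Ioc_of_le (hu n).2.le] at this
  · refine Eventually.of_forall fun n => ?_
    rw [le_div_iff₀ (by linarith [h.K_lt]), mul_comm]
    have h2 := (h.integral_right_le (hu n)).2
    have h3 : 0 ≤ (u n - x₀) ^ 2 / a (u n) :=
      div_nonneg (sq_nonneg _) (h.nonneg ⟨(h.x₀_mem.1.trans (hu n).1).le, (hu n).2.le⟩)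
    have h4 : ∫ x in Ioc (u n) 1, ‖(x - x₀) / a x‖ = ∫ x in (u n)..1, (x - x₀) / a x := by
      rw [intervalIntegral.integral_of_le (hu n).2.le]
      refine setIntegral_congr_fun measurableSet_Ioc fun x hx => ?_
      exact Real.norm_of_nonneg (div_nonneg (sub_nonneg.2 ((hu n).1.trans hx.1).le)
        (h.nonneg ⟨((h.x₀_mem.1.trans (hu n).1).trans hx.1).le, hx.2⟩))
    rw [h4]
    linarith

theorem integrableOn_left : IntegrableOn (fun x => (x - x₀) / a x) (Ioc 0 x₀) := by
  obtain ⟨u, -, hu, hu'⟩ := exists_seq_strictMono_tendsto' h.x₀_mem.1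
  have h1 := h.pos 0 h.zero_mem_ne.1 h.zero_mem_ne.2
  refine integrableOn_Ioc_of_intervalIntegral_norm_bounded_right
    (I := x₀ ^ 2 / a 0 / (2 - K)) (l := atTop) (b := u) (fun n => ?_) hu' ?_
  · have := (h.integral_left_le (hu n)).1
    rwa [intervalIntegrable_iff_integrableOn_Ioc_of_le (hu n).1.le] at this
  · refine Eventually.of_forall fun n => ?_
    rw [le_div_iff₀ (by linarith [h.K_lt]), mul_comm]
    have h2 := (h.integral_left_le (hu n)).2
    have h3 : 0 ≤ (u n - x₀) ^ 2 / a (u n) :=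
      div_nonneg (sq_nonneg _) (h.nonneg ⟨(hu n).1.le, ((hu n).2.trans h.x₀_mem.2).le⟩)
    have h4 : ∫ x in Ioc 0 (u n), ‖(x - x₀) / a x‖ = -∫ x in (0 : ℝ)..(u n), (x - x₀) / a x := by
      rw [intervalIntegral.integral_of_le (hu n).1.le, ← integral_neg]
      refine setIntegral_congr_fun measurableSet_Ioc fun x hx => ?_
      exact Real.norm_of_nonpos (div_nonpos_of_nonpos_of_nonneg
        (sub_nonpos.2 (hx.2.trans (hu n).2.le))
        (h.nonneg ⟨hx.1.le, (hx.2.trans (hu n).2.le).trans h.x₀_mem.2.le⟩))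
    rw [h4]
    linarith

theorem integrable_div : IntervalIntegrable (fun x => (x - x₀) / a x) volume 0 1 :=
  ((intervalIntegrable_iff_integrableOn_Ioc_of_le h.x₀_mem.1.le).2 h.integrableOn_left).trans
    ((intervalIntegrable_iff_integrableOn_Ioc_of_le h.x₀_mem.2.le).2 h.integrableOn_right)

/-- This bound is the source of the threshold imposed on the additive constant of the weight. -/
theorem integral_right_total_le :
    ∫ x in x₀..1, (x - x₀) / a x ≤ (1 - x₀) ^ 2 / (a 1 * (2 - K)) := by
  obtain ⟨u, -, hu, hu'⟩ := exists_seq_strictAnti_tendsto' h.x₀_mem.2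
  have hm := Ioo_subset_Icc_self h.x₀_mem
  have h1 : ContinuousOn (fun y => ∫ x in (1 : ℝ)..y, (x - x₀) / a x) (uIcc 0 1) :=
    intervalIntegral.continuousOn_primitive_interval' h.integrable_div (by simp)
  rw [uIcc_of_le zero_le_one] at h1
  have h2 := (h1 x₀ hm).tendsto.comp (tendsto_nhdsWithin_iff.2 ⟨hu', Eventually.of_forall
    fun n => (⟨(h.x₀_mem.1.trans (hu n).1).le, (hu n).2.le⟩ : u n ∈ Icc (0 : ℝ) 1)⟩)
  rw [intervalIntegral.integral_symm]
  refine le_of_tendsto' h2.neg fun n => ?_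
  have h3 := (h.integral_right_le (hu n)).2
  have h4 : 0 ≤ (u n - x₀) ^ 2 / a (u n) :=
    div_nonneg (sq_nonneg _) (h.nonneg ⟨(h.x₀_mem.1.trans (hu n).1).le, (hu n).2.le⟩)
  rw [Function.comp_apply, ← intervalIntegral.integral_symm, ← div_div,
    le_div_iff₀ (by linarith [h.K_lt]), mul_comm]
  linarith

theorem integral_left_total_le :
    ∫ x in x₀..0, (x - x₀) / a x ≤ x₀ ^ 2 / (a 0 * (2 - K)) := by
  obtain ⟨u, -, hu, hu'⟩ := exists_seq_strictMono_tendsto' h.x₀_mem.1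
  have hm := Ioo_subset_Icc_self h.x₀_mem
  have h1 : ContinuousOn (fun y => ∫ x in (0 : ℝ)..y, (x - x₀) / a x) (uIcc 0 1) :=
    intervalIntegral.continuousOn_primitive_interval' h.integrable_div (by simp)
  rw [uIcc_of_le zero_le_one] at h1
  have h2 := (h1 x₀ hm).tendsto.comp (tendsto_nhdsWithin_iff.2 ⟨hu', Eventually.of_forall
    fun n => (⟨(hu n).1.le, ((hu n).2.trans h.x₀_mem.2).le⟩ : u n ∈ Icc (0 : ℝ) 1)⟩)
  rw [intervalIntegral.integral_symm]
  refine le_of_tendsto' h2.neg fun n => ?_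
  have h3 := (h.integral_left_le (hu n)).2
  have h4 : 0 ≤ (u n - x₀) ^ 2 / a (u n) :=
    div_nonneg (sq_nonneg _) (h.nonneg ⟨(hu n).1.le, ((hu n).2.trans h.x₀_mem.2).le⟩)
  rw [Function.comp_apply, ← div_div, le_div_iff₀ (by linarith [h.K_lt]), mul_comm]
  linarith

end DegenerateCoefficient

/-! ### The weight functions -/

theorem psiDiv_eq_psiNonDiv (a : ℝ → ℝ) (x₀ c₁ c₂ : ℝ) :
    psiDiv a x₀ c₁ c₂ = psiNonDiv a x₀ c₁ c₂ 0 := by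
  funext x
  simp [psiDiv, psiNonDiv]

section Weights

variable {a : ℝ → ℝ} {x₀ K : ℝ}

/-- The factor `e^{R (x - x₀)²}`. -/
def gaussFactor (x₀ R x : ℝ) : ℝ := Real.exp (R * (x - x₀) ^ 2)

theorem contDiff_gaussFactor (x₀ R : ℝ) : ContDiff ℝ 1 (gaussFactor x₀ R) := by
  unfold gaussFactor; fun_prop

theorem hasDerivAt_gaussFactor (x₀ R x : ℝ) :
    HasDerivAt (gaussFactor x₀ R) (2 * R * (x - x₀) * gaussFactor x₀ R x) x := by
  have h1 : HasDerivAt (fun x => R * (x - x₀) ^ 2) (R * (2 * (x - x₀) ^ 1 * 1)) x :=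
    (((hasDerivAt_id x).sub_const x₀).pow 2).const_mul R
  refine h1.exp.congr_deriv ?_
  rw [gaussFactor]
  ring

theorem gaussFactor_pos (x₀ R x : ℝ) : 0 < gaussFactor x₀ R x := Real.exp_pos _

theorem one_le_gaussFactor {R : ℝ} (hR : 0 ≤ R) (x₀ x : ℝ) : 1 ≤ gaussFactor x₀ R x :=
  Real.one_le_exp (by positivity)

theorem gaussFactor_le_of_abs_le {R : ℝ} (hR : 0 ≤ R) {x₀ x y : ℝ} (h : |x - x₀| ≤ |y - x₀|) :
    gaussFactor x₀ R x ≤ gaussFactor x₀ R y := by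
  unfold gaussFactor
  exact Real.exp_le_exp.2 (mul_le_mul_of_nonneg_left (sq_le_sq.2 h) hR)

theorem abs_sub_le_one {x₀ x : ℝ} (hx₀ : x₀ ∈ Ioo (0 : ℝ) 1) (hx : x ∈ Icc (0 : ℝ) 1) :
    |x - x₀| ≤ 1 :=
  abs_le.2 ⟨by linarith [hx₀.2, hx.1], by linarith [hx₀.1, hx.2]⟩

theorem gaussFactor_le {R : ℝ} (hR : 0 ≤ R) {x₀ x : ℝ} (hx₀ : x₀ ∈ Ioo (0 : ℝ) 1)
    (hx : x ∈ Icc (0 : ℝ) 1) : gaussFactor x₀ R x ≤ Real.exp R := by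
  unfold gaussFactor
  refine Real.exp_le_exp.2 ?_
  have h1 : (x - x₀) ^ 2 ≤ 1 := (sq_le_one_iff_abs_le_one _).2 (abs_sub_le_one hx₀ hx)
  calc R * (x - x₀) ^ 2 ≤ R * 1 := by gcongr
    _ = R := mul_one R

theorem locACDeriv_sub (x₀ : ℝ) : LocACDeriv x₀ (fun x => x - x₀) (fun _ => 1) :=
  LocACDeriv.of_contDiff (by fun_prop) fun x => (hasDerivAt_id x).sub_const x₀

namespace DegenerateCoefficient

variable (h : DegenerateCoefficient a x₀ K)
include h

theorem integrable_div_mul (R : ℝ) :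
    IntervalIntegrable (fun x => (x - x₀) / a x * gaussFactor x₀ R x) volume 0 1 :=
  h.integrable_div.mul_continuousOn (contDiff_gaussFactor x₀ R).continuous.continuousOn

theorem integral_mem_right {R : ℝ} (hR : 0 ≤ R) {x : ℝ} (hx : x ∈ Icc x₀ 1) :
    (∫ y in x₀..x, (y - x₀) / a y * gaussFactor x₀ R y) ∈
      Icc 0 ((1 - x₀) ^ 2 * gaussFactor x₀ R 1 / ((2 - K) * a 1)) := by
  have hm := Ioo_subset_Icc_self h.x₀_mem
  have hnn : ∀ y ∈ Icc x₀ 1, 0 ≤ (y - x₀) / a y := fun y hy =>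
    div_nonneg (sub_nonneg.2 hy.1) (h.nonneg ⟨hm.1.trans hy.1, hy.2⟩)
  have hsub : ∀ {z}, z ∈ Icc x₀ 1 → uIcc x₀ z ⊆ uIcc 0 1 := fun {z} hz => by
    rw [uIcc_of_le zero_le_one]; exact uIcc_subset_Icc hm ⟨hm.1.trans hz.1, hz.2⟩
  have i1 := (h.integrable_div_mul R).mono_set (hsub hx)
  have i2 := h.integrable_div.mono_set (hsub hx)
  have i3 := h.integrable_div.mono_set (hsub (right_mem_Icc.2 hm.2))
  constructor
  · refine intervalIntegral.integral_nonneg hx.1 fun y hy => ?_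
    exact mul_nonneg (hnn y ⟨hy.1, hy.2.trans hx.2⟩) (gaussFactor_pos _ _ _).le
  · calc ∫ y in x₀..x, (y - x₀) / a y * gaussFactor x₀ R y
        ≤ ∫ y in x₀..x, (y - x₀) / a y * gaussFactor x₀ R 1 := by
          refine intervalIntegral.integral_mono_on hx.1 i1 (i2.mul_const _) fun y hy => ?_
          refine mul_le_mul_of_nonneg_left (gaussFactor_le_of_abs_le hR ?_)
            (hnn y ⟨hy.1, hy.2.trans hx.2⟩)
          rw [abs_of_nonneg (sub_nonneg.2 hy.1), abs_of_nonneg (sub_nonneg.2 hm.2)]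
          linarith [hy.2, hx.2]
      _ = (∫ y in x₀..x, (y - x₀) / a y) * gaussFactor x₀ R 1 :=
          intervalIntegral.integral_mul_const _ _
      _ ≤ (∫ y in x₀..1, (y - x₀) / a y) * gaussFactor x₀ R 1 := by
          refine mul_le_mul_of_nonneg_right ?_ (gaussFactor_pos _ _ _).le
          refine intervalIntegral.integral_mono_interval le_rfl hx.1 hx.2 ?_ i3
          filter_upwards [ae_restrict_mem measurableSet_Ioc] with y hy
          exact hnn y (Ioc_subset_Icc_self hy)
      _ ≤ (1 - x₀) ^ 2 / (a 1 * (2 - K)) * gaussFactor x₀ R 1 :=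
          mul_le_mul_of_nonneg_right h.integral_right_total_le (gaussFactor_pos _ _ _).le
      _ = _ := by rw [div_mul_eq_mul_div, mul_comm (a 1)]

theorem integral_mem_left {R : ℝ} (hR : 0 ≤ R) {x : ℝ} (hx : x ∈ Icc 0 x₀) :
    (∫ y in x₀..x, (y - x₀) / a y * gaussFactor x₀ R y) ∈
      Icc 0 (x₀ ^ 2 * gaussFactor x₀ R 0 / ((2 - K) * a 0)) := by
  have hm := Ioo_subset_Icc_self h.x₀_mem
  have hnn : ∀ y ∈ Icc 0 x₀, 0 ≤ -((y - x₀) / a y) := fun y hy => by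
    rw [neg_nonneg]
    exact div_nonpos_of_nonpos_of_nonneg (sub_nonpos.2 hy.2) (h.nonneg ⟨hy.1, hy.2.trans hm.2⟩)
  have hsub : ∀ {z}, z ∈ Icc 0 x₀ → uIcc z x₀ ⊆ uIcc 0 1 := fun {z} hz => by
    rw [uIcc_of_le zero_le_one]; exact uIcc_subset_Icc ⟨hz.1, hz.2.trans hm.2⟩ hm
  have i1 := (h.integrable_div_mul R).mono_set (hsub hx)
  have i2 := (h.integrable_div.mono_set (hsub hx)).neg
  have i3 := (h.integrable_div.mono_set (hsub (left_mem_Icc.2 hm.1))).neg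
  rw [intervalIntegral.integral_symm, ← intervalIntegral.integral_neg]
  constructor
  · refine intervalIntegral.integral_nonneg hx.2 fun y hy => ?_
    rw [← neg_mul]
    exact mul_nonneg (hnn y ⟨hx.1.trans hy.1, hy.2⟩) (gaussFactor_pos _ _ _).le
  · calc ∫ y in x..x₀, -((y - x₀) / a y * gaussFactor x₀ R y)
        ≤ ∫ y in x..x₀, -((y - x₀) / a y) * gaussFactor x₀ R 0 := by
          refine intervalIntegral.integral_mono_on hx.2 i1.neg (i2.mul_const _) fun y hy => ?_
          rw [← neg_mul]
          refine mul_le_mul_of_nonneg_left (gaussFactor_le_of_abs_le hR ?_)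
            (hnn y ⟨hx.1.trans hy.1, hy.2⟩)
          rw [abs_of_nonpos (sub_nonpos.2 hy.2), abs_of_nonpos (sub_nonpos.2 hm.1)]
          linarith [hy.1, hx.1]
      _ = (∫ y in x..x₀, -((y - x₀) / a y)) * gaussFactor x₀ R 0 :=
          intervalIntegral.integral_mul_const _ _
      _ ≤ (∫ y in 0..x₀, -((y - x₀) / a y)) * gaussFactor x₀ R 0 := by
          refine mul_le_mul_of_nonneg_right ?_ (gaussFactor_pos _ _ _).le
          refine intervalIntegral.integral_mono_interval hx.1 hx.2 le_rfl ?_ i3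
          filter_upwards [ae_restrict_mem measurableSet_Ioc] with y hy
          exact hnn y (Ioc_subset_Icc_self hy)
      _ ≤ x₀ ^ 2 / (a 0 * (2 - K)) * gaussFactor x₀ R 0 := by
          refine mul_le_mul_of_nonneg_right ?_ (gaussFactor_pos _ _ _).le
          rw [intervalIntegral.integral_neg, ← intervalIntegral.integral_symm]
          exact h.integral_left_total_le
      _ = _ := by rw [div_mul_eq_mul_div, mul_comm (a 0)]

theorem psi_locACDeriv (d c R : ℝ) : LocACDeriv x₀ (psiNonDiv a x₀ d c R)
    (fun x => d * ((x - x₀) / a x * gaussFactor x₀ R x)) := by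
  have hm := Ioo_subset_Icc_self h.x₀_mem
  have h0 := h.integrable_div_mul R
  have h1 := h0.absolutelyContinuousOnInterval_intervalIntegral (c := x₀)
    (by rwa [uIcc_of_le zero_le_one])
  have h2 : LocACDeriv x₀ (fun x => ∫ y in x₀..x, (y - x₀) / a y * gaussFactor x₀ R y)
      (fun x => (x - x₀) / a x * gaussFactor x₀ R x) := by
    refine ⟨h1.locAC h.x₀_mem, ?_⟩
    filter_upwards [ae_restrict_of_ae h0.ae_hasDerivAt_integral, ae_mem_Ioo] with x e1 e2
    refine e1 ?_ x₀ ?_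
    · rw [uIcc_of_le zero_le_one]; exact Ioo_subset_Icc_self e2
    · rwa [uIcc_of_le zero_le_one]
  have h3 : LocACDeriv x₀ (fun _ => c) (fun _ => 0) :=
    LocACDeriv.of_contDiff contDiff_const fun x => hasDerivAt_const x c
  refine ((h2.sub h3).const_mul d).congr_deriv (ae_of_all _ fun x => ?_)
  simp

theorem psi_continuousOn (d c R : ℝ) : ContinuousOn (psiNonDiv a x₀ d c R) (Icc 0 1) := by
  have hm := Ioo_subset_Icc_self h.x₀_mem
  have h1 := intervalIntegral.continuousOn_primitive_interval' (h.integrable_div_mul R)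
    (a := x₀) (by rwa [uIcc_of_le zero_le_one])
  rw [uIcc_of_le zero_le_one] at h1
  exact (h1.sub continuousOn_const).const_smul d

/-- The integral defining the weight lies between `0` and the threshold `m`, because the Gaussian
factor is largest at the end points. The strict inequality `m < c` leaves the gap `d (c - m)` below
zero. -/
theorem psi_bounds {d c R : ℝ} (hd : 0 < d) (hR : 0 ≤ R)
    (hc : max ((1 - x₀) ^ 2 * Real.exp (R * (1 - x₀) ^ 2) / ((2 - K) * a 1))
      (x₀ ^ 2 * Real.exp (R * x₀ ^ 2) / ((2 - K) * a 0)) < c) :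
    ∃ δ > 0, ∃ N > 0, ∀ x ∈ Icc (0 : ℝ) 1,
      psiNonDiv a x₀ d c R x ≤ -δ ∧ -N ≤ psiNonDiv a x₀ d c R x := by
  set m := max ((1 - x₀) ^ 2 * Real.exp (R * (1 - x₀) ^ 2) / ((2 - K) * a 1))
      (x₀ ^ 2 * Real.exp (R * x₀ ^ 2) / ((2 - K) * a 0)) with hm
  have key : ∀ x ∈ Icc (0 : ℝ) 1,
      (∫ y in x₀..x, (y - x₀) / a y * gaussFactor x₀ R y) ∈ Icc 0 m := by
    intro x hx
    rcases le_total x₀ x with hle | hle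
    · have h1 := h.integral_mem_right hR ⟨hle, hx.2⟩
      exact ⟨h1.1, h1.2.trans (le_max_left _ _)⟩
    · have h1 := h.integral_mem_left hR ⟨hx.1, hle⟩
      refine ⟨h1.1, h1.2.trans (le_trans (le_of_eq ?_) (le_max_right _ _))⟩
      simp [gaussFactor]
  refine ⟨d * (c - m), mul_pos hd (sub_pos.2 hc), d * |c| + 1, by positivity, fun x hx => ?_⟩
  have h1 := key x hx
  have e : psiNonDiv a x₀ d c R x
      = d * ((∫ y in x₀..x, (y - x₀) / a y * gaussFactor x₀ R y) - c) := rfl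
  rw [e]
  constructor
  · rw [← mul_neg]
    exact mul_le_mul_of_nonneg_left (by linarith [h1.2]) hd.le
  · have h2 : d * -|c| ≤ d * ((∫ y in x₀..x, (y - x₀) / a y * gaussFactor x₀ R y) - c) :=
      mul_le_mul_of_nonneg_left (by linarith [h1.1, le_abs_self c]) hd.le
    linarith

/-- The weights for the problem in divergence form. -/
theorem carlemanWeights_div {c₁ c₂ : ℝ} (hc₁ : 0 < c₁)
    (hc₂ : max ((1 - x₀) ^ 2 / (a 1 * (2 - K))) (x₀ ^ 2 / (a 0 * (2 - K))) < c₂) :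
    ∃ δ N : ℝ, CarlemanWeights x₀ c₁ δ N 2 a (fun _ => 1) (fun x => x - x₀)
      (fun x => (x - x₀) / a x) (fun _ => 1) (fun _ => 0) (fun x => 2 - (x - x₀) * Dx a x / a x)
      (psiDiv a x₀ c₁ c₂) (fun x => x - x₀) (fun _ => 1) := by
  -- The weight in divergence form is the case `R = 0`, where the Gaussian factor is one.
  obtain ⟨δ, hδ, N, hN, hψ⟩ := h.psi_bounds (R := 0) hc₁ le_rfl (c := c₂) (by
    simpa [mul_comm] using hc₂)
  obtain ⟨N₁, hN₁, ha⟩ := h.exists_le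
  obtain ⟨N₂, hN₂, hμ⟩ := h.exists_sq_div_le
  have hK := h.K_lt
  have hsq : ∀ x ∈ Icc (0 : ℝ) 1, (x - x₀) ^ 2 ≤ 1 := fun x hx =>
    (sq_le_one_iff_abs_le_one _).2 (abs_sub_le_one h.x₀_mem hx)
  rw [psiDiv_eq_psiNonDiv]
  refine ⟨min δ (2 - K), N + N₁ + N₂ + 1, ?_⟩
  exact
  { x₀_mem := h.x₀_mem
    d_pos := hc₁
    δ_pos := lt_min hδ (by linarith)
    A_pos := h.pos
    ρ_pos := fun _ _ _ => one_pos
    aemeasurable_A := h.locAC.aemeasurable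
    aemeasurable_ρ := aemeasurable_const
    κ_eq := fun x hx hne => by
      have := (h.pos x hx hne).ne'
      field_simp
    κ_ac := by simpa using locACDeriv_sub x₀
    γ_ac := by
      refine h.locACDeriv_div.congr_deriv (ae_of_all _ fun x => ?_)
      ring
    M_ac := LocACDeriv.of_contDiff contDiff_const fun x => hasDerivAt_const x 1
    ψ_ac := by
      refine (h.psi_locACDeriv c₁ c₂ 0).congr_deriv (ae_of_all _ fun x => ?_)
      simp [gaussFactor]
    k_ac := locACDeriv_sub x₀
    le_D := by
      filter_upwards [h.ae_quotient_le] with x hx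
      exact (min_le_right _ _).trans (by linarith)
    abs_M_le := fun _ _ _ => by rw [abs_one]; linarith
    abs_M'_le := ae_of_all _ fun _ => by rw [abs_zero]; linarith
    κγ_le := fun x hx hne => by
      have := hμ x hx hne
      calc (x - x₀) * ((x - x₀) / a x) = (x - x₀) ^ 2 / a x := by ring
        _ ≤ _ := by linarith
    A_le := fun x hx _ => by linarith [ha x hx]
    A_le_ρ := fun x hx _ => by linarith [ha x hx]
    ρA_le := fun x hx hne => by
      have h1 := ha x hx
      have h2 := h.nonneg hx
      calc 1 * a x * (x - x₀) ^ 2 ≤ 1 * a x * 1 := by gcongr; exact hsq x hx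
        _ ≤ _ := by linarith
    abs_κ_le := fun x _ _ => by
      rw [mul_one]
      exact le_mul_of_one_le_left (abs_nonneg _) (by linarith)
    ψ_le := fun x hx => (hψ x hx).1.trans (neg_le_neg (min_le_left _ _))
    le_ψ := fun x hx => le_trans (by linarith) (hψ x hx).2
    ψ_cont := h.psi_continuousOn c₁ c₂ 0 x₀ (Ioo_subset_Icc_self h.x₀_mem)
    -- Here `k = κ`, so `2 l² k X Y` is controlled by the geometric mean of `l A Y²` and `l³ (κ²/A)
    -- X²`; the term `l² k' X²` is exactly the quantity to be bounded.
    coercive := by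
      filter_upwards [ae_Icc_ne x₀] with x hx l hl X Y
      have hax := h.pos x hx.1 hx.2
      have h1 : 0 ≤ l * a x * Y ^ 2 + l ^ 3 * ((x - x₀) ^ 2 / a x) * X ^ 2 := by positivity
      have h2 : 0 ≤ l / a x * (a x * Y + l * (x - x₀) * X) ^ 2 := by positivity
      have h3 : l / a x * (a x * Y + l * (x - x₀) * X) ^ 2
          = l * a x * Y ^ 2 + l ^ 3 * ((x - x₀) ^ 2 / a x) * X ^ 2
            + 2 * l ^ 2 * (x - x₀) * X * Y := by
        field_simp
        ring
      have h4 : 0 ≤ (N + N₁ + N₂) *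
          (l * a x * Y ^ 2 + l ^ 3 * ((x - x₀) ^ 2 / a x) * X ^ 2) := by positivity
      linarith }

/-- The multiplier which yields coercivity for the problem in non divergence form. -/
theorem exists_coercive_multiplier {R : ℝ} (hR : 0 ≤ R) :
    ∃ (N : ℝ) (n : ℕ) (k k' : ℝ → ℝ), 0 < N ∧ LocACDeriv x₀ k k' ∧
      ((K < 1 ∧ ∀ x ∈ Icc (0 : ℝ) 1, x ≠ x₀ → |k x| ≤ N * |x - x₀| * (1 / a x)) ∨
        (1 ≤ K ∧ ∀ x ∈ Icc (0 : ℝ) 1, x ≠ x₀ → |k x| ≤ |x - x₀|⁻¹)) ∧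
      ∀ᵐ x ∂muI, ∀ l > 0, ∀ X Y : ℝ, l ^ 2 * (1 / a x) * X ^ 2 ≤
        N * (l * Y ^ 2 + l ^ 3 * ((x - x₀) * gaussFactor x₀ R x / a x) ^ 2 * X ^ 2)
          + l ^ n * (k' x * X ^ 2 + 2 * k x * X * Y) := by
  by_cases hK : K < 1
  · have hK' : 0 < 1 - K := by linarith
    set m : ℝ := (1 - K)⁻¹ with hm
    have hm0 : 0 < m := inv_pos.2 hK'
    -- For `K < 1` the derivative of `(x - x₀)/a` is at least `(1 - K)/a`, so the multiplier
    -- normalised by `m = 1/(1 - K)` produces `1/a` directly. Nothing is required of `v` at `x₀`,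
    -- where it need not vanish.
    refine ⟨m, 2, _, _, hm0, h.locACDeriv_div.const_mul m, Or.inl ⟨hK, fun x hx hne => ?_⟩, ?_⟩
    · rw [abs_mul, abs_of_pos hm0, abs_div, abs_of_pos (h.pos x hx hne)]
      apply le_of_eq
      ring
    · filter_upwards [ae_Icc_ne x₀, h.ae_quotient_le] with x hx hq l hl X Y
      have hax := h.pos x hx.1 hx.2
      have hE := one_le_gaussFactor hR x₀ x
      set e := gaussFactor x₀ R x
      set z := (x - x₀) / a x with hz
      have h1 : 1 / a x ≤ m * ((1 - (x - x₀) * Dx a x / a x) / a x) := by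
        rw [← mul_div_assoc]
        gcongr
        rw [hm, inv_mul_eq_div, le_div_iff₀ hK']
        linarith
      have h2 : l ^ 2 * (1 / a x) * X ^ 2
          ≤ l ^ 2 * (m * ((1 - (x - x₀) * Dx a x / a x) / a x)) * X ^ 2 := by gcongr
      have h3 : z ^ 2 ≤ ((x - x₀) * e / a x) ^ 2 := by
        have : (x - x₀) * e / a x = z * e := by rw [hz]; ring
        rw [this, mul_pow]
        exact le_mul_of_one_le_right (sq_nonneg _) (one_le_pow₀ hE)
      have h4 : m * (l ^ 3 * z ^ 2 * X ^ 2) ≤ m * (l ^ 3 * ((x - x₀) * e / a x) ^ 2 * X ^ 2) := by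
        gcongr
      have h5 : 0 ≤ m * l * (Y + l * z * X) ^ 2 := by positivity
      have h6 : m * l * (Y + l * z * X) ^ 2
          = m * (l * Y ^ 2) + m * (l ^ 3 * z ^ 2 * X ^ 2) + l ^ 2 * (2 * (m * z) * X * Y) := by ring
      linarith
  -- For `1 ≤ K` the weight `1/a` is the geometric mean of the Hardy weight `1/(x - x₀)²` and of
  -- `((x - x₀)/a)²`. They carry the powers `l` and `l³`, which explains the exponent `1` of the
  -- multiplier.
  · refine ⟨2, 1, fun x => -(x - x₀)⁻¹, fun x => 1 / (x - x₀) ^ 2, two_pos, ?_,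
      Or.inr ⟨not_lt.1 hK, fun x _ _ => by rw [abs_neg, abs_inv]⟩, ?_⟩
    · have h1 : LocAC x₀ (fun x : ℝ => (x - x₀)⁻¹) := by
        have h2 : LocAC x₀ (fun x : ℝ => ((x - x₀) * (x - x₀))⁻¹) :=
          ((locACDeriv_sub x₀).ac.mul (locACDeriv_sub x₀).ac).inv h.x₀_mem fun x _ hne =>
            mul_self_pos.2 (sub_ne_zero.2 hne)
        refine ((locACDeriv_sub x₀).ac.mul h2).congr h.x₀_mem fun x _ hne => ?_
        have := sub_ne_zero.2 hne
        field_simp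
      refine ⟨h1.neg, ?_⟩
      filter_upwards [ae_ne x₀] with x hx
      have h2 : HasDerivAt (fun x => (x - x₀)⁻¹) (-1 / (x - x₀) ^ 2) x :=
        ((hasDerivAt_id x).sub_const x₀).fun_inv (sub_ne_zero.2 hx)
      exact h2.fun_neg.congr_deriv (by ring)
    · filter_upwards [ae_Icc_ne x₀] with x hx l hl X Y
      have hax := h.pos x hx.1 hx.2
      have hE := one_le_gaussFactor hR x₀ x
      have hy : x - x₀ ≠ 0 := sub_ne_zero.2 hx.2
      set e := gaussFactor x₀ R x
      set y := x - x₀ with hyd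
      have h3 : (y / a x) ^ 2 ≤ (y * e / a x) ^ 2 := by
        have : y * e / a x = y / a x * e := by ring
        rw [this, mul_pow]
        exact le_mul_of_one_le_right (sq_nonneg _) (one_le_pow₀ hE)
      have h4 : 2 * (l ^ 3 * (y / a x) ^ 2 * X ^ 2) ≤ 2 * (l ^ 3 * (y * e / a x) ^ 2 * X ^ 2) := by
        gcongr
      -- The first square is the Hardy inequality in divergence form, the second the
      -- arithmetic-geometric mean inequality. Each leaves half of the Hardy term `l X²/y²`.
      have h5 : 0 ≤ l * (2 * (Y - X / (2 * y)) ^ 2 + 2 * (l * (y / a x) * X - X / (2 * y)) ^ 2) := by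
        positivity
      have h6 : l * (2 * (Y - X / (2 * y)) ^ 2 + 2 * (l * (y / a x) * X - X / (2 * y)) ^ 2)
          = 2 * (l * Y ^ 2) + 2 * (l ^ 3 * (y / a x) ^ 2 * X ^ 2) - 2 * (l ^ 2 * (1 / a x) * X ^ 2)
            + l * (1 / y ^ 2 * X ^ 2 + 2 * -y⁻¹ * X * Y) := by
        field_simp
        ring
      have h7 : 0 ≤ l ^ 2 * (1 / a x) * X ^ 2 := by positivity
      rw [pow_one]
      linarith

end DegenerateCoefficient

end Weights

section

variable {a : ℝ → ℝ} {x₀ K : ℝ}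

theorem locACDeriv_gaussFactor (x₀ R : ℝ) :
    LocACDeriv x₀ (gaussFactor x₀ R) (fun x => 2 * R * (x - x₀) * gaussFactor x₀ R x) :=
  LocACDeriv.of_contDiff (contDiff_gaussFactor x₀ R) (hasDerivAt_gaussFactor x₀ R)

/-- The weights for the problem in non divergence form. -/
theorem DegenerateCoefficient.carlemanWeights_nonDiv (h : DegenerateCoefficient a x₀ K)
    {Q : ℝ → ℝ} (hQ : MemW1 ⊤ Q) (hQa : (fun x => (x - x₀) * Dx a x / a x) =ᵐ[muI] Q)
    {d c R : ℝ} (hd : 0 < d) (hR : 0 ≤ R)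
    (hc : max ((1 - x₀) ^ 2 * Real.exp (R * (1 - x₀) ^ 2) / ((2 - K) * a 1))
      (x₀ ^ 2 * Real.exp (R * x₀ ^ 2) / ((2 - K) * a 0)) < c) :
    ∃ (δ N : ℝ) (n : ℕ) (M M' D k k' : ℝ → ℝ),
      CarlemanWeights x₀ d δ N n (fun _ => 1) (fun x => 1 / a x)
        (fun x => (x - x₀) * gaussFactor x₀ R x / a x) (fun x => (x - x₀) * gaussFactor x₀ R x)
        M M' D (psiNonDiv a x₀ d c R) k k' ∧ ContinuousOn M (Icc 0 1) ∧
      ((K < 1 ∧ ∀ x ∈ Icc (0 : ℝ) 1, x ≠ x₀ → |k x| ≤ N * |x - x₀| * (1 / a x)) ∨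
        (1 ≤ K ∧ ∀ x ∈ Icc (0 : ℝ) 1, x ≠ x₀ → |k x| ≤ |x - x₀|⁻¹)) := by
  obtain ⟨δ, hδ, Nψ, hNψ, hψ⟩ := h.psi_bounds hd hR hc
  obtain ⟨Na, hNa, ha⟩ := h.exists_le
  obtain ⟨Nμ, hNμ, hμ⟩ := h.exists_sq_div_le
  obtain ⟨Nk, n, k, k', hNk, hkac, hk, hcoer⟩ := h.exists_coercive_multiplier hR
  obtain ⟨L, hL, hQ'⟩ := exists_ae_abs_le hQ.2
  obtain ⟨Cq, hCq⟩ := hQ.1.exists_bound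
  rw [uIcc_of_le zero_le_one] at hCq
  have hCq0 : 0 ≤ Cq := (norm_nonneg _).trans (hCq 0 (by simp))
  have hK := h.K_lt
  have hm := Ioo_subset_Icc_self h.x₀_mem
  set e := gaussFactor x₀ R with he
  set B := Real.exp R with hB
  have hB0 : 0 < B := Real.exp_pos _
  have e0 : ∀ x, 0 < e x := gaussFactor_pos x₀ R
  have e1 : ∀ x, 1 ≤ e x := one_le_gaussFactor hR x₀
  have eB : ∀ x ∈ Icc (0 : ℝ) 1, e x ≤ B := fun x hx => gaussFactor_le hR h.x₀_mem hx
  have habs : ∀ x ∈ Icc (0 : ℝ) 1, |x - x₀| ≤ 1 := fun x hx => abs_sub_le_one h.x₀_mem hx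
  have hsq : ∀ x ∈ Icc (0 : ℝ) 1, (x - x₀) ^ 2 ≤ 1 := fun x hx =>
    (sq_le_one_iff_abs_le_one _).2 (habs x hx)
  -- From `κ = (x - x₀) e / a` one computes `κ' = (e / a) m`, so `M = κ' / ρ = e m`. Only `Q`, and
  -- not `a` itself, has to be differentiated once more.
  set m : ℝ → ℝ := fun x => 1 + 2 * R * (x - x₀) ^ 2 - Q x with hmd
  have hmb : ∀ x ∈ Icc (0 : ℝ) 1, |m x| ≤ 1 + 2 * R + Cq := by
    intro x hx
    have h1 := hCq x hx
    rw [Real.norm_eq_abs] at h1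
    have h2 : 2 * R * (x - x₀) ^ 2 ≤ 2 * R * 1 := by gcongr; exact hsq x hx
    have h3 : 0 ≤ 2 * R * (x - x₀) ^ 2 := by positivity
    rw [abs_le] at h1 ⊢
    constructor <;> simp only [hmd] <;> linarith
  have hmac : LocACDeriv x₀ m (fun x => 4 * R * (x - x₀) - Dx Q x) := by
    have h1 : LocACDeriv x₀ (fun x => 1 + 2 * R * (x - x₀) ^ 2) (fun x => 4 * R * (x - x₀)) := by
      refine LocACDeriv.of_contDiff (by fun_prop) fun x => ?_
      have h2 : HasDerivAt (fun x => 1 + 2 * R * (x - x₀) ^ 2)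
          (2 * R * (2 * (x - x₀) ^ 1 * 1)) x :=
        ((((hasDerivAt_id x).sub_const x₀).pow 2).const_mul (2 * R)).const_add 1
      exact h2.congr_deriv (by ring)
    exact h1.sub ((hQ.1.locAC h.x₀_mem).locACDeriv_Dx h.x₀_mem)
  have heac := locACDeriv_gaussFactor x₀ R
  rw [← he] at heac
  have hgac := (locACDeriv_sub x₀).mul heac
  set c₀ := 1 + 2 * R + Cq with hc₀
  have hc₀0 : 0 ≤ c₀ := by positivity
  set N := Nψ + Na + Nμ * (1 + B ^ 2) + Nk + B * c₀ + (2 * R * B * c₀ + B * (4 * R + L)) + B + 1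
    with hN
  have p1 : 0 ≤ Nμ * B ^ 2 := by positivity
  have p2 : 0 ≤ B * c₀ := by positivity
  have p3 : 0 ≤ 2 * R * B * c₀ + B * (4 * R + L) := by positivity
  refine ⟨min δ (2 - K), N, n, fun x => e x * m x,
    fun x => 2 * R * (x - x₀) * e x * m x + e x * (4 * R * (x - x₀) - Dx Q x),
    fun x => e x * (2 + 4 * R * (x - x₀) ^ 2 - Q x), k, k', ?_, ?_, ?_⟩
  · exact
    { x₀_mem := h.x₀_mem
      d_pos := hd
      δ_pos := lt_min hδ (by linarith)
      A_pos := fun _ _ _ => one_pos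
      ρ_pos := fun x hx hne => one_div_pos.2 (h.pos x hx hne)
      aemeasurable_A := aemeasurable_const
      aemeasurable_ρ := by simpa only [one_div] using h.locACDeriv_inv.ac.aemeasurable
      κ_eq := fun x _ _ => by ring
      κ_ac := by
        refine (hgac.mul h.locACDeriv_inv).congr h.x₀_mem (fun x _ _ => div_eq_mul_inv _ _) ?_
        filter_upwards [hQa, ae_Icc_ne x₀] with x h1 h2
        have h3 := (h.pos x h2.1 h2.2).ne'
        simp only [hmd]
        rw [← h1]
        field_simp
        ring
      γ_ac := by
        refine hgac.congr_deriv (ae_of_all _ fun x => ?_)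
        simp only [hmd]
        ring
      M_ac := heac.mul hmac
      ψ_ac := by
        refine (h.psi_locACDeriv d c R).congr_deriv (ae_of_all _ fun x => ?_)
        rw [← he]
        ring
      k_ac := hkac
      le_D := by
        filter_upwards [h.ae_quotient_le, hQa] with x hx hx'
        rw [hx'] at hx
        refine (min_le_right _ _).trans ?_
        have h1 : 0 ≤ 4 * R * (x - x₀) ^ 2 := by positivity
        have h2 : 2 - K ≤ 2 + 4 * R * (x - x₀) ^ 2 - Q x := by linarith
        exact h2.trans (le_mul_of_one_le_left (by linarith) (e1 x))
      abs_M_le := fun x hx _ => by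
        rw [abs_mul, abs_of_pos (e0 x)]
        calc e x * |m x| ≤ B * c₀ := by
              gcongr
              exacts [eB x hx, hmb x hx]
          _ ≤ N := by linarith
      abs_M'_le := by
        filter_upwards [hQ', ae_Icc_ne x₀] with x h1 h2
        have g0 := (e0 x).le
        have g1 : |2 * R * (x - x₀) * e x * m x| ≤ 2 * R * 1 * B * c₀ := by
          rw [abs_mul, abs_mul, abs_mul, abs_of_pos (e0 x), abs_of_nonneg (by positivity : 0 ≤ 2 * R)]
          gcongr
          exacts [habs x h2.1, eB x h2.1, hmb x h2.1]
        have g2 : |e x * (4 * R * (x - x₀) - Dx Q x)| ≤ B * (4 * R + L) := by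
          rw [abs_mul, abs_of_pos (e0 x)]
          have g3 : |4 * R * (x - x₀)| ≤ 4 * R * 1 := by
            rw [abs_mul, abs_of_nonneg (by positivity : 0 ≤ 4 * R)]
            gcongr
            exact habs x h2.1
          have g4 := abs_sub (4 * R * (x - x₀)) (Dx Q x)
          gcongr
          · exact eB x h2.1
          · linarith
        have g5 := abs_add_le (2 * R * (x - x₀) * e x * m x) (e x * (4 * R * (x - x₀) - Dx Q x))
        have g6 : 2 * R * 1 * B * c₀ + B * (4 * R + L) ≤ N := by linarith
        linarith
      κγ_le := fun x hx hne => by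
        have h1 := hμ x hx hne
        have h2 := eB x hx
        have h3 := e0 x
        have h4 := h.pos x hx hne
        calc (x - x₀) * e x / a x * ((x - x₀) * e x) = (x - x₀) ^ 2 / a x * e x ^ 2 := by ring
          _ ≤ Nμ * B ^ 2 := by gcongr
          _ ≤ N := by linarith
      A_le := fun _ _ _ => by linarith
      A_le_ρ := fun x hx hne => by
        rw [mul_one_div, le_div_iff₀ (h.pos x hx hne)]
        linarith [ha x hx]
      ρA_le := fun x hx hne => by
        calc 1 / a x * 1 * (x - x₀) ^ 2 = (x - x₀) ^ 2 / a x := by ring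
          _ ≤ Nμ := hμ x hx hne
          _ ≤ N := by linarith
      abs_κ_le := fun x hx hne => by
        have h4 := h.pos x hx hne
        rw [abs_div, abs_mul, abs_of_pos h4, abs_of_pos (e0 x), mul_one_div]
        refine div_le_div_of_nonneg_right ?_ h4.le
        rw [mul_comm N]
        exact mul_le_mul_of_nonneg_left (by linarith [eB x hx]) (abs_nonneg _)
      ψ_le := fun x hx => (hψ x hx).1.trans (neg_le_neg (min_le_left _ _))
      le_ψ := fun x hx => le_trans (by linarith) (hψ x hx).2
      ψ_cont := h.psi_continuousOn d c R x₀ hm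
      coercive := by
        filter_upwards [hcoer, ae_Icc_ne x₀] with x h1 h2 l hl X Y
        refine (h1 l hl X Y).trans ?_
        have h3 : 0 ≤ l * Y ^ 2 + l ^ 3 * ((x - x₀) * gaussFactor x₀ R x / a x) ^ 2 * X ^ 2 := by
          positivity
        have h4 : Nk * (l * Y ^ 2 + l ^ 3 * ((x - x₀) * gaussFactor x₀ R x / a x) ^ 2 * X ^ 2)
            ≤ N * (l * Y ^ 2 + l ^ 3 * ((x - x₀) * gaussFactor x₀ R x / a x) ^ 2 * X ^ 2) :=
          mul_le_mul_of_nonneg_right (by linarith) h3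
        rw [mul_one, div_one]
        linarith }
  · have h1 : ContinuousOn Q (Icc 0 1) := by
      have := hQ.1.continuousOn
      rwa [uIcc_of_le zero_le_one] at this
    refine (contDiff_gaussFactor x₀ R).continuous.continuousOn.mul (ContinuousOn.sub ?_ h1)
    fun_prop
  · refine hk.imp (fun hk => ⟨hk.1, fun x hx hne => (hk.2 x hx hne).trans ?_⟩) id
    have h4 := h.pos x hx hne
    gcongr
    linarith

end

/-! ### Regularity of the time slices of a solution -/

section Slices

variable {a : ℝ → ℝ} {x₀ K : ℝ}

/-- A function whose derivative has a representative which is continuous away from `x₀` is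
continuously differentiable there. -/
theorem LocACDeriv.hasDerivWithinAt {u u' q : ℝ → ℝ} (hx₀ : x₀ ∈ Ioo (0 : ℝ) 1)
    (hu : LocACDeriv x₀ u u') (hq : LocAC x₀ q) (hqu : u' =ᵐ[muI] q) {x : ℝ}
    (hx : x ∈ Icc (0 : ℝ) 1) (hne : x ≠ x₀) : HasDerivWithinAt u (q x) (Icc 0 1) x := by
  have key : ∀ y z : ℝ, 0 ≤ y → z ≤ 1 → ∀ hyz : y ≤ z, x ∈ Icc y z → Icc y z ∈ 𝓝[Icc 0 1] x →
      AbsolutelyContinuousOnInterval u y z → AbsolutelyContinuousOnInterval q y z →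
      HasDerivWithinAt u (q x) (Icc 0 1) x := by
    intro y z hy hz hyz hxm hnhds huac hqac
    have hqc := hqac.continuousOn
    rw [uIcc_of_le hyz] at hqc
    -- Extending the restriction of `q` continuously to the line makes the fundamental theorem of
    -- calculus available up to the end points of `[0,1]`.
    set f := IccExtend hyz ((Icc y z).domRestrict q) with hf
    have hfc : Continuous f := (continuousOn_iff_continuous_domRestrict.1 hqc).Icc_extend'
    have hfq : ∀ ξ ∈ Icc y z, f ξ = q ξ := fun ξ hξ => by
      rw [hf, IccExtend_of_mem hyz _ hξ]; rfl
    have h1 : HasDerivAt (fun w => u x + ∫ ξ in x..w, f ξ) (q x) x := by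
      rw [← hfq x hxm]
      exact (hfc.integral_hasStrictDerivAt x x).hasDerivAt.const_add _
    have h2 : ∀ w ∈ Icc y z, u w = u x + ∫ ξ in x..w, f ξ := by
      intro w hw
      have h3 : AbsolutelyContinuousOnInterval u x w :=
        huac.mono (by rw [uIcc_of_le hyz]; exact uIcc_subset_Icc hxm hw)
      rw [← sub_eq_iff_eq_add', ← h3.integral_deriv_eq_sub]
      refine intervalIntegral.integral_congr_ae_restrict ?_
      have hsub : uIoc x w ⊆ Ioc 0 1 := by
        intro ξ hξ
        rw [uIoc, mem_Ioc] at hξ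
        exact ⟨(hy.trans (le_min hxm.1 hw.1)).trans_lt hξ.1,
          (hξ.2.trans (max_le hxm.2 hw.2)).trans hz⟩
      have hd := hu.deriv
      rw [EventuallyEq, muI, restrict_Ioo_eq_restrict_Ioc] at hqu
      rw [muI, restrict_Ioo_eq_restrict_Ioc] at hd
      filter_upwards [ae_restrict_of_ae_restrict_of_subset hsub hd,
        ae_restrict_of_ae_restrict_of_subset hsub hqu, ae_restrict_mem measurableSet_uIoc]
        with ξ e1 e2 e3
      rw [e1.deriv, e2, hfq]
      exact uIcc_subset_Icc hxm hw (uIoc_subset_uIcc e3)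
    exact (h1.hasDerivWithinAt.congr h2 (h2 x hxm)).mono_of_mem_nhdsWithin hnhds
  rcases lt_or_gt_of_ne hne with hlt | hgt
  · obtain ⟨y, hy, hy'⟩ := exists_between hlt
    have hym : y ∈ Ioo 0 x₀ := ⟨hx.1.trans_lt hy, hy'⟩
    refine key 0 y le_rfl (hy'.trans hx₀.2).le hym.1.le ⟨hx.1, hy.le⟩ ?_ (hu.ac.1 y hym)
      (hq.1 y hym)
    filter_upwards [self_mem_nhdsWithin, nhdsWithin_le_nhds (Iio_mem_nhds hy)] with z hz hz'
    exact ⟨hz.1, le_of_lt hz'⟩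
  · obtain ⟨y, hy, hy'⟩ := exists_between hgt
    have hym : y ∈ Ioo x₀ 1 := ⟨hy, hy'.trans_le hx.2⟩
    refine key y 1 (hx₀.1.trans hy).le le_rfl hym.2.le ⟨hy'.le, hx.2⟩ ?_ (hu.ac.2 y hym)
      (hq.2 y hym)
    filter_upwards [self_mem_nhdsWithin, nhdsWithin_le_nhds (Ioi_mem_nhds hy')] with z hz hz'
    exact ⟨le_of_lt hz', hz.2⟩

theorem Dx_eq_of_hasDerivWithinAt {u : ℝ → ℝ} {x l : ℝ} (h : HasDerivWithinAt u l (Icc 0 1) x)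
    (hx : x ∈ Icc (0 : ℝ) 1) : Dx u x = l :=
  h.derivWithin (uniqueDiffOn_Icc zero_lt_one x hx)

/-- Functions in `H¹` are Hölder continuous with exponent `1/2`. -/
theorem MemW1.exists_sq_sub_le {f : ℝ → ℝ} (hf : MemW1 2 f) :
    ∃ C > 0, ∀ x ∈ Icc (0 : ℝ) 1, ∀ y ∈ Icc (0 : ℝ) 1, (f x - f y) ^ 2 ≤ C * |x - y| := by
  have hsq : Integrable (fun x => Dx f x ^ 2) muI := hf.2.integrable_sq
  set C := ∫ x, Dx f x ^ 2 ∂muI with hC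
  have hC0 : 0 ≤ C := integral_nonneg fun x => sq_nonneg _
  have key : ∀ x ∈ Icc (0 : ℝ) 1, ∀ y ∈ Icc (0 : ℝ) 1, x < y →
      (f y - f x) ^ 2 ≤ (C + 1) * (y - x) := by
    intro x hx y hy hxy
    have hpos : 0 < y - x := sub_pos.2 hxy
    have hac : AbsolutelyContinuousOnInterval f x y :=
      hf.1.mono (by rw [uIcc_of_le zero_le_one]; exact uIcc_subset_Icc hx hy)
    have hd : ∀ᵐ z ∂volume.restrict (Ioo x y), HasDerivAt f (Dx f z) z := by
      have h1 : LocACDeriv (1 / 2) f (Dx f) :=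
        (hf.1.locAC (x₀ := 1 / 2) (by norm_num)).locACDeriv_Dx (by norm_num)
      exact ae_restrict_of_ae_restrict_of_subset (Ioo_subset_Ioo hx.1 hy.2) h1.deriv
    have h1 := hac.integral_eq_sub_of_hasDerivAt hxy.le hd
    have i1 := hac.intervalIntegrable_of_hasDerivAt hxy.le hd
    have i2 := hsq.intervalIntegrable_of_muI hx hy
    -- With `m` the mean slope, `0 ≤ ∫ (f' - m)²` is the Cauchy–Schwarz inequality for `∫ f'`.
    set m := (f y - f x) / (y - x) with hm
    have h2 : 0 ≤ ∫ z in x..y, (Dx f z - m) ^ 2 :=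
      intervalIntegral.integral_nonneg hxy.le fun z _ => sq_nonneg _
    have h3 : ∫ z in x..y, (Dx f z - m) ^ 2
        = (∫ z in x..y, Dx f z ^ 2) - 2 * m * (f y - f x) + m ^ 2 * (y - x) := by
      have e : ∀ z, (Dx f z - m) ^ 2 = Dx f z ^ 2 - 2 * m * Dx f z + m ^ 2 := fun z => by ring
      simp only [e]
      rw [intervalIntegral.integral_add (i2.sub (i1.const_mul _)) (by simp),
        intervalIntegral.integral_sub i2 (i1.const_mul _), intervalIntegral.integral_const_mul,
        h1, intervalIntegral.integral_const, smul_eq_mul]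
      ring
    have h4 : ∫ z in x..y, Dx f z ^ 2 ≤ C := by
      rw [hC, LocACDeriv.integral_muI]
      exact intervalIntegral.integral_mono_interval hx.1 hxy.le hy.2
        (ae_of_all _ fun z => sq_nonneg _)
        (hsq.intervalIntegrable_of_muI (by simp) (by simp))
    have h5 : f y - f x = m * (y - x) := by rw [hm]; field_simp
    have h6 : 0 ≤ C - m ^ 2 * (y - x) := by
      rw [h3, h5] at h2
      linarith
    rw [h5]
    nlinarith
  refine ⟨C + 1, by positivity, fun x hx y hy => ?_⟩
  rcases lt_trichotomy x y with hxy | hxy | hxy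
  · rw [abs_sub_comm, abs_of_pos (sub_pos.2 hxy), ← neg_sub, neg_sq]
    exact key x hx y hy hxy
  · rw [hxy]; simp
  · rw [abs_of_pos (sub_pos.2 hxy)]
    exact key y hy x hx hxy

/-- Integrability of the energy density provides one sequence on each side along which `|x - x₀|`
times the density vanishes. The limits in `key` are the same for both sides, as the cancellation at
`x₀` requires. -/
theorem exists_trace {A ρ M k v w p G : ℝ → ℝ} (hx₀ : x₀ ∈ Ioo (0 : ℝ) 1)
    (hA : ∀ x ∈ Icc (0 : ℝ) 1, x ≠ x₀ → 0 < A x) (hρ : ∀ x ∈ Icc (0 : ℝ) 1, x ≠ x₀ → 0 < ρ x)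
    (hi : Integrable (fun x => ρ x * v x ^ 2 + ρ x * w x ^ 2 + A x * p x ^ 2) muI)
    {ℓ₁ ℓ₂ ℓ₃ : ℝ}
    (key : ∀ zs : ℕ → ℝ, (∀ n, zs n ∈ Icc (0 : ℝ) 1 ∧ zs n ≠ x₀) → Tendsto zs atTop (𝓝 x₀) →
      Tendsto (fun n => |zs n - x₀| * (ρ (zs n) * v (zs n) ^ 2 + ρ (zs n) * w (zs n) ^ 2
        + A (zs n) * p (zs n) ^ 2)) atTop (𝓝 0) →
      Tendsto (fun n => k (zs n) * v (zs n) ^ 2) atTop (𝓝 0) ∧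
      Tendsto (fun n => G (zs n) * v (zs n)) atTop (𝓝 ℓ₁) ∧
      Tendsto (fun n => G (zs n) * w (zs n)) atTop (𝓝 ℓ₂) ∧
      Tendsto (fun n => M (zs n) * G (zs n) * v (zs n)) atTop (𝓝 ℓ₃)) :
    ∃ xs ys : ℕ → ℝ, (∀ n, xs n ∈ Ioo x₀ 1) ∧ (∀ n, ys n ∈ Ioo 0 x₀) ∧
    ∃ ℓ₁ ℓ₂ ℓ₃, TraceSeq x₀ A ρ M k v w p G ℓ₁ ℓ₂ ℓ₃ xs ∧
      TraceSeq x₀ A ρ M k v w p G ℓ₁ ℓ₂ ℓ₃ ys := by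
  have hm := Ioo_subset_Icc_self hx₀
  have hnn : ∀ x ∈ Icc (0 : ℝ) 1, x ≠ x₀ →
      0 ≤ ρ x * v x ^ 2 + ρ x * w x ^ 2 + A x * p x ^ 2 := fun x hx hne => by
    have h1 := hA x hx hne
    have h2 := hρ x hx hne
    positivity
  have mr : ∀ x ∈ Ioo x₀ 1, x ∈ Icc (0 : ℝ) 1 ∧ x ≠ x₀ := fun x hx =>
    ⟨⟨(hx₀.1.trans hx.1).le, hx.2.le⟩, hx.1.ne'⟩
  have ml : ∀ x ∈ Ioo 0 x₀, x ∈ Icc (0 : ℝ) 1 ∧ x ≠ x₀ := fun x hx =>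
    ⟨⟨hx.1.le, (hx.2.trans hx₀.2).le⟩, hx.2.ne⟩
  obtain ⟨xs, hxs, hxs', hxe⟩ := exists_seq_right hx₀.2
    (fun x hx => hnn x (mr x hx).1 (mr x hx).2) (hi.intervalIntegrable_of_muI hm (by simp))
  obtain ⟨ys, hys, hys', hye⟩ := exists_seq_left hx₀.1
    (fun x hx => hnn x (ml x hx).1 (ml x hx).2) (hi.intervalIntegrable_of_muI (by simp) hm)
  obtain ⟨a1, a2, a3, a4⟩ := key xs (fun n => mr _ (hxs n)) hxs' hxe
  obtain ⟨b1, b2, b3, b4⟩ := key ys (fun n => ml _ (hys n)) hys' hye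
  exact ⟨xs, ys, hxs, hys, ℓ₁, ℓ₂, ℓ₃, ⟨hxs', hxe, a1, a2, a3, a4⟩, ⟨hys', hye, b1, b2, b3, b4⟩⟩

theorem _root_.AbsolutelyContinuousOnInterval.tendsto_seq {f : ℝ → ℝ}
    (hf : AbsolutelyContinuousOnInterval f 0 1) (hx₀ : x₀ ∈ Ioo (0 : ℝ) 1) {zs : ℕ → ℝ}
    (hzs : ∀ n, zs n ∈ Icc (0 : ℝ) 1) (h : Tendsto zs atTop (𝓝 x₀)) :
    Tendsto (fun n => f (zs n)) atTop (𝓝 (f x₀)) := by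
  have h1 := hf.continuousOn
  rw [uIcc_of_le zero_le_one] at h1
  exact (h1 x₀ (Ioo_subset_Icc_self hx₀)).tendsto.comp
    (tendsto_nhdsWithin_iff.2 ⟨h, Eventually.of_forall hzs⟩)

theorem MemH1a.locAC {u : ℝ → ℝ} (hu : MemH1a a x₀ K u) (hx₀ : x₀ ∈ Ioo (0 : ℝ) 1) :
    LocAC x₀ u := by
  rcases lt_or_ge K 1 with hK | hK
  · exact (hu.1 hK).locAC hx₀
  · exact (hu.2.1 hK).2

theorem MemH1a.memLp {u : ℝ → ℝ} (hu : MemH1a a x₀ K u) (hx₀ : x₀ ∈ Ioo (0 : ℝ) 1) :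
    MemLp u 2 muI := by
  rcases lt_or_ge K 1 with hK | hK
  · obtain ⟨C, hC⟩ := (hu.1 hK).exists_bound
    rw [uIcc_of_le zero_le_one] at hC
    refine MemLp.of_bound (hu.locAC hx₀).aemeasurable.aestronglyMeasurable C ?_
    filter_upwards [ae_mem_Ioo] with x hx using hC x (Ioo_subset_Icc_self hx)
  · exact (hu.2.1 hK).1

/-- An element of `𝓗²_a` is continuously differentiable away from `x₀`. -/
theorem MemH2a.exists_flux {u : ℝ → ℝ} (h : DegenerateCoefficient a x₀ K)
    (hu : MemH2a a x₀ K u) : ∃ F : ℝ → ℝ, MemW1 2 F ∧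
      (∀ x ∈ Icc (0 : ℝ) 1, x ≠ x₀ → DifferentiableWithinAt ℝ u (Icc 0 1) x) ∧
      ∀ x ∈ Icc (0 : ℝ) 1, x ≠ x₀ → a x * Dx u x = F x := by
  obtain ⟨F, hF, hFu⟩ := hu.2
  have hd : ∀ x ∈ Icc (0 : ℝ) 1, x ≠ x₀ →
      HasDerivWithinAt u (F x * (a x)⁻¹) (Icc 0 1) x := by
    intro x hx hne
    refine ((hu.1.locAC h.x₀_mem).locACDeriv_Dx h.x₀_mem).hasDerivWithinAt h.x₀_mem
      ((hF.1.locAC h.x₀_mem).mul h.locACDeriv_inv.ac) ?_ hx hne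
    filter_upwards [hFu, ae_Icc_ne x₀] with y h1 h2
    have h3 := (h.pos y h2.1 h2.2).ne'
    rw [← h1]
    field_simp
  refine ⟨F, hF, fun x hx hne => (hd x hx hne).differentiableWithinAt, fun x hx hne => ?_⟩
  have h3 := (h.pos x hx hne).ne'
  rw [Dx_eq_of_hasDerivWithinAt (hd x hx hne) hx]
  field_simp

/-- The point at issue is the trace at `x₀`. For `K < 1` the flux `a u'` and the functions `u`, `w`
have continuous representatives. For `1 ≤ K`, `u` and `w` may be unbounded at `x₀`, but the flux
vanishes there fast enough to make the products tend to zero. -/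
theorem MemH2a.sliceRegular {u w : ℝ → ℝ} (h : DegenerateCoefficient a x₀ K)
    (hu : MemH2a a x₀ K u) (hw : MemH1a a x₀ K w) :
    SliceRegular x₀ a (fun _ => 1) (fun _ => 1) (fun x => x - x₀) u w (Dx u) (Dx w)
      (fun x => a x * Dx u x) (Dx fun x => a x * Dx u x) := by
  obtain ⟨F, hF, -, hFu⟩ := hu.exists_flux h
  have hx₀ := h.x₀_mem
  have hm := Ioo_subset_Icc_self hx₀
  have hGac : LocAC x₀ (fun x => a x * Dx u x) := (hF.1.locAC hx₀).congr hx₀ hFu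
  refine ⟨(hu.1.locAC hx₀).locACDeriv_Dx hx₀, (hw.locAC hx₀).locACDeriv_Dx hx₀,
    hGac.locACDeriv_Dx hx₀, fun _ _ _ => rfl, hu.1.2.2.2.1, hu.1.2.2.2.2, hw.2.2.2.1,
    hw.2.2.2.2, ?_⟩
  have hi : Integrable (fun x => 1 * u x ^ 2 + 1 * w x ^ 2 + a x * Dx u x ^ 2) muI := by
    have h1 := (hu.1.memLp hx₀).integrable_sq
    have h2 := (hw.memLp hx₀).integrable_sq
    have h3 := hu.1.2.2.1.integrable_sq
    refine ((h1.add h2).add h3).congr ?_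
    filter_upwards [ae_Icc_ne x₀] with x hx
    simp only [Pi.add_apply]
    rw [mul_pow, Real.sq_sqrt (h.pos x hx.1 hx.2).le]
    ring
  have hlim : ∃ ℓ₁ ℓ₂ : ℝ, ∀ zs : ℕ → ℝ, (∀ n, zs n ∈ Icc (0 : ℝ) 1 ∧ zs n ≠ x₀) →
      Tendsto zs atTop (𝓝 x₀) →
      Tendsto (fun n => |zs n - x₀| * (1 * u (zs n) ^ 2 + 1 * w (zs n) ^ 2
        + a (zs n) * Dx u (zs n) ^ 2)) atTop (𝓝 0) →
      Tendsto (fun n => F (zs n) * u (zs n)) atTop (𝓝 ℓ₁) ∧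
      Tendsto (fun n => F (zs n) * w (zs n)) atTop (𝓝 ℓ₂) := by
    rcases lt_or_ge K 1 with hK | hK
    · exact ⟨F x₀ * u x₀, F x₀ * w x₀, fun zs hzs hzs' _ =>
        ⟨(hF.1.tendsto_seq hx₀ (fun n => (hzs n).1) hzs').mul
          ((hu.1.1 hK).tendsto_seq hx₀ (fun n => (hzs n).1) hzs'),
        (hF.1.tendsto_seq hx₀ (fun n => (hzs n).1) hzs').mul
          ((hw.1 hK).tendsto_seq hx₀ (fun n => (hzs n).1) hzs')⟩⟩
    · obtain ⟨L, hL, ha⟩ := h.lipschitz hK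
      obtain ⟨C, hC, hFC⟩ := hF.exists_sq_sub_le
      refine ⟨0, 0, fun zs hzs hzs' he => ?_⟩
      -- From `a ≤ L |x - x₀|` one gets `F² = a (a u'²) ≤ L |x - x₀| a u'²`, which tends to zero
      -- along the sequence.
      have hF0 : F x₀ = 0 := by
        have h1 : Tendsto (fun n => F (zs n) ^ 2) atTop (𝓝 0) := by
          refine squeeze_zero (fun n => sq_nonneg _) (fun n => ?_)
            (by simpa using he.const_mul L)
          have hp := h.pos _ (hzs n).1 (hzs n).2
          rw [← hFu _ (hzs n).1 (hzs n).2]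
          have h2 : 0 ≤ L * |zs n - x₀| * (1 * u (zs n) ^ 2 + 1 * w (zs n) ^ 2) := by positivity
          calc (a (zs n) * Dx u (zs n)) ^ 2 = a (zs n) * (a (zs n) * Dx u (zs n) ^ 2) := by ring
            _ ≤ L * |zs n - x₀| * (a (zs n) * Dx u (zs n) ^ 2) := by
              gcongr
              exact ha _ (hzs n).1
            _ ≤ _ := by linarith
        have h2 := (hF.1.tendsto_seq hx₀ (fun n => (hzs n).1) hzs').pow 2
        exact pow_eq_zero_iff (two_ne_zero) |>.1 (tendsto_nhds_unique h2 h1)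
      -- Since `F x₀ = 0`, Hölder continuity gives `F² ≤ C |x - x₀|`, and `|x - x₀| f²` tends to
      -- zero along the sequence.
      have hsmall : ∀ f : ℝ → ℝ, (∀ n, f (zs n) ^ 2 ≤ 1 * u (zs n) ^ 2 + 1 * w (zs n) ^ 2
          + a (zs n) * Dx u (zs n) ^ 2) →
          Tendsto (fun n => F (zs n) * f (zs n)) atTop (𝓝 0) := by
        intro f hf
        have h1 : Tendsto (fun n => (F (zs n) * f (zs n)) ^ 2) atTop (𝓝 0) := by
          have hC' := he.const_mul C
          rw [mul_zero] at hC'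
          refine squeeze_zero (fun n => sq_nonneg _) (fun n => ?_) hC'
          have h2 := hFC _ (hzs n).1 _ hm
          rw [hF0, sub_zero] at h2
          rw [mul_pow, ← mul_assoc]
          exact mul_le_mul h2 (hf n) (sq_nonneg _) (by positivity)
        have h3 := h1.sqrt
        simp only [Real.sqrt_sq_eq_abs, Real.sqrt_zero] at h3
        exact tendsto_zero_iff_abs_tendsto_zero _ |>.2 h3
      have hp : ∀ n, 0 ≤ a (zs n) * Dx u (zs n) ^ 2 := fun n => by
        have := h.pos _ (hzs n).1 (hzs n).2
        positivity
      exact ⟨hsmall u fun n => by linarith [hp n, sq_nonneg (w (zs n))],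
        hsmall w fun n => by linarith [hp n, sq_nonneg (u (zs n))]⟩
  obtain ⟨ℓ₁, ℓ₂, hlim⟩ := hlim
  refine exists_trace hx₀ h.pos (fun _ _ _ => one_pos) hi (ℓ₁ := ℓ₁) (ℓ₂ := ℓ₂) (ℓ₃ := ℓ₁)
    fun zs hzs hzs' he => ?_
  obtain ⟨l1, l2⟩ := hlim zs hzs hzs' he
  have hG : ∀ n, a (zs n) * Dx u (zs n) = F (zs n) := fun n => hFu _ (hzs n).1 (hzs n).2
  simp only [hG, one_mul]
  refine ⟨?_, l1, l2, l1⟩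
  rw [tendsto_zero_iff_abs_tendsto_zero]
  refine squeeze_zero (fun n => abs_nonneg _) (fun n => ?_) he
  have hp := h.pos _ (hzs n).1 (hzs n).2
  simp only [Function.comp_apply]
  rw [abs_mul, abs_of_nonneg (sq_nonneg (u (zs n)))]
  gcongr
  have : 0 ≤ a (zs n) * Dx u (zs n) ^ 2 := by positivity
  linarith [sq_nonneg (w (zs n))]

theorem MemH2inv.exists_flux {u : ℝ → ℝ} (hx₀ : x₀ ∈ Ioo (0 : ℝ) 1)
    (hu : MemH2inv a u) : ∃ F : ℝ → ℝ, MemW1 2 F ∧ Dx u =ᵐ[muI] F ∧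
      (∀ x ∈ Icc (0 : ℝ) 1, x ≠ x₀ → DifferentiableWithinAt ℝ u (Icc 0 1) x) ∧
      ∀ x ∈ Icc (0 : ℝ) 1, x ≠ x₀ → Dx u x = F x := by
  obtain ⟨F, hF, hFu⟩ := hu.2
  have hd : ∀ x ∈ Icc (0 : ℝ) 1, x ≠ x₀ → HasDerivWithinAt u (F x) (Icc 0 1) x :=
    fun x hx hne => ((hu.1.1.1.locAC hx₀).locACDeriv_Dx hx₀).hasDerivWithinAt hx₀
      (hF.1.locAC hx₀) hFu hx hne
  exact ⟨F, hF, hFu, fun x hx hne => (hd x hx hne).differentiableWithinAt,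
    fun x hx hne => Dx_eq_of_hasDerivWithinAt (hd x hx hne) hx⟩

/-- The representatives of `u'`, and `u`, `w` and `M` themselves, are continuous at `x₀`, so the
products with the flux have limits. Only `k u²` requires an argument. -/
theorem MemH2inv.sliceRegular {u w M k : ℝ → ℝ} {N : ℝ} (h : DegenerateCoefficient a x₀ K)
    (hu : MemH2inv a u) (hw : MemH1inv a w) (hM : ContinuousOn M (Icc 0 1))
    (hk : (K < 1 ∧ ∀ x ∈ Icc (0 : ℝ) 1, x ≠ x₀ → |k x| ≤ N * |x - x₀| * (1 / a x)) ∨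
      (1 ≤ K ∧ ∀ x ∈ Icc (0 : ℝ) 1, x ≠ x₀ → |k x| ≤ |x - x₀|⁻¹)) :
    SliceRegular x₀ (fun _ => 1) (fun x => 1 / a x) M k u w (Dx u) (Dx w)
      (Dx u) (Dx (Dx u)) := by
  obtain ⟨F, hF, hFu', -, hFu⟩ := hu.exists_flux h.x₀_mem
  have hx₀ := h.x₀_mem
  have hm := Ioo_subset_Icc_self hx₀
  have hGac : LocAC x₀ (Dx u) := (hF.1.locAC hx₀).congr hx₀ hFu
  refine ⟨(hu.1.1.1.locAC hx₀).locACDeriv_Dx hx₀, (hw.1.1.locAC hx₀).locACDeriv_Dx hx₀,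
    hGac.locACDeriv_Dx hx₀, fun _ _ _ => (one_mul _).symm, hu.1.2.1, hu.1.2.2.1, hw.2.1,
    hw.2.2.1, ?_⟩
  have hi : Integrable (fun x => 1 / a x * u x ^ 2 + 1 / a x * w x ^ 2 + 1 * Dx u x ^ 2) muI := by
    have h1 := hu.1.2.2.2.integrable_sq
    have h2 := hw.2.2.2.integrable_sq
    have h3 := hu.1.1.2.integrable_sq
    refine ((h1.add h2).add h3).congr ?_
    filter_upwards [ae_Icc_ne x₀] with x hx
    simp only [Pi.add_apply]
    rw [div_pow, div_pow, Real.sq_sqrt (h.pos x hx.1 hx.2).le]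
    ring
  refine exists_trace hx₀ (fun _ _ _ => one_pos) (fun x hx hne => one_div_pos.2 (h.pos x hx hne))
    hi (ℓ₁ := F x₀ * u x₀) (ℓ₂ := F x₀ * w x₀) (ℓ₃ := M x₀ * F x₀ * u x₀)
    fun zs hzs hzs' he => ?_
  have hG : ∀ n, Dx u (zs n) = F (zs n) := fun n => hFu _ (hzs n).1 (hzs n).2
  have lF := hF.1.tendsto_seq hx₀ (fun n => (hzs n).1) hzs'
  have lu := hu.1.1.1.tendsto_seq hx₀ (fun n => (hzs n).1) hzs'
  have lw := hw.1.1.tendsto_seq hx₀ (fun n => (hzs n).1) hzs'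
  have lM := (hM x₀ hm).tendsto.comp
    (tendsto_nhdsWithin_iff.2 ⟨hzs', Eventually.of_forall fun n => (hzs n).1⟩)
  have hle : ∀ n, |zs n - x₀| * (1 / a (zs n) * u (zs n) ^ 2) ≤ |zs n - x₀| *
      (1 / a (zs n) * u (zs n) ^ 2 + 1 / a (zs n) * w (zs n) ^ 2 + 1 * Dx u (zs n) ^ 2) := by
    intro n
    have hp := h.pos _ (hzs n).1 (hzs n).2
    gcongr
    have h1 : 0 ≤ 1 / a (zs n) * w (zs n) ^ 2 := by positivity
    linarith [sq_nonneg (Dx u (zs n))]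
  have he' : Tendsto (fun n => |zs n - x₀| * (1 / a (zs n) * u (zs n) ^ 2)) atTop (𝓝 0) :=
    squeeze_zero (fun n => by have hp := h.pos _ (hzs n).1 (hzs n).2; positivity) hle he
  refine ⟨?_, ?_, ?_, ?_⟩
  · rw [tendsto_zero_iff_abs_tendsto_zero]
    rcases hk with ⟨-, hk⟩ | ⟨hK, hk⟩
    · refine squeeze_zero (fun n => abs_nonneg _) (fun n => ?_) (by simpa using he'.const_mul N)
      simp only [Function.comp_apply]
      rw [abs_mul, abs_of_nonneg (sq_nonneg (u (zs n)))]
      calc |k (zs n)| * u (zs n) ^ 2 ≤ N * |zs n - x₀| * (1 / a (zs n)) * u (zs n) ^ 2 :=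
            mul_le_mul_of_nonneg_right (hk _ (hzs n).1 (hzs n).2) (sq_nonneg _)
        _ = _ := by ring
    -- Here `u² = a (u²/a) ≤ L |x - x₀| u²/a` tends to zero, hence `u x₀ = 0`. As `u'` is bounded,
    -- `u² / |x - x₀|` is at most a multiple of `|x - x₀|`.
    · obtain ⟨L, hL, ha⟩ := h.lipschitz hK
      have hu0 : u x₀ = 0 := by
        have h1 : Tendsto (fun n => u (zs n) ^ 2) atTop (𝓝 0) := by
          refine squeeze_zero (fun n => sq_nonneg _) (fun n => ?_)
            (by simpa using he'.const_mul L)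
          have hp := h.pos _ (hzs n).1 (hzs n).2
          calc u (zs n) ^ 2 = a (zs n) * (1 / a (zs n) * u (zs n) ^ 2) := by field_simp
            _ ≤ L * |zs n - x₀| * (1 / a (zs n) * u (zs n) ^ 2) := by
              gcongr
              exact ha _ (hzs n).1
            _ = _ := by ring
        exact pow_eq_zero_iff two_ne_zero |>.1 (tendsto_nhds_unique (lu.pow 2) h1)
      obtain ⟨B, hB⟩ := hF.1.exists_bound
      rw [uIcc_of_le zero_le_one] at hB
      have hLip : ∀ x ∈ Icc (0 : ℝ) 1, |u x| ≤ B * |x - x₀| := fun x hx => by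
        have := hu.1.1.1.abs_sub_le_of_ae_abs_Dx_le (L := B) (by
          filter_upwards [hFu', ae_mem_Ioo] with y h1 h2
          rw [h1]
          exact hB y (Ioo_subset_Icc_self h2)) hx hm
        rwa [hu0, sub_zero] at this
      have l0 : Tendsto (fun n => B ^ 2 * |zs n - x₀|) atTop (𝓝 0) := by
        have h1 := ((hzs'.sub_const x₀).abs).const_mul (B ^ 2)
        simpa using h1
      refine squeeze_zero (fun n => abs_nonneg _) (fun n => ?_) l0
      have hpos : 0 < |zs n - x₀| := abs_pos.2 (sub_ne_zero.2 (hzs n).2)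
      simp only [Function.comp_apply]
      rw [abs_mul, abs_of_nonneg (sq_nonneg (u (zs n)))]
      calc |k (zs n)| * u (zs n) ^ 2 ≤ |zs n - x₀|⁻¹ * (B * |zs n - x₀|) ^ 2 := by
            rw [← sq_abs (u (zs n))]
            gcongr
            exacts [hk _ (hzs n).1 (hzs n).2, hLip _ (hzs n).1]
        _ = _ := by field_simp
  · simp only [hG]; exact lF.mul lu
  · simp only [hG]; exact lF.mul lw
  · simp only [hG]; exact (lM.mul lF).mul lu

end Slices

/-! ### The Carleman inequalities in divergence and non divergence form -/

section Comparison

variable {T x₀ d δ N : ℝ} {n : ℕ} {A ρ κ γ M M' D ψ k k' : ℝ → ℝ}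

/-- A version of the Carleman inequality in which the weights are replaced by comparable ones. -/
theorem CarlemanWeights.carleman_of_comparable
    (H : CarlemanWeights x₀ d δ N n A ρ κ γ M M' D ψ k k') (hT : 0 < T) {c : ℝ → ℝ → ℝ}
    (hc : MemLp (fun q : ℝ × ℝ => c q.1 q.2) ⊤ (muQ T)) {κ₁ γ₁ : ℝ → ℝ} {B : ℝ}
    (hκm : AEMeasurable κ₁ muI)
    (hκ : ∀ x ∈ Icc (0 : ℝ) 1, x ≠ x₀ → κ₁ x ^ 2 ≤ κ x ^ 2) (hB : 1 ≤ B)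
    (hγ1 : γ 1 ≤ B * γ₁ 1) (hγ0 : B * γ₁ 0 ≤ γ 0) :
    ∃ C > 0, ∃ s₀ > 0, ∀ v w p b G r h : ℝ → ℝ → ℝ, WeightedSolution T x₀ A ρ M k v w p b G r →
      (∀ᵐ q ∂muQ T, w q.1 q.2 + r q.1 q.2 / ρ q.2 - c q.1 q.2 * v q.1 q.2 = h q.1 q.2) →
      ∀ s ≥ s₀, Integrable (leftTerm T s 1 A κ₁ ψ v p) (muQ T) ∧
        Integrable (sourceTerm T s ρ ψ h) (muQ T) ∧
        Integrable (boundaryTerm T s d γ₁ ψ G) (volume.restrict (Ioo 0 T)) ∧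
        ∫ q, leftTerm T s 1 A κ₁ ψ v p q ∂(muQ T) ≤ C *
          ((∫ q, sourceTerm T s ρ ψ h q ∂(muQ T))
            + ∫ t in Ioo 0 T, boundaryTerm T s d γ₁ ψ G t) := by
  obtain ⟨Cc, -, hCc⟩ := exists_ae_abs_le hc
  obtain ⟨C, hC, s₀, hs₀, hmain⟩ := H.carleman hT hc.aestronglyMeasurable.aemeasurable hCc
  have hd := H.d_pos
  -- This factor removes `d` from both terms on the left, which carry `d` and `d³`.
  set m := d⁻¹ + (d ^ 3)⁻¹ with hm
  have hm0 : 0 < m := by positivity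
  have hm1 : 1 ≤ m * d := by
    have : m * d = 1 + (d ^ 3)⁻¹ * d := by rw [hm, add_mul, inv_mul_cancel₀ hd.ne']
    rw [this]; linarith [show 0 < (d ^ 3)⁻¹ * d by positivity]
  have hm3 : 1 ≤ m * d ^ 3 := by
    have : m * d ^ 3 = d⁻¹ * d ^ 3 + 1 := by
      rw [hm, add_mul, inv_mul_cancel₀ (pow_ne_zero 3 hd.ne')]
    rw [this]; linarith [show 0 < d⁻¹ * d ^ 3 by positivity]
  refine ⟨m * C * B, by positivity, s₀, hs₀, fun v w p b G r h hV heq s hs => ?_⟩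
  have hs0 : 0 < s := hs₀.trans_le hs
  obtain ⟨i1, i2, i3, hle⟩ := hmain v w p b G r h hV heq s hs
  have hpt : ∀ᵐ q ∂muQ T, 0 ≤ leftTerm T s 1 A κ₁ ψ v p q ∧
      leftTerm T s 1 A κ₁ ψ v p q ≤ m * leftTerm T s d A κ ψ v p q := by
    filter_upwards [ae_muQ_mem T x₀] with q hq
    have hΘ := Theta_pos hq.1
    have hA := H.A_pos _ hq.2.1 hq.2.2
    have hk := hκ _ hq.2.1 hq.2.2
    unfold leftTerm
    constructor
    · positivity
    · rw [mul_left_comm m]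
      gcongr
      rw [mul_add]
      refine add_le_add ?_ ?_
      · calc s * Theta T q.1 * 1 * A q.2 * p q.1 q.2 ^ 2
            = 1 * (s * Theta T q.1 * A q.2 * p q.1 q.2 ^ 2) := by ring
          _ ≤ m * d * (s * Theta T q.1 * A q.2 * p q.1 q.2 ^ 2) := by gcongr
          _ = _ := by ring
      · calc (s * Theta T q.1 * 1) ^ 3 * (κ₁ q.2 ^ 2 / A q.2) * v q.1 q.2 ^ 2
            = 1 * ((s * Theta T q.1) ^ 3 * (κ₁ q.2 ^ 2 / A q.2) * v q.1 q.2 ^ 2) := by ring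
          _ ≤ m * d ^ 3 * ((s * Theta T q.1) ^ 3 * (κ q.2 ^ 2 / A q.2) * v q.1 q.2 ^ 2) := by
            gcongr
          _ = _ := by ring
  have j1 : Integrable (leftTerm T s 1 A κ₁ ψ v p) (muQ T) := by
    refine (i1.const_mul m).mono' ?_ ?_
    · have m1 : AEMeasurable (fun q : ℝ × ℝ => Theta T q.1) (muQ T) :=
        ((measurable_Theta T).comp measurable_fst).aemeasurable
      exact ((H.aemeasurable_exp T s).mul (aemeasurable_quadratic
        (aemeasurable_snd_muQ T H.aemeasurable_A) (aemeasurable_snd_muQ T hκm)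
        (H.aemeasurable_v hV) (H.aemeasurable_p hV)
        ((m1.const_mul s).mul_const 1))).aestronglyMeasurable
    · filter_upwards [hpt] with q hq
      rw [Real.norm_of_nonneg hq.1]
      exact hq.2
  have j3 := H.integrable_boundaryTerm hV hs0 γ₁
  refine ⟨j1, i2, j3, ?_⟩
  have e1 : ∫ q, leftTerm T s 1 A κ₁ ψ v p q ∂(muQ T)
      ≤ m * ∫ q, leftTerm T s d A κ ψ v p q ∂(muQ T) := by
    rw [← integral_const_mul]
    exact integral_mono_ae j1 (i1.const_mul m) (hpt.mono fun q hq => hq.2)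
  have e2 : ∫ t in Ioo 0 T, boundaryTerm T s d γ ψ G t
      ≤ B * ∫ t in Ioo 0 T, boundaryTerm T s d γ₁ ψ G t := by
    rw [← integral_const_mul]
    refine integral_mono_ae i3 (j3.const_mul B) ?_
    filter_upwards [ae_restrict_mem measurableSet_Ioo] with t ht
    have hΘ := Theta_pos ht
    unfold boundaryTerm
    rw [mul_left_comm B]
    gcongr
    have f1 : γ 1 * G t 1 ^ 2 * Real.exp (2 * (s * Theta T t) * ψ 1)
        ≤ B * γ₁ 1 * G t 1 ^ 2 * Real.exp (2 * (s * Theta T t) * ψ 1) := by gcongr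
    have f0 : B * γ₁ 0 * G t 0 ^ 2 * Real.exp (2 * (s * Theta T t) * ψ 0)
        ≤ γ 0 * G t 0 ^ 2 * Real.exp (2 * (s * Theta T t) * ψ 0) := by gcongr
    linarith
  have e3 : 0 ≤ ∫ q, sourceTerm T s ρ ψ h q ∂(muQ T) := by
    refine integral_nonneg_of_ae ?_
    filter_upwards [H.ae_ρ_pos T] with q hq
    unfold sourceTerm
    simp only [Pi.zero_apply]
    positivity
  calc _ ≤ m * (C * ((∫ q, sourceTerm T s ρ ψ h q ∂(muQ T))
        + ∫ t in Ioo 0 T, boundaryTerm T s d γ ψ G t)) := e1.trans (by gcongr)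
    _ ≤ m * (C * (B * (∫ q, sourceTerm T s ρ ψ h q ∂(muQ T))
        + B * ∫ t in Ioo 0 T, boundaryTerm T s d γ₁ ψ G t)) := by
      gcongr
      exact le_mul_of_one_le_left e3 hB
    _ = _ := by ring

end Comparison

section Solutions

variable {T x₀ K : ℝ} {a : ℝ → ℝ} {v vt : ℝ → ℝ → ℝ}

theorem MemS1.weightedSolution (h : DegenerateCoefficient a x₀ K) (hT : 0 < T)
    (hv : MemS1 T a x₀ K v vt) :
    WeightedSolution T x₀ a (fun _ => 1) (fun _ => 1) (fun x => x - x₀) v vt (fun t => Dx (v t))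
      (fun t => Dx (vt t)) (fun t x => a x * Dx (v t) x)
      (fun t => Dx fun y => a y * Dx (v t) y) := by
  have hx₀ := h.x₀_mem
  have hpm : AEMeasurable (fun q : ℝ × ℝ => Dx (v q.1) q.2) (muQ T) := by
    refine aemeasurable_of_sqrt_mul (aemeasurable_snd_muQ T h.locAC.aemeasurable) ?_
      hv.memL2.sq_dx.aestronglyMeasurable.aemeasurable
    filter_upwards [ae_muQ_mem T x₀] with q hq using h.pos _ hq.2.1 hq.2.2
  have hd : ∀ e ∈ Icc (0 : ℝ) 1, e ≠ x₀ →
      AEMeasurable (fun t => a e * Dx (v t) e) (volume.restrict (Ioo 0 T)) := by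
    intro e he hne
    refine (hv.dt.aemeasurable_Dx hT he hne ?_).const_mul (a e)
    filter_upwards [hv.memL2.mem] with t ht
    obtain ⟨F, -, hF, -⟩ := ht.exists_flux h
    exact hF e he hne
  refine ⟨?_, ?_, ?_, hv.memL2.sq_dx, hv.memL2_dt.sq_dx, ?_, ?_,
    hd 0 h.zero_mem_ne.1 h.zero_mem_ne.2, hd 1 h.one_mem_ne.1 h.one_mem_ne.2⟩
  · filter_upwards [hv.memL2.mem, hv.memL2_dt.mem] with t h1 h2 using h1.sliceRegular h h2
  · simpa using hv.memL2.sq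
  · simpa using hv.memL2_dt.sq
  · simpa using hv.memL2.sq_dxx
  · refine hv.dt.time_regular hT hx₀ h.locAC h.pos (fun t ht => (hv.mem t ht).locAC hx₀) ?_ hpm
      hv.memL2_dt.sq_dx
    filter_upwards [hv.memL2_dt.mem] with t ht using ⟨ht.locAC hx₀, ht.2.2.2.1, ht.2.2.2.2⟩

theorem MemS2.weightedSolution {M k : ℝ → ℝ} {N : ℝ} (h : DegenerateCoefficient a x₀ K)
    (hT : 0 < T) (hv : MemS2 T a x₀ v vt) (hM : ContinuousOn M (Icc 0 1))
    (hk : (K < 1 ∧ ∀ x ∈ Icc (0 : ℝ) 1, x ≠ x₀ → |k x| ≤ N * |x - x₀| * (1 / a x)) ∨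
      (1 ≤ K ∧ ∀ x ∈ Icc (0 : ℝ) 1, x ≠ x₀ → |k x| ≤ |x - x₀|⁻¹)) :
    WeightedSolution T x₀ (fun _ => 1) (fun x => 1 / a x) M k v vt (fun t => Dx (v t))
      (fun t => Dx (vt t)) (fun t => Dx (v t)) (fun t => Dx (Dx (v t))) := by
  have hx₀ := h.x₀_mem
  have hpm : AEMeasurable (fun q : ℝ × ℝ => Dx (v q.1) q.2) (muQ T) :=
    hv.memL2.sq_dx.aestronglyMeasurable.aemeasurable
  have hd : ∀ e ∈ Icc (0 : ℝ) 1, e ≠ x₀ →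
      AEMeasurable (fun t => Dx (v t) e) (volume.restrict (Ioo 0 T)) := by
    intro e he hne
    refine hv.dt.aemeasurable_Dx hT he hne ?_
    filter_upwards [hv.memL2.mem] with t ht
    obtain ⟨F, -, -, hF, -⟩ := ht.exists_flux hx₀
    exact hF e he hne
  have hsq : ∀ x y : ℝ, √(1 / a x) * y = y / √(a x) := fun x y => by
    rw [one_div, Real.sqrt_inv, inv_mul_eq_div]
  have hsq' : ∀ x y : ℝ, y / √(1 / a x) = √(a x) * y := fun x y => by
    rw [one_div, Real.sqrt_inv, div_inv_eq_mul, mul_comm]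
  refine ⟨?_, ?_, ?_, ?_, ?_, ?_, ?_,
    hd 0 h.zero_mem_ne.1 h.zero_mem_ne.2, hd 1 h.one_mem_ne.1 h.one_mem_ne.2⟩
  · filter_upwards [hv.memL2.mem, hv.memL2_dt.mem] with t h1 h2 using h1.sliceRegular h h2 hM hk
  · simpa only [hsq] using hv.memL2.sq
  · simpa only [hsq] using hv.memL2_dt.sq
  · simpa using hv.memL2.sq_dx
  · simpa using hv.memL2_dt.sq_dx
  · simpa only [hsq'] using hv.memL2.sq_dxx
  · refine hv.dt.time_regular hT hx₀ (A := fun _ => 1) (LocAC.of_contDiff contDiff_const)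
      (fun _ _ _ => one_pos) (fun t ht => (hv.mem t ht).1.1.locAC hx₀) ?_ hpm
      (by simpa using hv.memL2_dt.sq_dx)
    filter_upwards [hv.memL2_dt.mem] with t ht using ⟨ht.1.1.locAC hx₀, ht.2.1, ht.2.2.1⟩

end Solutions

section Main

variable {T x₀ K : ℝ} {a : ℝ → ℝ} {c : ℝ → ℝ → ℝ}

theorem exp_weight_eq (T : ℝ) (ψ : ℝ → ℝ) (s t x : ℝ) :
    expWeight T ψ s t x = Real.exp (2 * (s * Theta T t) * ψ x) := by
  rw [expWeight]; congr 1; ring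

/-- A boundary term which is a multiple of the one in the unified setting. -/
theorem boundary_integral {s d : ℝ} (hT : 0 < T) (hs : 0 < s) (hd : 0 < d) {B F : ℝ → ℝ}
    (hB : ∀ t, F t = s * d * B t) (hF : Integrable F (volume.restrict (Ioo 0 T))) :
    IntervalIntegrable B volume 0 T ∧ ∫ t in Ioo 0 T, F t = s * d * ∫ t in (0 : ℝ)..T, B t := by
  constructor
  · rw [intervalIntegrable_iff_integrableOn_Ioo_of_le hT.le]
    refine (hF.const_mul (s * d)⁻¹).congr (ae_of_all _ fun t => ?_)
    simp only [hB]
    field_simp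
  · rw [intervalIntegral.integral_of_le hT.le, ← restrict_Ioo_eq_restrict_Ioc,
      ← integral_const_mul]
    simp only [hB]

theorem DegenerateCoefficient.carlemanDiv (h : DegenerateCoefficient a x₀ K) (hT : 0 < T)
    (hc : MemLp (fun q : ℝ × ℝ => c q.1 q.2) ⊤ (muQ T)) {c₁ c₂ : ℝ} (hc₁ : 0 < c₁)
    (hc₂ : max ((1 - x₀) ^ 2 / (a 1 * (2 - K))) (x₀ ^ 2 / (a 0 * (2 - K))) < c₂) :
    ∃ C > 0, ∃ s₀ > 0, ∀ f v : ℝ → ℝ → ℝ, IsDivSolution T a x₀ K c f v →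
      ∀ s ≥ s₀, CarlemanDiv T a x₀ c₁ c₂ C s f v := by
  obtain ⟨δ, N, H⟩ := h.carlemanWeights_div hc₁ hc₂
  obtain ⟨C, hC, s₀, hs₀, key⟩ := H.carleman_of_comparable hT hc (B := 1)
    (γ₁ := fun x => (x - x₀) / a x) H.κ_ac.ac.aemeasurable
    (fun _ _ _ => le_rfl) le_rfl (one_mul _).ge (one_mul _).le
  refine ⟨C, hC, s₀, hs₀, fun f v ⟨vt, hv, heq⟩ s hs => ?_⟩
  obtain ⟨i1, i2, i3, hle⟩ := key _ _ _ _ _ _ f (hv.weightedSolution h hT)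
    (by simpa only [div_one] using heq) s hs
  have h0 := (h.pos 0 h.zero_mem_ne.1 h.zero_mem_ne.2).ne'
  have h1 := (h.pos 1 h.one_mem_ne.1 h.one_mem_ne.2).ne'
  have hb := boundary_integral hT (hs₀.trans_le hs) hc₁ (B := fun t => bracket fun x =>
    a x * Theta T t * expWeight T (psiDiv a x₀ c₁ c₂) s t x * (x - x₀) * Dx (v t) x ^ 2)
    (fun t => by
      simp only [boundaryTerm, bracket, exp_weight_eq]
      field_simp) i3
  rw [hb.2] at hle
  have eL : ∀ q : ℝ × ℝ, leftTerm T s 1 a (fun x => x - x₀) (psiDiv a x₀ c₁ c₂) v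
      (fun t => Dx (v t)) q = (s * Theta T q.1 * a q.2 * Dx (v q.1) q.2 ^ 2
      + s ^ 3 * Theta T q.1 ^ 3 * ((q.2 - x₀) ^ 2 / a q.2) * v q.1 q.2 ^ 2)
        * expWeight T (psiDiv a x₀ c₁ c₂) s q.1 q.2 := fun q => by
    rw [leftTerm, exp_weight_eq]; ring
  have eH : ∀ q : ℝ × ℝ, sourceTerm T s (fun _ => 1) (psiDiv a x₀ c₁ c₂) f q
      = f q.1 q.2 ^ 2 * expWeight T (psiDiv a x₀ c₁ c₂) s q.1 q.2 := fun q => by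
    rw [sourceTerm, exp_weight_eq]; ring
  simp only [eL, eH] at hle
  exact ⟨i1.congr (ae_of_all _ eL), i2.congr (ae_of_all _ eH), hb.1, hle⟩

theorem DegenerateCoefficient.carlemanNonDiv (h : DegenerateCoefficient a x₀ K) (hT : 0 < T)
    (hc : MemLp (fun q : ℝ × ℝ => c q.1 q.2) ⊤ (muQ T))
    (hQ : MemW1ae ⊤ (fun x => (x - x₀) * Dx a x / a x)) {d₁ d₂ R : ℝ} (hd₁ : 0 < d₁) (hR : 0 < R)
    (hd₂ : max ((1 - x₀) ^ 2 * Real.exp (R * (1 - x₀) ^ 2) / ((2 - K) * a 1))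
      (x₀ ^ 2 * Real.exp (R * x₀ ^ 2) / ((2 - K) * a 0)) < d₂) :
    ∃ C > 0, ∃ s₀ > 0, ∀ f v : ℝ → ℝ → ℝ, IsNonDivSolution T a x₀ c f v →
      ∀ s ≥ s₀, CarlemanNonDiv T a x₀ d₁ d₂ R C s f v := by
  obtain ⟨Q, hQ, hQa⟩ := hQ
  obtain ⟨δ, N, n, M, M', D, k, k', H, hM, hk⟩ :=
    h.carlemanWeights_nonDiv hQ hQa hd₁ hR.le hd₂
  have e1 := one_le_gaussFactor hR.le x₀
  -- The Gaussian factor is at least one, so it may be dropped from `κ` on the left side. At the end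
  -- points it is at most `e^R`, which goes into the constant of the boundary term.
  obtain ⟨C, hC, s₀, hs₀, key⟩ := H.carleman_of_comparable hT hc (B := Real.exp R)
    (κ₁ := fun x => (x - x₀) / a x) (γ₁ := fun x => x - x₀) h.locACDeriv_div.ac.aemeasurable
    (fun x _ _ => by
      have : (x - x₀) * gaussFactor x₀ R x / a x = (x - x₀) / a x * gaussFactor x₀ R x := by ring
      rw [this, mul_pow]
      exact le_mul_of_one_le_right (sq_nonneg _) (one_le_pow₀ (e1 x)))
    (Real.one_le_exp hR.le)
    (by
      rw [mul_comm]
      exact mul_le_mul_of_nonneg_right (gaussFactor_le hR.le h.x₀_mem h.one_mem_ne.1)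
        (sub_nonneg.2 h.x₀_mem.2.le))
    (by
      rw [mul_comm]
      exact mul_le_mul_of_nonpos_left (gaussFactor_le hR.le h.x₀_mem h.zero_mem_ne.1)
        (sub_nonpos.2 h.x₀_mem.1.le))
  refine ⟨C, hC, s₀, hs₀, fun f v ⟨vt, hv, heq⟩ s hs => ?_⟩
  obtain ⟨i1, i2, i3, hle⟩ := key _ _ _ _ _ _ f (hv.weightedSolution h hT hM hk)
    (by
      filter_upwards [heq] with q hq
      rw [← hq, one_div, div_inv_eq_mul, mul_comm (a q.2)]) s hs
  have hb := boundary_integral hT (hs₀.trans_le hs) hd₁ (B := fun t => bracket fun x =>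
    Theta T t * expWeight T (psiNonDiv a x₀ d₁ d₂ R) s t x * (x - x₀) * Dx (v t) x ^ 2)
    (fun t => by
      simp only [boundaryTerm, bracket, exp_weight_eq]
      ring) i3
  rw [hb.2] at hle
  have eL : ∀ q : ℝ × ℝ, leftTerm T s 1 (fun _ => 1) (fun x => (x - x₀) / a x)
      (psiNonDiv a x₀ d₁ d₂ R) v (fun t => Dx (v t)) q = (s * Theta T q.1 * Dx (v q.1) q.2 ^ 2
      + s ^ 3 * Theta T q.1 ^ 3 * ((q.2 - x₀) / a q.2) ^ 2 * v q.1 q.2 ^ 2)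
        * expWeight T (psiNonDiv a x₀ d₁ d₂ R) s q.1 q.2 := fun q => by
    rw [leftTerm, exp_weight_eq]; ring
  have eH : ∀ q : ℝ × ℝ, sourceTerm T s (fun x => 1 / a x) (psiNonDiv a x₀ d₁ d₂ R) f q
      = f q.1 q.2 ^ 2 * (expWeight T (psiNonDiv a x₀ d₁ d₂ R) s q.1 q.2 / a q.2) := fun q => by
    rw [sourceTerm, exp_weight_eq]; ring
  simp only [eL, eH] at hle
  exact ⟨i1.congr (ae_of_all _ eL), i2.congr (ae_of_all _ eH), hb.1, hle⟩

end Main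

end DegenerateCarleman

end

theorem corollary6p1 (T : ℝ) (hT : 0 < T) (a : ℝ → ℝ) (x₀ K : ℝ) (c : ℝ → ℝ → ℝ)
    (hc : MeasureTheory.MemLp (fun p : ℝ × ℝ => c p.1 p.2) ⊤ (DegenerateCarleman.muQ T)) :
    (DegenerateCarleman.DivergenceHypothesis a x₀ K →
      ∀ c₁ c₂ : ℝ, 0 < c₁ →
        max ((1 - x₀) ^ 2 / (a 1 * (2 - K))) (x₀ ^ 2 / (a 0 * (2 - K))) < c₂ →
        ∃ C > 0, ∃ s₀ > 0, ∀ h v : ℝ → ℝ → ℝ,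
          DegenerateCarleman.IsDivSolution T a x₀ K c h v →
          ∀ s ≥ s₀, DegenerateCarleman.CarlemanDiv T a x₀ c₁ c₂ C s h v) ∧
    (DegenerateCarleman.NonDivergenceHypothesis a x₀ K →
      ∀ d₁ d₂ R : ℝ, 0 < d₁ → 0 < R →
        max ((1 - x₀) ^ 2 * Real.exp (R * (1 - x₀) ^ 2) / ((2 - K) * a 1))
          (x₀ ^ 2 * Real.exp (R * x₀ ^ 2) / ((2 - K) * a 0)) < d₂ →
        ∃ C > 0, ∃ s₀ > 0, ∀ h v : ℝ → ℝ → ℝ,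
          DegenerateCarleman.IsNonDivSolution T a x₀ c h v →
          ∀ s ≥ s₀, DegenerateCarleman.CarlemanNonDiv T a x₀ d₁ d₂ R C s h v) := by
  constructor
  · rintro ⟨h, -⟩ c₁ c₂ hc₁ hc₂
    exact (h.elim (·.degenerateCoefficient) (·.degenerateCoefficient)).carlemanDiv hT hc hc₁ hc₂
  · rintro ⟨h, hQ, -⟩ d₁ d₂ R hd₁ hR hd₂
    exact (h.elim (·.degenerateCoefficient) (·.degenerateCoefficient)).carlemanNonDiv hT hc hQ
      hd₁ hR hd₂
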